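/- Let $\ell$ be an odd positive integer and let $\xi\in\mathbb C^*$ be a primitive $\ell$-th root of unity. Let $\mathbf U$ be the Drinfeld--Jimbo quantum group of $\mathfrak{sl}_2$ over $\mathbb Q(v)$, with generators $E,F,K^{\pm1}$, let $\mathbf U_{\mathcal A}$ be Lusztig's integral form, i.e. the subalgebra over $\mathcal A=\mathbb Z[v,v^{-1}]$ generated by $K^{\pm1}$ and the quantum divided powers $E^{(n)},F^{(n)}$ ($n\ge0$), and put $$\mathbf U_\ell=\mathbf U_\ell(\mathfrak{sl}_2)=(\mathbf U_{\mathcal A}\otimes_{\mathcal A}\mathbb C)/(K^\ell-1),$$ where $v$ acts on $\mathbb C$ by $\xi$. Let $\mathbf U_\ell^0\subset\mathbf U_\ell$ be the subalgebra generated by $K^{\pm1}$ and the elements $\left[{K;c\atop t}\right]=\prod_{s=1}^{t}\frac{Kv^{c-s+1}-K^{-1}v^{-(c-s+1)}}{v^s-v^{-s}}$ ($c\in\mathbb Z$, $t\ge0$), and let $\mathbf B_\ell^+$ (resp. $\mathbf B_\ell^-$) be the subalgebra generated by $\mathbf U_\ell^0$ and all $E^{(n)}$ (resp. all $F^{(n)}$).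 Identify the weight lattice with $\mathbb Z$. For $\lambda\in\mathbb Z$ let $\mathbb C(\lambda)$ be the one-dimensional module of weight $\lambda$ over $\mathbf B_\ell^{+}$ or over $\mathbf B_\ell^-$: $K$ acts by $\xi^\lambda$, $\left[{K;c\atop t}\right]$ by the quantum binomial coefficient $\left[{\lambda+c\atop t}\right]$ at $v=\xi$, and $E^{(n)}$, resp. $F^{(n)}$, by $0$ for $n\ge1$. Let $s\cdot\lambda=-\lambda-2$ be the dot action of the simple reflection $s$. Define: * $M^e_\ell(\lambda)=\mathbf U_\ell\otimes_{\mathbf B_\ell^+}\mathbb C(\lambda)$, the Verma module; * for $\lambda\ge0$, $W_\ell(\lambda)$, the Weyl module: the maximal finite-dimensional quotient of $M^e_\ell(\lambda)$; * $M^s_\ell(\lambda)=S\otimes_{\mathbf B_\ell^-}\mathbb C(\lambda)$, the quasi-Verma module of highest weight $\lambda$ twisted by $s$, semiinfinitely induced from the twisted Borel subalgebra $s(\mathbf B^+_\ell)=\mathbf B^-_\ell$. Here $S$ is the semiregular module of $\mathbf U_\ell$ with respect to $\mathbf U_\ell=\mathbf B_\ell^-\otimes\mathbf U_\ell^+$,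 in its realization as the space of graded homomorphisms of left $\mathbf B_\ell^-$-modules $\mathbf U_\ell\to\mathbf B_\ell^-$ (sums of homogeneous ones, for the grading $\deg E^{(n)}=n$, $\deg F^{(n)}=-n$, $\deg K=0$), with the left $\mathbf U_\ell$-action $(u\varphi)(x)=\varphi(xu)$ and the right $\mathbf B_\ell^-$-action $(\varphi b)(x)=\varphi(x)b$. Then for every integer $\mu\ge0$ (divisible by $\ell$ or not) there exists an exact sequence of $\mathbf U_\ell$-modules $$0\longrightarrow M^s_\ell(s\cdot\mu)\longrightarrow M^e_\ell(\mu)\longrightarrow W_\ell(\mu)\longrightarrow0 .$$ -/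

import Mathlib

set_option linter.unusedSimpArgs false

open LaurentPolynomial TensorProduct

noncomputable section

namespace QuantumSl2

/-! ### The Drinfeld-Jimbo algebra over the field of rational functions -/

/-- The field `ℚ(v)`. -/
abbrev Qv : Type := RatFunc ℚ

/-- The indeterminate `v`. -/
def v : Qv := RatFunc.X

/-- The generators `E, F, K, K⁻¹`. -/
inductive Gen : Type
  | E | F | K | Kinv

/-- The defining relations of the quantum group of `sl₂`. -/
inductive Rel : FreeAlgebra Qv Gen → FreeAlgebra Qv Gen → Prop
  | K_Kinv : Rel (FreeAlgebra.ι Qv Gen.K * FreeAlgebra.ι Qv Gen.Kinv) 1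
  | Kinv_K : Rel (FreeAlgebra.ι Qv Gen.Kinv * FreeAlgebra.ι Qv Gen.K) 1
  | K_E : Rel (FreeAlgebra.ι Qv Gen.K * FreeAlgebra.ι Qv Gen.E)
      (v ^ (2 : ℤ) • (FreeAlgebra.ι Qv Gen.E * FreeAlgebra.ι Qv Gen.K))
  | K_F : Rel (FreeAlgebra.ι Qv Gen.K * FreeAlgebra.ι Qv Gen.F)
      (v ^ (-2 : ℤ) • (FreeAlgebra.ι Qv Gen.F * FreeAlgebra.ι Qv Gen.K))
  | E_F : Rel (FreeAlgebra.ι Qv Gen.E * FreeAlgebra.ι Qv Gen.F)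
      (FreeAlgebra.ι Qv Gen.F * FreeAlgebra.ι Qv Gen.E +
        (v - v⁻¹)⁻¹ • (FreeAlgebra.ι Qv Gen.K - FreeAlgebra.ι Qv Gen.Kinv))

/-- The Drinfeld-Jimbo quantum group of `sl₂` over `ℚ(v)`. -/
def U : Type := RingQuot Rel

instance : Ring U := inferInstanceAs (Ring (RingQuot Rel))

instance : Algebra Qv U := inferInstanceAs (Algebra Qv (RingQuot Rel))

/-- The canonical map from the free algebra. -/
def toU : FreeAlgebra Qv Gen →ₐ[Qv] U := RingQuot.mkAlgHom Qv Rel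

lemma toU_rel {x y : FreeAlgebra Qv Gen} (h : Rel x y) : toU x = toU y :=
  RingQuot.mkAlgHom_rel Qv h

/-- The image of a generator in `U`. -/
def gen (g : Gen) : U := toU (FreeAlgebra.ι Qv g)

/-- The quantum integer `[n] = (vⁿ - v⁻ⁿ) / (v - v⁻¹)`. -/
def qInt (n : ℤ) : Qv := (v ^ n - v ^ (-n)) / (v - v⁻¹)

/-- The quantum factorial `[n]! = [1][2]⋯[n]`. -/
def qFact (n : ℕ) : Qv := ∏ i ∈ Finset.range n, qInt (i + 1)

/-- The quantum divided power `x⁽ⁿ⁾ = xⁿ / [n]!`. -/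
def divPow (x : U) (n : ℕ) : U := (qFact n)⁻¹ • x ^ n

/-- The element `[K; c] = (K vᶜ - K⁻¹ v⁻ᶜ) / (v - v⁻¹)`. -/
def qK (c : ℤ) : U := (v - v⁻¹)⁻¹ • (v ^ c • gen Gen.K - v ^ (-c) • gen Gen.Kinv)

/-- Lusztig's element
`[K; c; t] = ∏_{s=1}^{t} (K v^{c-s+1} - K⁻¹ v^{-(c-s+1)}) / (v^s - v^{-s})`. -/
def binK (c : ℤ) : ℕ → U
  | 0 => 1
  | t + 1 => binK c t * ((v ^ ((t : ℤ) + 1) - v ^ (-((t : ℤ) + 1)))⁻¹ •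
      (v ^ (c - t) • gen Gen.K - v ^ (-(c - t)) • gen Gen.Kinv))

/-! ### Lusztig's integral form -/

/-- The ring `𝒜 = ℤ[v, v⁻¹]`. -/
abbrev A : Type := ℤ[T;T⁻¹]

lemma v_ne_zero : v ≠ 0 := RatFunc.X_ne_zero

/-- The inclusion `ℤ[v, v⁻¹] ⊆ ℚ(v)`. -/
instance : Algebra A Qv :=
  (LaurentPolynomial.eval₂ (Int.castRingHom Qv) (Units.mk0 v v_ne_zero)).toAlgebra

instance : Algebra A U := Algebra.compHom U (algebraMap A Qv)

/-- Lusztig's integral form: the `𝒜`-subalgebra of `U` generated by the quantum divided powers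
`E⁽ⁿ⁾`, `F⁽ⁿ⁾` and by `K`, `K⁻¹`. -/
def UA : Subalgebra A U :=
  Algebra.adjoin A
    (Set.range (divPow (gen Gen.E)) ∪ Set.range (divPow (gen Gen.F)) ∪
      {gen Gen.K, gen Gen.Kinv})

lemma E_mem (n : ℕ) : divPow (gen Gen.E) n ∈ UA :=
  Algebra.subset_adjoin (Or.inl (Or.inl ⟨n, rfl⟩))

lemma F_mem (n : ℕ) : divPow (gen Gen.F) n ∈ UA :=
  Algebra.subset_adjoin (Or.inl (Or.inr ⟨n, rfl⟩))

lemma K_mem : gen Gen.K ∈ UA := Algebra.subset_adjoin (Or.inr (Or.inl rfl))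

lemma Kinv_mem : gen Gen.Kinv ∈ UA := Algebra.subset_adjoin (Or.inr (Or.inr rfl))

/-! The elements `[K; c; t]` belong to the integral form. -/

lemma K_Kinv : gen Gen.K * gen Gen.Kinv = 1 := by
  simpa [gen] using toU_rel Rel.K_Kinv

lemma Kinv_K : gen Gen.Kinv * gen Gen.K = 1 := by
  simpa [gen] using toU_rel Rel.Kinv_K

lemma K_E : gen Gen.K * gen Gen.E = v ^ (2 : ℤ) • (gen Gen.E * gen Gen.K) := by
  simpa [gen] using toU_rel Rel.K_E

lemma K_F : gen Gen.K * gen Gen.F = v ^ (-2 : ℤ) • (gen Gen.F * gen Gen.K) := by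
  simpa [gen] using toU_rel Rel.K_F

lemma E_F : gen Gen.E * gen Gen.F =
    gen Gen.F * gen Gen.E + (v - v⁻¹)⁻¹ • (gen Gen.K - gen Gen.Kinv) := by
  simpa [gen] using toU_rel Rel.E_F

lemma E_K : gen Gen.E * gen Gen.K = v ^ (-2 : ℤ) • (gen Gen.K * gen Gen.E) := by
  rw [K_E, smul_smul, ← zpow_add₀ v_ne_zero]; simp

lemma E_Kinv : gen Gen.E * gen Gen.Kinv = v ^ (2 : ℤ) • (gen Gen.Kinv * gen Gen.E) := by
  calc gen Gen.E * gen Gen.Kinv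
      = gen Gen.Kinv * (gen Gen.K * gen Gen.E) * gen Gen.Kinv := by
        rw [← mul_assoc, Kinv_K, one_mul]
    _ = v ^ (2 : ℤ) • (gen Gen.Kinv * gen Gen.E * (gen Gen.K * gen Gen.Kinv)) := by
        rw [K_E]; simp only [mul_smul_comm, smul_mul_assoc, mul_assoc]
    _ = _ := by rw [K_Kinv, mul_one]

lemma F_Kinv : gen Gen.F * gen Gen.Kinv = v ^ (-2 : ℤ) • (gen Gen.Kinv * gen Gen.F) := by
  calc gen Gen.F * gen Gen.Kinv
      = gen Gen.Kinv * (gen Gen.K * gen Gen.F) * gen Gen.Kinv := by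
        rw [← mul_assoc, Kinv_K, one_mul]
    _ = v ^ (-2 : ℤ) • (gen Gen.Kinv * gen Gen.F * (gen Gen.K * gen Gen.Kinv)) := by
        rw [K_F]; simp only [mul_smul_comm, smul_mul_assoc, mul_assoc]
    _ = _ := by rw [K_Kinv, mul_one]

lemma F_K : gen Gen.F * gen Gen.K = v ^ (2 : ℤ) • (gen Gen.K * gen Gen.F) := by
  rw [K_F, smul_smul, ← zpow_add₀ v_ne_zero]; simp

lemma aux_one {R M : Type*} [CommRing R] [AddCommGroup M] [Module R M]
    (a b c : R) (x y : M) :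
    a • x - b • y + (c • x - c • y) = (a + c) • x - (b + c) • y := by module

lemma aux_two {R M : Type*} [CommRing R] [AddCommGroup M] [Module R M]
    (a b c d : R) (x y : M) :
    a • x - b • y + (c • x - d • y) = (a + c) • x - (b + d) • y := by module

lemma aux_three {R M : Type*} [CommRing R] [AddCommGroup M] [Module R M]
    (a b c : R) (x y : M) :
    a • x - (b - c) • y = a • x - b • y + c • y := by module

lemma v_pow_ne {n : ℤ} (hn : 0 < n) : v ^ n - v ^ (-n) ≠ 0 := by
  intro h
  obtain ⟨m, rfl⟩ := Int.eq_ofNat_of_zero_le hn.le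
  have hm : m ≠ 0 := by rintro rfl; simp at hn
  have h1 : v ^ (m + m) = 1 := by
    have h2 : v ^ (m : ℤ) = v ^ (-(m : ℤ)) := sub_eq_zero.mp h
    have h3 : v ^ (m : ℤ) * v ^ (m : ℤ) = 1 := by
      nth_rewrite 2 [h2]
      rw [← zpow_add₀ v_ne_zero]; simp
    rw [pow_add]; simpa using h3
  have h4 : (algebraMap (Polynomial ℚ) Qv) (Polynomial.X ^ (m + m)) =
      (algebraMap (Polynomial ℚ) Qv) 1 := by
    rw [map_pow, RatFunc.algebraMap_X, map_one]; exact h1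
  have h5 := RatFunc.algebraMap_injective ℚ h4
  have h6 := congrArg Polynomial.natDegree h5
  simp at h6
  exact hm h6

lemma v_sub_ne : v - v⁻¹ ≠ 0 := by
  have := v_pow_ne (n := 1) one_pos
  simpa using this

lemma qInt_ne {n : ℤ} (hn : 0 < n) : qInt n ≠ 0 := div_ne_zero (v_pow_ne hn) v_sub_ne

lemma qFact_succ (n : ℕ) : qFact (n + 1) = qFact n * qInt (n + 1) := by
  simp [qFact, Finset.prod_range_succ]

lemma qFact_ne (n : ℕ) : qFact n ≠ 0 :=
  Finset.prod_ne_zero_iff.mpr fun i _ => qInt_ne (by positivity)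

lemma mul_divPow (x : U) (n : ℕ) : x * divPow x n = qInt (n + 1) • divPow x (n + 1) := by
  have h1 := qFact_ne n
  have h2 : qInt ((n : ℤ) + 1) ≠ 0 := qInt_ne (by positivity)
  rw [divPow, divPow, mul_smul_comm, ← pow_succ', smul_smul, qFact_succ]
  congr 1
  field_simp

lemma divPow_mul (x : U) (n : ℕ) : divPow x n * x = qInt (n + 1) • divPow x (n + 1) := by
  rw [← mul_divPow, divPow, smul_mul_assoc, mul_smul_comm, ← pow_succ, ← pow_succ']

lemma binK_succ (c : ℤ) (t : ℕ) :
    binK c (t + 1) = (qInt (t + 1))⁻¹ • (binK c t * qK (c - t)) := by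
  have h2 := v_sub_ne
  rw [binK, qK, mul_smul_comm, mul_smul_comm, smul_smul, qInt, inv_div, div_eq_mul_inv,
    mul_right_comm, mul_inv_cancel₀ h2, one_mul]

lemma qK_comm (c d : ℤ) : qK c * qK d = qK d * qK c := by
  have h : gen Gen.K * gen Gen.Kinv = gen Gen.Kinv * gen Gen.K := by rw [K_Kinv, Kinv_K]
  have h1 : Commute (gen Gen.K) (gen Gen.Kinv) := h
  have h2 : ∀ c : ℤ, Commute (qK c) (gen Gen.K) := fun c =>
    ((((Commute.refl _).smul_left _).sub_left (h1.symm.smul_left _)).smul_left _)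
  have h3 : ∀ c : ℤ, Commute (qK c) (gen Gen.Kinv) := fun c =>
    (((h1.smul_left _).sub_left ((Commute.refl _).smul_left _)).smul_left _)
  exact (((h2 c).smul_right _).sub_right ((h3 c).smul_right _)).smul_right _

lemma qK_binK (c d : ℤ) (t : ℕ) : qK c * binK d t = binK d t * qK c := by
  induction t with
  | zero => simp [binK]
  | succ t ih =>
    rw [binK_succ, mul_smul_comm, smul_mul_assoc, ← mul_assoc, ih, mul_assoc, qK_comm, mul_assoc]

lemma binK_succ' (c : ℤ) (t : ℕ) :
    binK (c + 1) (t + 1) = (qInt (t + 1))⁻¹ • (qK (c + 1) * binK c t) := by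
  induction t with
  | zero => rw [binK_succ]; simp [binK]
  | succ t ih =>
    rw [binK_succ, ih, binK_succ c t]
    simp only [smul_mul_assoc, mul_smul_comm, smul_smul, mul_assoc]
    push_cast
    rw [show c + 1 - ((t : ℤ) + 1) = c - t by ring]

lemma E_qK (c : ℤ) : gen Gen.E * qK c = qK (c - 2) * gen Gen.E := by
  have h := v_ne_zero
  simp only [qK, smul_mul_assoc, mul_smul_comm, mul_sub, sub_mul, E_K, E_Kinv, smul_smul]
  rw [← zpow_add₀ h, ← zpow_add₀ h]
  congr 4; ring_nf

lemma F_qK (c : ℤ) : gen Gen.F * qK c = qK (c + 2) * gen Gen.F := by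
  have h := v_ne_zero
  simp only [qK, smul_mul_assoc, mul_smul_comm, mul_sub, sub_mul, F_K, F_Kinv, smul_smul]
  rw [← zpow_add₀ h, ← zpow_add₀ h]
  congr 4; ring_nf

lemma E_binK (c : ℤ) (t : ℕ) : gen Gen.E * binK c t = binK (c - 2) t * gen Gen.E := by
  induction t with
  | zero => simp [binK]
  | succ t ih =>
    rw [binK_succ, binK_succ, mul_smul_comm, ← mul_assoc, ih, mul_assoc, E_qK, smul_mul_assoc,
      mul_assoc, show c - (t : ℤ) - 2 = c - 2 - t by ring]

/-- `E F⁽ˢ⁺¹⁾ = F⁽ˢ⁺¹⁾ E + F⁽ˢ⁾ [K; -s]`. -/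
lemma E_divPow_F (s : ℕ) : gen Gen.E * divPow (gen Gen.F) (s + 1) =
    divPow (gen Gen.F) (s + 1) * gen Gen.E + divPow (gen Gen.F) s * qK (-s) := by
  have hv := v_ne_zero
  have hd := v_sub_ne
  induction s with
  | zero =>
    have h1 : qInt 1 = 1 := by simp [qInt, hd]
    simp [divPow, qFact, h1, qK, E_F]
  | succ s ih =>
    have h2 : qInt ((s : ℤ) + 1 + 1) ≠ 0 := qInt_ne (by positivity)
    have key : qInt (((s + 1 : ℕ) : ℤ) + 1) • (gen Gen.E * divPow (gen Gen.F) (s + 1 + 1)) =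
        qInt (((s + 1 : ℕ) : ℤ) + 1) • (divPow (gen Gen.F) (s + 1 + 1) * gen Gen.E +
          divPow (gen Gen.F) (s + 1) * qK (-((s + 1 : ℕ) : ℤ))) := by
      have h3 : gen Gen.E * gen Gen.F = gen Gen.F * gen Gen.E + qK 0 := by
        simp [qK, E_F]
      have h4 : qInt ((s : ℤ) + 1) • qK (-s - 2) + qK 0 =
          qInt ((s : ℤ) + 1 + 1) • qK (-((s : ℤ) + 1)) := by
        have e1 : qInt ((s : ℤ) + 1) * ((v - v⁻¹)⁻¹ * v ^ (-(s : ℤ) - 2)) + (v - v⁻¹)⁻¹ =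
          qInt ((s : ℤ) + 1 + 1) * ((v - v⁻¹)⁻¹ * v ^ (-((s : ℤ) + 1))) := by
          have hs : v ^ (s : ℤ) ≠ 0 := zpow_ne_zero _ hv
          simp only [qInt, neg_add_rev, neg_neg, neg_sub, zpow_add₀ hv, zpow_sub₀ hv, zpow_neg,
            zpow_one]
          simp only [show (2 : ℤ) = 1 + 1 by norm_num, zpow_add₀ hv, zpow_one]
          field_simp
          ring
        have e2 : qInt ((s : ℤ) + 1) * ((v - v⁻¹)⁻¹ * v ^ (-(-(s : ℤ) - 2))) + (v - v⁻¹)⁻¹ =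
          qInt ((s : ℤ) + 1 + 1) * ((v - v⁻¹)⁻¹ * v ^ (-(-((s : ℤ) + 1)))) := by
          have hs : v ^ (s : ℤ) ≠ 0 := zpow_ne_zero _ hv
          simp only [qInt, neg_add_rev, neg_neg, neg_sub, zpow_add₀ hv, zpow_sub₀ hv, zpow_neg,
            zpow_one]
          simp only [show (2 : ℤ) = 1 + 1 by norm_num, zpow_add₀ hv, zpow_one]
          field_simp
          ring
        simp only [qK, smul_sub, smul_smul, neg_zero, zpow_zero, mul_one]
        rw [← e1, ← e2]
        exact aux_one _ _ _ _ _
      rw [← mul_smul_comm, ← divPow_mul, ← mul_assoc, ih, add_mul, mul_assoc, h3, mul_add,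
        ← mul_assoc, divPow_mul]
      have h5 : qK (-(s : ℤ)) * gen Gen.F = gen Gen.F * qK (-s - 2) := by
        rw [F_qK]; congr 2; ring
      rw [mul_assoc (divPow (gen Gen.F) s), h5, ← mul_assoc, divPow_mul]
      push_cast
      rw [smul_add, ← mul_smul_comm _ _ (qK _), ← h4, mul_add, mul_smul_comm, smul_mul_assoc,
        smul_mul_assoc]
      abel
    have := congrArg (fun x => (qInt (((s + 1 : ℕ) : ℤ) + 1))⁻¹ • x) key
    push_cast at this ⊢
    simpa [smul_smul, inv_mul_cancel₀ h2] using this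

lemma coeff_identity (i r s : ℕ) :
    qInt ((r : ℤ) - i) • binK (2 * i - r - s) (i + 1) +
        qK (1 - s + i) * binK (2 * i - r - s) i =
      qInt ((r : ℤ) + 1) • binK (2 * i - r - s + 1) (i + 1) := by
  have hv := v_ne_zero
  have hd := v_sub_ne
  have hi : qInt ((i : ℤ) + 1) ≠ 0 := qInt_ne (by positivity)
  have h4 : qInt ((r : ℤ) - i) • qK (2 * i - r - s - i) + qInt ((i : ℤ) + 1) • qK (1 - s + i) =
      qInt ((r : ℤ) + 1) • qK (2 * i - r - s + 1) := by
    have e1 : qInt ((r : ℤ) - i) * ((v - v⁻¹)⁻¹ * v ^ (2 * (i : ℤ) - r - s - i)) +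
        qInt ((i : ℤ) + 1) * ((v - v⁻¹)⁻¹ * v ^ (1 - (s : ℤ) + i)) =
        qInt ((r : ℤ) + 1) * ((v - v⁻¹)⁻¹ * v ^ (2 * (i : ℤ) - r - s + 1)) := by
      have h1 : v ^ (s : ℤ) ≠ 0 := zpow_ne_zero _ hv
      have h2 : v ^ (r : ℤ) ≠ 0 := zpow_ne_zero _ hv
      have h3 : v ^ (i : ℤ) ≠ 0 := zpow_ne_zero _ hv
      simp only [qInt, neg_add_rev, neg_neg, neg_sub, two_mul, zpow_add₀ hv, zpow_sub₀ hv,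
        zpow_neg, zpow_one]
      field_simp
      ring
    have e2 : qInt ((r : ℤ) - i) * ((v - v⁻¹)⁻¹ * v ^ (-(2 * (i : ℤ) - r - s - i))) +
        qInt ((i : ℤ) + 1) * ((v - v⁻¹)⁻¹ * v ^ (-(1 - (s : ℤ) + i))) =
        qInt ((r : ℤ) + 1) * ((v - v⁻¹)⁻¹ * v ^ (-(2 * (i : ℤ) - r - s + 1))) := by
      have h1 : v ^ (s : ℤ) ≠ 0 := zpow_ne_zero _ hv
      have h2 : v ^ (r : ℤ) ≠ 0 := zpow_ne_zero _ hv
      have h3 : v ^ (i : ℤ) ≠ 0 := zpow_ne_zero _ hv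
      simp only [qInt, neg_add_rev, neg_neg, neg_sub, two_mul, zpow_add₀ hv, zpow_sub₀ hv,
        zpow_neg, zpow_one]
      field_simp
      ring
    simp only [qK, smul_sub, smul_smul]
    rw [← e1, ← e2]
    exact aux_two _ _ _ _ _ _
  rw [binK_succ', smul_comm, ← smul_mul_assoc, ← h4, binK_succ, add_mul,
    smul_add, smul_mul_assoc, smul_mul_assoc, smul_smul _ (qInt ((i : ℤ) + 1)),
    inv_mul_cancel₀ hi, one_smul, ← qK_binK, smul_comm]

/-- `E⁽ʳ⁾ F⁽ˢ⁾ = ∑ⱼ F⁽ˢ⁻ʲ⁾ [K; 2j-r-s; j] E⁽ʳ⁻ʲ⁾`. -/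
lemma divPow_E_divPow_F (r s : ℕ) (h : r ≤ s) :
    divPow (gen Gen.E) r * divPow (gen Gen.F) s =
      ∑ j ∈ Finset.range (r + 1), divPow (gen Gen.F) (s - j) * binK (2 * j - r - s) j *
        divPow (gen Gen.E) (r - j) := by
  induction r with
  | zero => simp [divPow, qFact, binK]
  | succ r ih =>
    have hr : qInt ((r : ℤ) + 1) ≠ 0 := qInt_ne (by positivity)
    have key : qInt ((r : ℤ) + 1) • (divPow (gen Gen.E) (r + 1) * divPow (gen Gen.F) s) =
        qInt ((r : ℤ) + 1) • ∑ j ∈ Finset.range (r + 1 + 1), divPow (gen Gen.F) (s - j) *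
          binK (2 * j - (r + 1 : ℕ) - s) j * divPow (gen Gen.E) (r + 1 - j) := by
      rw [← smul_mul_assoc, ← mul_divPow, mul_assoc, ih (by omega), Finset.mul_sum]
      have step : ∀ j ∈ Finset.range (r + 1),
          gen Gen.E * (divPow (gen Gen.F) (s - j) * binK (2 * j - r - s) j *
            divPow (gen Gen.E) (r - j)) =
          qInt ((r : ℤ) + 1 - j) • (divPow (gen Gen.F) (s - j) * binK (2 * j - r - s - 2) j *
            divPow (gen Gen.E) (r + 1 - j)) +
          divPow (gen Gen.F) (s - (j + 1)) * (qK (1 - s + j) * binK (2 * j - r - s) j) *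
            divPow (gen Gen.E) (r - j) := by
        intro j hj
        have hj' : j ≤ r := by simpa [Nat.lt_succ_iff] using hj
        obtain ⟨p, rfl⟩ : ∃ p, s = p + 1 + j := ⟨s - 1 - j, by omega⟩
        obtain ⟨q, rfl⟩ : ∃ q, r = q + j := ⟨r - j, by omega⟩
        rw [show p + 1 + j - j = p + 1 by omega, show p + 1 + j - (j + 1) = p by omega,
          show q + j - j = q by omega, show q + j + 1 - j = q + 1 by omega, ← mul_assoc,
          ← mul_assoc, E_divPow_F, add_mul, add_mul, mul_assoc _ (gen Gen.E), E_binK,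
          mul_assoc _ _ (divPow (gen Gen.E) q), mul_assoc _ (gen Gen.E), mul_divPow]
        push_cast
        rw [show ((q : ℤ) + j + 1 - j) = q + 1 by ring,
          show (1 - ((p : ℤ) + 1 + j) + j) = -p by ring]
        simp only [mul_smul_comm, mul_assoc]
      rw [Finset.sum_congr rfl step, Finset.sum_add_distrib, Finset.smul_sum]
      have ext : ∑ j ∈ Finset.range (r + 1), qInt ((r : ℤ) + 1 - j) •
          (divPow (gen Gen.F) (s - j) * binK (2 * j - r - s - 2) j *
            divPow (gen Gen.E) (r + 1 - j)) =
          ∑ j ∈ Finset.range (r + 1 + 1), qInt ((r : ℤ) + 1 - j) •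
          (divPow (gen Gen.F) (s - j) * binK (2 * j - r - s - 2) j *
            divPow (gen Gen.E) (r + 1 - j)) := by
        rw [Finset.sum_range_succ _ (r + 1)]
        simp [qInt]
      rw [ext, Finset.sum_range_succ' _ (r + 1), Finset.sum_range_succ' _ (r + 1),
        add_right_comm, ← Finset.sum_add_distrib]
      congr 1
      · refine Finset.sum_congr rfl fun i _ => ?_
        rw [show r + 1 - (i + 1) = r - i by omega]
        push_cast
        rw [show (r : ℤ) + 1 - (i + 1) = r - i by ring,
          show 2 * ((i : ℤ) + 1) - r - s - 2 = 2 * i - r - s by ring,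
          show 2 * ((i : ℤ) + 1) - (r + 1) - s = 2 * i - r - s + 1 by ring,
          ← smul_mul_assoc, ← mul_smul_comm, ← add_mul, ← mul_add, coeff_identity,
          mul_smul_comm, smul_mul_assoc]
    have := congrArg (fun x => (qInt ((r : ℤ) + 1))⁻¹ • x) key
    simpa only [smul_smul, inv_mul_cancel₀ hr, one_smul] using this

lemma smul_mem_UA (n : ℤ) {x : U} (hx : x ∈ UA) : v ^ n • x ∈ UA := by
  have h : v ^ n • x = (LaurentPolynomial.T n : A) • x := by
    rw [show (LaurentPolynomial.T n : A) • x = algebraMap A Qv (LaurentPolynomial.T n) • x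
      from rfl]
    congr 1
    change v ^ n = LaurentPolynomial.eval₂ _ _ _
    rw [LaurentPolynomial.eval₂_T]
    simp
  rw [h]
  exact UA.smul_mem hx _

/-- `[K; c+1; t+1] = v^{t+1} [K; c; t+1] + v^{t-c} K⁻¹ [K; c; t]`. -/
lemma binK_shift (c : ℤ) (t : ℕ) :
    binK (c + 1) (t + 1) = v ^ ((t : ℤ) + 1) • binK c (t + 1) +
      v ^ ((t : ℤ) - c) • (gen Gen.Kinv * binK c t) := by
  have hv := v_ne_zero
  have hd := v_sub_ne
  have ht : v ^ ((t : ℤ) + 1) - v ^ (-((t : ℤ) + 1)) ≠ 0 := v_pow_ne (by positivity)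
  have ht' : qInt ((t : ℤ) + 1) ≠ 0 := qInt_ne (by positivity)
  have h1 : qK (c + 1) = v ^ ((t : ℤ) + 1) • qK (c - t) +
      (qInt ((t : ℤ) + 1) * v ^ ((t : ℤ) - c)) • gen Gen.Kinv := by
    have e1 : (v - v⁻¹)⁻¹ * v ^ (c + 1) =
        v ^ ((t : ℤ) + 1) * ((v - v⁻¹)⁻¹ * v ^ (c - t)) := by
      rw [mul_left_comm, ← zpow_add₀ hv]; congr 2; ring
    have e2 : (v - v⁻¹)⁻¹ * v ^ (-(c + 1)) =
        v ^ ((t : ℤ) + 1) * ((v - v⁻¹)⁻¹ * v ^ (-(c - t))) -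
          qInt ((t : ℤ) + 1) * v ^ ((t : ℤ) - c) := by
      have h1 : v ^ (t : ℤ) ≠ 0 := zpow_ne_zero _ hv
      have h3 : v ^ (c : ℤ) ≠ 0 := zpow_ne_zero _ hv
      simp only [qInt, neg_add_rev, neg_neg, neg_sub, zpow_add₀ hv, zpow_sub₀ hv,
        zpow_neg, zpow_one]
      field_simp
      ring
    simp only [qK, smul_sub, smul_smul]
    rw [e1, e2]
    exact aux_three _ _ _ _ _
  rw [binK_succ', h1, binK_succ, add_mul, smul_add, smul_mul_assoc, smul_mul_assoc, qK_binK,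
    smul_smul, smul_smul, smul_smul, ← mul_assoc, inv_mul_cancel₀ ht', one_mul, mul_comm]

lemma binK_mem (c : ℤ) (t : ℕ) : binK c t ∈ UA := by
  induction t using Nat.strong_induction_on generalizing c with
  | _ t ih =>
    cases t with
    | zero => exact UA.one_mem
    | succ t =>
      have h0 : binK 0 (t + 1) ∈ UA := by
        have h := divPow_E_divPow_F (t + 1) (t + 1) le_rfl
        rw [Finset.sum_range_succ] at h
        have h1 : divPow (gen Gen.F) (t + 1 - (t + 1)) *
            binK (2 * (t + 1 : ℕ) - (t + 1 : ℕ) - (t + 1 : ℕ)) (t + 1) *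
            divPow (gen Gen.E) (t + 1 - (t + 1)) = binK 0 (t + 1) := by
          rw [show (2 * ((t + 1 : ℕ) : ℤ) - (t + 1 : ℕ) - (t + 1 : ℕ)) = 0 by ring]
          simp [divPow, qFact]
        rw [h1, ← sub_eq_iff_eq_add'] at h
        rw [← h]
        refine UA.sub_mem (UA.mul_mem (E_mem _) (F_mem _)) (UA.sum_mem fun j hj => ?_)
        exact UA.mul_mem (UA.mul_mem (F_mem _) (ih j (Finset.mem_range.mp hj) _)) (E_mem _)
      induction c using Int.induction_on with
      | zero => exact h0
      | succ c hc =>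
        rw [binK_shift]
        exact UA.add_mem (smul_mem_UA _ hc)
          (smul_mem_UA _ (UA.mul_mem Kinv_mem (ih t (Nat.lt_succ_self t) _)))
      | pred c hc =>
        have h := binK_shift (-(c : ℤ) - 1) t
        rw [sub_add_cancel, ← sub_eq_iff_eq_add] at h
        have h2 : binK (-(c : ℤ) - 1) (t + 1) = v ^ (-((t : ℤ) + 1)) •
            (v ^ ((t : ℤ) + 1) • binK (-(c : ℤ) - 1) (t + 1)) := by
          rw [smul_smul, ← zpow_add₀ v_ne_zero, neg_add_cancel, zpow_zero, one_smul]
        rw [h2, ← h]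
        exact smul_mem_UA _ (UA.sub_mem hc
          (smul_mem_UA _ (UA.mul_mem Kinv_mem (ih t (Nat.lt_succ_self t) _))))

/-! ### Specialization at a root of unity -/

/-- The specialization `ℤ[v, v⁻¹] → ℂ`, `v ↦ ξ`. -/
def specHom (ξ : ℂˣ) : A →+* ℂ := LaurentPolynomial.eval₂ (Int.castRingHom ℂ) ξ

/-- The field `ℂ`, regarded as an `𝒜`-algebra on which `v` acts by `ξ`. -/
def Cspec (_ : ℂˣ) : Type := ℂ

instance (ξ : ℂˣ) : Field (Cspec ξ) := inferInstanceAs (Field ℂ)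

instance (ξ : ℂˣ) : Algebra ℂ (Cspec ξ) := inferInstanceAs (Algebra ℂ ℂ)

instance (ξ : ℂˣ) : Algebra A (Cspec ξ) := RingHom.toAlgebra (S := Cspec ξ) (specHom ξ)

instance (ξ : ℂˣ) : SMulCommClass A ℂ (Cspec ξ) :=
  ⟨fun a c x => by simp only [Algebra.smul_def]; exact mul_left_comm _ _ _⟩

/-- The algebra `ℂ ⊗ UA` over `𝒜`, where `v` acts on `ℂ` by `ξ`. -/
abbrev Utilde (ξ : ℂˣ) : Type := Cspec ξ ⊗[A] UA

/-- The map `x ↦ 1 ⊗ x`. -/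
def toUtilde (ξ : ℂˣ) : UA →+* Utilde ξ :=
  (Algebra.TensorProduct.includeRight : UA →ₐ[A] Utilde ξ).toRingHom

/-- The relation `K^ℓ = 1`. -/
inductive KRel (ℓ : ℕ) (ξ : ℂˣ) : Utilde ξ → Utilde ξ → Prop
  | K_pow : KRel ℓ ξ (toUtilde ξ ⟨gen Gen.K, K_mem⟩ ^ ℓ) 1

/-- The quantum group `U_ℓ` of `sl₂` at `ξ`: the quotient of `Utilde ξ` by the two-sided ideal
generated by `K^ℓ - 1`. -/
def Uℓ (ℓ : ℕ) (ξ : ℂˣ) : Type := RingQuot (KRel ℓ ξ)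

instance (ℓ : ℕ) (ξ : ℂˣ) : Ring (Uℓ ℓ ξ) := inferInstanceAs (Ring (RingQuot (KRel ℓ ξ)))

instance (ℓ : ℕ) (ξ : ℂˣ) : Algebra ℂ (Uℓ ℓ ξ) :=
  inferInstanceAs (Algebra ℂ (RingQuot (KRel ℓ ξ)))

section
variable (ℓ : ℕ) (ξ : ℂˣ)

/-- The canonical map from the integral form to `U_ℓ`. -/
def toUℓ : UA →+* Uℓ ℓ ξ :=
  (RingQuot.mkAlgHom ℂ (KRel ℓ ξ) : Utilde ξ →ₐ[ℂ] Uℓ ℓ ξ).toRingHom.comp (toUtilde ξ)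

/-- The image of `E⁽ⁿ⁾` in `U_ℓ`. -/
def E (n : ℕ) : Uℓ ℓ ξ := toUℓ ℓ ξ ⟨divPow (gen Gen.E) n, E_mem n⟩

/-- The image of `F⁽ⁿ⁾` in `U_ℓ`. -/
def F (n : ℕ) : Uℓ ℓ ξ := toUℓ ℓ ξ ⟨divPow (gen Gen.F) n, F_mem n⟩

/-- The image of `K` in `U_ℓ`. -/
def K : Uℓ ℓ ξ := toUℓ ℓ ξ ⟨gen Gen.K, K_mem⟩

/-- The image of `K⁻¹` in `U_ℓ`. -/
def Kinv : Uℓ ℓ ξ := toUℓ ℓ ξ ⟨gen Gen.Kinv, Kinv_mem⟩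

/-- The image of `[K; c; t]` in `U_ℓ`. -/
def bin (c : ℤ) (t : ℕ) : Uℓ ℓ ξ := toUℓ ℓ ξ ⟨binK c t, binK_mem c t⟩

/-- Algebra generators of the Cartan part `U_ℓ⁰`. -/
def cartanGens : Set (Uℓ ℓ ξ) :=
  {K ℓ ξ, Kinv ℓ ξ} ∪ {x | ∃ (c : ℤ) (t : ℕ), x = bin ℓ ξ c t}

/-- The positive quantum Borel subalgebra `B_ℓ⁺`. -/
def Bpos : Subalgebra ℂ (Uℓ ℓ ξ) := Algebra.adjoin ℂ (Set.range (E ℓ ξ) ∪ cartanGens ℓ ξ)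

/-- The negative quantum Borel subalgebra `B_ℓ⁻`; it is the twist `s(B_ℓ⁺)` of `B_ℓ⁺` by the
simple reflection `s`. -/
def Bneg : Subalgebra ℂ (Uℓ ℓ ξ) := Algebra.adjoin ℂ (Set.range (F ℓ ξ) ∪ cartanGens ℓ ξ)

/-- Elements of `U_ℓ⁰` generating the kernel of the character of weight `lam`, by which `K` acts
as `ξ^lam` and `[K; c; t]` as the quantum binomial coefficient `[lam + c; t]` at `v = ξ`. Because
the latter vanishes for `c = -lam` and `t ≥ 1`, and because the elements `[K; -lam; t]` together
with `K`, `K⁻¹` generate `U_ℓ⁰`, the kernel is generated by `K - ξ^lam` and `[K; -lam; t]`,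
`t ≥ 1`. -/
def weightKer (lam : ℤ) : Set (Uℓ ℓ ξ) :=
  {K ℓ ξ - algebraMap ℂ (Uℓ ℓ ξ) ((ξ ^ lam : ℂˣ) : ℂ)} ∪
    {x | ∃ t : ℕ, 1 ≤ t ∧ x = bin ℓ ξ (-lam) t}

/-! ### Verma modules and Weyl modules -/

/-- Generators of the kernel of the character of weight `lam` of `B_ℓ⁺`. -/
def posKer (lam : ℤ) : Set (Uℓ ℓ ξ) :=
  {x | ∃ n : ℕ, 1 ≤ n ∧ x = E ℓ ξ n} ∪ weightKer ℓ ξ lam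

/-- The Verma module `M_ℓ(lam) = M_ℓᵉ(lam)`, which is the induced module
`U_ℓ ⊗ ℂ(lam)` over `B_ℓ⁺`, i.e. the quotient of `U_ℓ` by the left ideal generated by the kernel
of the character of `B_ℓ⁺` on `ℂ(lam)`. -/
abbrev Verma (lam : ℤ) : Type :=
  Uℓ ℓ ξ ⧸ (Submodule.span (Uℓ ℓ ξ) (posKer ℓ ξ lam))

/-- The Weyl module: the maximal finite-dimensional quotient of the Verma module. -/
abbrev Weyl (lam : ℤ) : Type :=
  Verma ℓ ξ lam ⧸
    sInf {N : Submodule (Uℓ ℓ ξ) (Verma ℓ ξ lam) | FiniteDimensional ℂ (Verma ℓ ξ lam ⧸ N)}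

end

section
variable (ℓ : ℕ) (ξ : ℂˣ)

/-! ### The semiregular module and quasi-Verma modules -/

/-- `IsMonomial x d`: the element `x` is a product of generators `E⁽ⁿ⁾` (of degree `n`), `F⁽ⁿ⁾`
(of degree `-n`), `K`, `K⁻¹` (of degree `0`), of total degree `d`. -/
inductive IsMonomial : Uℓ ℓ ξ → ℤ → Prop
  | one : IsMonomial 1 0
  | E_mul (n : ℕ) (x : Uℓ ℓ ξ) (d : ℤ) : IsMonomial x d → IsMonomial (E ℓ ξ n * x) (n + d)
  | F_mul (n : ℕ) (x : Uℓ ℓ ξ) (d : ℤ) : IsMonomial x d → IsMonomial (F ℓ ξ n * x) (-n + d)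
  | K_mul (x : Uℓ ℓ ξ) (d : ℤ) : IsMonomial x d → IsMonomial (K ℓ ξ * x) d
  | Kinv_mul (x : Uℓ ℓ ξ) (d : ℤ) : IsMonomial x d → IsMonomial (Kinv ℓ ξ * x) d

/-- The component of degree `d` of the grading of `U_ℓ` by the root lattice. -/
def degPart (d : ℤ) : Submodule ℂ (Uℓ ℓ ξ) := Submodule.span ℂ {x | IsMonomial ℓ ξ x d}

/-- All homomorphisms of left `B_ℓ⁻`-modules from `U_ℓ` to `B_ℓ⁻`. -/
def HomB : Type := Uℓ ℓ ξ →ₗ[Bneg ℓ ξ] Bneg ℓ ξ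

instance : AddCommGroup (HomB ℓ ξ) := inferInstanceAs (AddCommGroup (Uℓ ℓ ξ →ₗ[Bneg ℓ ξ] Bneg ℓ ξ))

instance : FunLike (HomB ℓ ξ) (Uℓ ℓ ξ) (Bneg ℓ ξ) :=
  inferInstanceAs (FunLike (Uℓ ℓ ξ →ₗ[Bneg ℓ ξ] Bneg ℓ ξ) (Uℓ ℓ ξ) (Bneg ℓ ξ))

/-- Right multiplication by `u`, as an endomorphism of the left `B_ℓ⁻`-module `U_ℓ`. -/
def rightMul (u : Uℓ ℓ ξ) : Uℓ ℓ ξ →ₗ[Bneg ℓ ξ] Uℓ ℓ ξ where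
  toFun x := x * u
  map_add' x y := add_mul x y u
  map_smul' b x := by simp [Subalgebra.smul_def, mul_assoc]

/-- The left `U_ℓ`-module structure `(u φ)(x) = φ(x u)`. -/
instance : Module (Uℓ ℓ ξ) (HomB ℓ ξ) where
  smul u φ := LinearMap.comp (φ : Uℓ ℓ ξ →ₗ[Bneg ℓ ξ] Bneg ℓ ξ) (rightMul ℓ ξ u)
  one_smul φ := LinearMap.ext fun x => congrArg φ (mul_one x)
  mul_smul u w φ := LinearMap.ext fun x => congrArg φ (mul_assoc x u w).symm
  smul_zero _ := rfl
  smul_add _ _ _ := rfl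
  add_smul u w φ := LinearMap.ext fun x =>
    (congrArg φ (mul_add x u w)).trans
      (LinearMap.map_add (φ : Uℓ ℓ ξ →ₗ[Bneg ℓ ξ] Bneg ℓ ξ) (x * u) (x * w))
  zero_smul φ := LinearMap.ext fun x =>
    (congrArg φ (mul_zero x)).trans (LinearMap.map_zero (φ : Uℓ ℓ ξ →ₗ[Bneg ℓ ξ] Bneg ℓ ξ))

/-- The right action of `B_ℓ⁻`, `(φ b)(x) = φ(x) b`. -/
def HomB.mulRight (φ : HomB ℓ ξ) (b : Bneg ℓ ξ) : HomB ℓ ξ :=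
  LinearMap.comp (LinearMap.toSpanSingleton (Bneg ℓ ξ) (Bneg ℓ ξ) b)
    (φ : Uℓ ℓ ξ →ₗ[Bneg ℓ ξ] Bneg ℓ ξ)

/-- `φ : U_ℓ → B_ℓ⁻` is homogeneous of degree `e`. -/
def HomB.IsHomogeneous (φ : HomB ℓ ξ) (e : ℤ) : Prop :=
  ∀ (d : ℤ) (x : Uℓ ℓ ξ), x ∈ degPart ℓ ξ d → (φ x : Uℓ ℓ ξ) ∈ degPart ℓ ξ (d + e)

/-- The semiregular `U_ℓ`-module with respect to the triangular decomposition
`U_ℓ = B_ℓ⁻ ⊗ U_ℓ⁺`, in its realization as the space of graded homomorphisms of left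
`B_ℓ⁻`-modules `U_ℓ → B_ℓ⁻`, i.e. of the sums of homogeneous ones. -/
def Semiregular : Submodule (Uℓ ℓ ξ) (HomB ℓ ξ) :=
  Submodule.span (Uℓ ℓ ξ) {φ | ∃ e : ℤ, φ.IsHomogeneous ℓ ξ e}

/-- Generators of the kernel of the character of weight `lam` of `B_ℓ⁻`. -/
def negKer (lam : ℤ) : Set (Uℓ ℓ ξ) :=
  {x | ∃ n : ℕ, 1 ≤ n ∧ x = F ℓ ξ n} ∪ weightKer ℓ ξ lam

/-- The quasi-Verma module `M_ℓˢ(lam)` of highest weight `lam`.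

It is semiinfinitely induced from the one-dimensional module of the twisted Borel subalgebra
`s(B_ℓ⁺) = B_ℓ⁻`. As the positive part of `B_ℓ⁻` is trivial, the semiinfinite `Tor` of degree `0`
is the tensor product over `B_ℓ⁻` of the semiregular module with the one-dimensional module: the
quotient of the semiregular module by all `φ b`, where `b` runs over the kernel of the character.
The element of the semiregular module that is `1` on `1` and vanishes on all `E⁽ⁿ⁾`, `n ≥ 1`,
becomes a vector of weight `lam`, the highest one. -/
abbrev QuasiVerma (lam : ℤ) : Type :=
  Semiregular ℓ ξ ⧸
    Submodule.comap (Semiregular ℓ ξ).subtype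
      (Submodule.span (Uℓ ℓ ξ)
        {ψ | ∃ φ ∈ Semiregular ℓ ξ, ∃ b : Bneg ℓ ξ,
          (b : Uℓ ℓ ξ) ∈ negKer ℓ ξ lam ∧ ψ = φ.mulRight ℓ ξ b})

end

/-- The dot action of the simple reflection on the weight lattice `ℤ`: `s · lam = -lam - 2`. -/
def sDot (lam : ℤ) : ℤ := -lam - 2

end QuantumSl2

end

noncomputable section

namespace QuantumSl2

/-! The Verma module of highest weight `μ` has the basis `F⁽ⁿ⁾v`, and `E⁽ᵏ⁾F⁽ⁿ⁺ᵏ⁾v = [μ-n; k]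
F⁽ⁿ⁾v`. For `n ≤ μ < n+k` this coefficient vanishes, so the vectors of index above `μ` span a
submodule, of codimension `μ+1`. It is shown to be a copy of the quasi-Verma module on the one hand,
and the smallest submodule of finite codimension on the other.

Copy of the quasi-Verma module: an element `φ` of the semiregular module is determined by its values
at the `E⁽ⁿ⁾`, which form a basis of `U_ℓ` over `B_ℓ⁻`, and only finitely many of these values are
nonzero (`Semiregular_support_finite`). Tensoring with `ℂ(s·μ)` keeps just the scalars `χ(φ(E⁽ⁿ⁾))`,
where `χ` is the character of `B_ℓ⁻` (`mem_quasiVermaKer`). The map `φ ↦ ∑ (-1)ⁿ χ(φ(E⁽ⁿ⁾))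
F⁽ⁿ⁺ᵘ⁺¹⁾v`, with `u = μ`, is linear over `U_ℓ`: the matrix coefficients of `E⁽ᵏ⁾` and `F⁽ᵏ⁾` on the
two sides are matched by `[-m; t] = (-1)ᵗ [m+t-1; t]` (`embFun_E_smul`, `embFun_F_smul`). Its kernel
is what the tensor product divides out (`ker_embLin`).

Minimality: let `N` have finite codimension. The elements `[K; c; t]` separate the basis vectors
even at a root of unity, so `N` contains `F⁽ⁿ⁾v` for all large `n`. One descends by `E⁽ᵏ⁾F⁽ⁿ⁺ᵏ⁾v =
±[p+k; k] F⁽ⁿ⁾v`, where `n = μ+1+p`. A given coefficient may vanish at `ξ`, but not for every `k ≥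
1` (`exists_qBinAt_ne_zero`). Divisibility of `μ` by `ℓ` plays no role.

Underneath lie two freeness statements: the `F⁽ⁿ⁾v` are a basis of the Verma module, and the `E⁽ⁿ⁾`
are a basis of `U_ℓ` over `B_ℓ⁻`. Spanning comes from ordering monomials in the integral form.
Independence comes from coordinate maps built over `ℚ(v)`, one from a Verma representation, the
other from a model of `U` on ordered monomials. They preserve integrality because ordered monomials
span `UA`, and they descend to `U_ℓ` because `K^ℓ` becomes central at `v = ξ` (`exists_Uℓ_lift`). -/

/-! ### Quantum binomial coefficients -/

/-- The quantum binomial coefficient `[m; t]` for `m : ℤ`. -/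
def qBin (m : ℤ) (t : ℕ) : Qv := ∏ s ∈ Finset.range t, (qInt (m - s) / qInt ((s : ℤ) + 1))

lemma qBin_zero_right (m : ℤ) : qBin m 0 = 1 := by simp [qBin]

lemma qBin_succ (m : ℤ) (t : ℕ) :
    qBin m (t + 1) = qBin m t * (qInt (m - t) / qInt ((t : ℤ) + 1)) := by
  rw [qBin, Finset.prod_range_succ, qBin]

lemma qBin_succ' (m : ℤ) (t : ℕ) :
    qBin (m + 1) (t + 1) = qInt (m + 1) / qInt ((t : ℤ) + 1) * qBin m t := by
  induction t with
  | zero => rw [qBin_succ]; simp [qBin_zero_right]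
  | succ t ih =>
    rw [qBin_succ, ih, qBin_succ m t]
    push_cast
    rw [show m + 1 - ((t : ℤ) + 1) = m - t by ring]
    ring

lemma qInt_zero : qInt 0 = 0 := by simp [qInt]

lemma qInt_neg (m : ℤ) : qInt (-m) = -qInt m := by
  simp only [qInt, neg_neg]; ring

lemma qInt_add (a b : ℤ) : qInt (a + b) = v ^ b * qInt a + v ^ (-a) * qInt b := by
  have hv := v_ne_zero
  have hd := v_sub_ne
  have h1 : v ^ a ≠ 0 := zpow_ne_zero _ hv
  have h2 : v ^ b ≠ 0 := zpow_ne_zero _ hv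
  simp only [qInt, neg_add_rev, zpow_add₀ hv, zpow_neg]
  field_simp
  ring

/-- Quantum Pascal rule, from the addition formula `qInt_add`. It is the scalar counterpart of
`binK_shift`, so the eigenvalues of `[K; c; t]` obey the same recursion as these elements. -/
lemma qBin_shift (c : ℤ) (t : ℕ) :
    qBin (c + 1) (t + 1) = v ^ ((t : ℤ) + 1) * qBin c (t + 1) + v ^ ((t : ℤ) - c) * qBin c t := by
  have h : qInt ((t : ℤ) + 1) ≠ 0 := qInt_ne (by positivity)
  have h1 := qInt_add (c - t) ((t : ℤ) + 1)
  rw [show c - (t : ℤ) + ((t : ℤ) + 1) = c + 1 by ring, neg_sub] at h1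
  rw [qBin_succ', qBin_succ, h1]
  field_simp

/-- Reflection rule: each factor changes sign, and the factors are then read in the opposite order.
It is the source of the signs in the embedding of the quasi-Verma module. -/
lemma qBin_neg (m : ℤ) (t : ℕ) : qBin (-m) t = (-1) ^ t * qBin (m + t - 1) t := by
  induction t with
  | zero => simp [qBin_zero_right]
  | succ t ih =>
    rw [qBin_succ, ih]
    push_cast
    rw [show m + ((t : ℤ) + 1) - 1 = m + t - 1 + 1 by ring, qBin_succ',
      show -m - (t : ℤ) = -(m + t) by ring, qInt_neg, show m + (t : ℤ) - 1 + 1 = m + t by ring]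
    ring

lemma qBin_eq_zero {m t : ℕ} (h : m < t) : qBin m t = 0 :=
  Finset.prod_eq_zero (Finset.mem_range.mpr h) (by simp [qInt_zero])

lemma qBin_add_mul (m n : ℕ) : qBin ((m : ℤ) + n) m * (qFact m * qFact n) = qFact (m + n) := by
  induction m with
  | zero => simp [qBin_zero_right, qFact]
  | succ m ih =>
    have h : qInt ((m : ℤ) + 1) ≠ 0 := qInt_ne (by positivity)
    rw [show m + 1 + n = m + n + 1 by ring, qFact_succ (m + n), ← ih, qFact_succ m]
    push_cast
    rw [show (m : ℤ) + 1 + n = m + n + 1 by ring, qBin_succ']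
    field_simp

lemma qBin_add (m n : ℕ) : qBin ((m : ℤ) + n) m = qFact (m + n) / (qFact m * qFact n) := by
  rw [eq_div_iff (mul_ne_zero (qFact_ne _) (qFact_ne _)), qBin_add_mul]

lemma qBin_self (m : ℕ) : qBin m m = 1 := by
  have := qBin_add m 0
  have h := qFact_ne m
  simp only [Nat.cast_zero, add_zero] at this
  rw [this, show qFact 0 = 1 by simp [qFact], mul_one, div_self h]

lemma qBin_symm (m n : ℕ) : qBin ((m : ℤ) + n) m = qBin ((m : ℤ) + n) n := by
  rw [qBin_add, add_comm (m : ℤ), qBin_add, add_comm, mul_comm]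

lemma algebraMap_T (n : ℤ) : algebraMap A Qv (T n) = v ^ n := by
  change LaurentPolynomial.eval₂ _ _ _ = _
  rw [LaurentPolynomial.eval₂_T]
  simp

/-- Multiplication by a power of `v` reduces this to `ℤ[X] ⊆ ℚ[X] ⊆ ℚ(X)`. Identities over `𝒜` may
then be checked in `ℚ(v)`, where quantum integers are invertible. -/
lemma algebraMap_A_injective : Function.Injective (algebraMap A Qv) := by
  rw [injective_iff_map_eq_zero]
  intro f hf
  obtain ⟨n, p, hp⟩ := LaurentPolynomial.exists_T_pow f
  have h1 : algebraMap A Qv (Polynomial.toLaurent p) = 0 := by rw [hp, map_mul, hf, zero_mul]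
  have h2 : algebraMap A Qv (Polynomial.toLaurent p) =
      algebraMap (Polynomial ℚ) Qv (p.map (Int.castRingHom ℚ)) := by
    have : ((algebraMap A Qv).comp (Polynomial.toLaurent : Polynomial ℤ →+* A)) =
        (algebraMap (Polynomial ℚ) Qv).comp (Polynomial.mapRingHom (Int.castRingHom ℚ)) := by
      apply Polynomial.ringHom_ext'
      · exact RingHom.ext_int _ _
      · simp [algebraMap_T, v]
    exact DFunLike.congr_fun this p
  rw [h2, map_eq_zero_iff _ (RatFunc.algebraMap_injective ℚ),
    Polynomial.map_eq_zero_iff (RingHom.injective_int _)] at h1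
  rw [h1, map_zero] at hp
  have h3 : (T (n : ℤ) : A) * T (-n) = 1 := by rw [← T_add]; simp
  calc f = f * T n * T (-n) := by rw [mul_assoc, h3, mul_one]
    _ = 0 := by rw [← hp, zero_mul]

/-- Start from `[0; t+1] = 0` and move `m` up or down with the Pascal rule. Its coefficient
`v^(t+1)` is a unit of `𝒜`, so both directions stay integral. -/
lemma exists_qBinA (m : ℤ) (t : ℕ) : ∃ a : A, algebraMap A Qv a = qBin m t := by
  induction t generalizing m with
  | zero => exact ⟨1, by simp [qBin_zero_right]⟩
  | succ t ih =>
    induction m using Int.induction_on with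
    | zero => exact ⟨0, by rw [map_zero]; exact (qBin_eq_zero (Nat.succ_pos t)).symm⟩
    | succ c hc =>
      obtain ⟨a, ha⟩ := hc
      obtain ⟨b, hb⟩ := ih c
      exact ⟨T ((t : ℤ) + 1) * a + T ((t : ℤ) - c) * b, by
        rw [qBin_shift, map_add, map_mul, map_mul, ha, hb, algebraMap_T, algebraMap_T]⟩
    | pred c hc =>
      obtain ⟨a, ha⟩ := hc
      obtain ⟨b, hb⟩ := ih (-(c : ℤ) - 1)
      have h := qBin_shift (-(c : ℤ) - 1) t
      rw [sub_add_cancel] at h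
      refine ⟨T (-((t : ℤ) + 1)) * (a - T ((t : ℤ) - (-(c : ℤ) - 1)) * b), ?_⟩
      rw [map_mul, map_sub, map_mul, ha, hb, algebraMap_T, algebraMap_T, h, add_sub_cancel_right,
        ← mul_assoc, ← zpow_add₀ v_ne_zero]
      simp

/-- The quantum binomial coefficient as a Laurent polynomial. -/
def qBinA (m : ℤ) (t : ℕ) : A := (exists_qBinA m t).choose

lemma algebraMap_qBinA (m : ℤ) (t : ℕ) : algebraMap A Qv (qBinA m t) = qBin m t :=
  (exists_qBinA m t).choose_spec

lemma qBinA_zero_right (m : ℤ) : qBinA m 0 = 1 :=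
  algebraMap_A_injective (by rw [algebraMap_qBinA, map_one, qBin_zero_right])

lemma qBinA_shift (c : ℤ) (t : ℕ) :
    qBinA (c + 1) (t + 1) = T ((t : ℤ) + 1) * qBinA c (t + 1) + T ((t : ℤ) - c) * qBinA c t :=
  algebraMap_A_injective (by simp only [map_add, map_mul, algebraMap_qBinA, algebraMap_T,
    qBin_shift])

lemma qBinA_neg (m : ℤ) (t : ℕ) : qBinA (-m) t = (-1) ^ t * qBinA (m + t - 1) t :=
  algebraMap_A_injective (by simp only [map_mul, map_pow, map_neg, map_one, algebraMap_qBinA,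
    qBin_neg])

lemma qBinA_eq_zero {m t : ℕ} (h : m < t) : qBinA m t = 0 :=
  algebraMap_A_injective (by rw [algebraMap_qBinA, map_zero, qBin_eq_zero h])

lemma qBinA_self (m : ℕ) : qBinA m m = 1 :=
  algebraMap_A_injective (by rw [algebraMap_qBinA, map_one, qBin_self])

lemma qBinA_symm (m n : ℕ) : qBinA ((m : ℤ) + n) m = qBinA ((m : ℤ) + n) n :=
  algebraMap_A_injective (by rw [algebraMap_qBinA, algebraMap_qBinA, qBin_symm])

/-! ### Relations in the quantum group over `ℚ(v)` -/

instance : IsScalarTower A Qv U := IsScalarTower.of_algebraMap_eq fun _ => rfl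

lemma A_smul (a : A) (x : U) : a • x = algebraMap A Qv a • x := rfl

lemma T_smul (n : ℤ) (x : U) : (T n : A) • x = v ^ n • x := by rw [A_smul, algebraMap_T]

lemma qBinA_smul (m : ℤ) (t : ℕ) (x : U) : qBinA m t • x = qBin m t • x := by
  rw [A_smul, algebraMap_qBinA]

lemma divPow_zero (x : U) : divPow x 0 = 1 := by simp [divPow, qFact]

lemma divPow_mul_divPow (x : U) (m n : ℕ) :
    divPow x m * divPow x n = qBin ((m : ℤ) + n) m • divPow x (m + n) := by
  have h1 := qFact_ne m
  have h2 := qFact_ne n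
  have h3 := qFact_ne (m + n)
  rw [qBin_add, divPow, divPow, divPow, smul_mul_smul_comm, ← pow_add, smul_smul]
  congr 1
  field_simp

lemma K_divPow_E (n : ℕ) : gen Gen.K * divPow (gen Gen.E) n =
    v ^ (2 * (n : ℤ)) • (divPow (gen Gen.E) n * gen Gen.K) := by
  have h : gen Gen.K * gen Gen.E ^ n = v ^ (2 * (n : ℤ)) • (gen Gen.E ^ n * gen Gen.K) := by
    induction n with
    | zero => simp
    | succ n ih =>
      rw [pow_succ, ← mul_assoc, ih, smul_mul_assoc, mul_assoc, K_E, mul_smul_comm, smul_smul,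
        ← zpow_add₀ v_ne_zero, mul_assoc]
      push_cast
      ring_nf
  rw [divPow, mul_smul_comm, h, smul_mul_assoc, smul_comm]

lemma K_divPow_F (n : ℕ) : gen Gen.K * divPow (gen Gen.F) n =
    v ^ (-2 * (n : ℤ)) • (divPow (gen Gen.F) n * gen Gen.K) := by
  have h : gen Gen.K * gen Gen.F ^ n = v ^ (-2 * (n : ℤ)) • (gen Gen.F ^ n * gen Gen.K) := by
    induction n with
    | zero => simp
    | succ n ih =>
      rw [pow_succ, ← mul_assoc, ih, smul_mul_assoc, mul_assoc, K_F, mul_smul_comm, smul_smul,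
        ← zpow_add₀ v_ne_zero, mul_assoc]
      push_cast
      ring_nf
  rw [divPow, mul_smul_comm, h, smul_mul_assoc, smul_comm]

lemma Kinv_mul_of_K_mul {x : U} {n : ℤ} (h : gen Gen.K * x = v ^ n • (x * gen Gen.K)) :
    gen Gen.Kinv * x = v ^ (-n) • (x * gen Gen.Kinv) := by
  have h1 : x * gen Gen.Kinv = v ^ n • (gen Gen.Kinv * x) := by
    calc x * gen Gen.Kinv = gen Gen.Kinv * (gen Gen.K * x) * gen Gen.Kinv := by
          rw [← mul_assoc, Kinv_K, one_mul]
      _ = v ^ n • (gen Gen.Kinv * x * (gen Gen.K * gen Gen.Kinv)) := by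
          rw [h]; simp only [mul_smul_comm, smul_mul_assoc, mul_assoc]
      _ = _ := by rw [K_Kinv, mul_one]
  rw [h1, smul_smul, ← zpow_add₀ v_ne_zero]
  simp

lemma divPow_E_binK (n : ℕ) (c : ℤ) (t : ℕ) : divPow (gen Gen.E) n * binK c t =
    binK (c - 2 * n) t * divPow (gen Gen.E) n := by
  have h : gen Gen.E ^ n * binK c t = binK (c - 2 * n) t * gen Gen.E ^ n := by
    induction n generalizing c with
    | zero => simp
    | succ n ih =>
      rw [pow_succ, mul_assoc, E_binK, ← mul_assoc, ih, mul_assoc]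
      push_cast
      ring_nf
  rw [divPow, smul_mul_assoc, h, mul_smul_comm]

lemma F_binK (c : ℤ) (t : ℕ) : gen Gen.F * binK c t = binK (c + 2) t * gen Gen.F := by
  induction t with
  | zero => simp [binK]
  | succ t ih =>
    rw [binK_succ, binK_succ, mul_smul_comm, ← mul_assoc, ih, mul_assoc, F_qK, smul_mul_assoc,
      mul_assoc, show c - (t : ℤ) + 2 = c + 2 - t by ring]

lemma binK_divPow_F (n : ℕ) (c : ℤ) (t : ℕ) : binK c t * divPow (gen Gen.F) n =
    divPow (gen Gen.F) n * binK (c - 2 * n) t := by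
  have h : binK c t * gen Gen.F ^ n = gen Gen.F ^ n * binK (c - 2 * n) t := by
    induction n generalizing c with
    | zero => simp
    | succ n ih =>
      have h1 := F_binK (c - 2) t
      rw [sub_add_cancel] at h1
      rw [pow_succ', ← mul_assoc, ← h1, mul_assoc, ih, mul_assoc]
      push_cast
      ring_nf
  rw [divPow, smul_mul_assoc, mul_smul_comm, h]

/-- `E⁽ʳ⁾ F⁽ˢ⁾ = ∑ⱼ F⁽ˢ⁻ʲ⁾ [K; 2j-r-s; j] E⁽ʳ⁻ʲ⁾` for `s ≤ r`. -/
lemma divPow_E_divPow_F_of_ge (r s : ℕ) (h : s ≤ r) :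
    divPow (gen Gen.E) r * divPow (gen Gen.F) s =
      ∑ j ∈ Finset.range (s + 1), divPow (gen Gen.F) (s - j) * binK (2 * j - r - s) j *
        divPow (gen Gen.E) (r - j) := by
  induction r, h using Nat.le_induction with
  | base => exact divPow_E_divPow_F s s le_rfl
  | succ r hsr ih =>
    have hr : qInt ((r : ℤ) + 1) ≠ 0 := qInt_ne (by positivity)
    have key : qInt ((r : ℤ) + 1) • (divPow (gen Gen.E) (r + 1) * divPow (gen Gen.F) s) =
        qInt ((r : ℤ) + 1) • ∑ j ∈ Finset.range (s + 1), divPow (gen Gen.F) (s - j) *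
          binK (2 * j - (r + 1 : ℕ) - s) j * divPow (gen Gen.E) (r + 1 - j) := by
      rw [← smul_mul_assoc, ← mul_divPow, mul_assoc, ih, Finset.mul_sum]
      have step : ∀ j ∈ Finset.range s,
          gen Gen.E * (divPow (gen Gen.F) (s - j) * binK (2 * j - r - s) j *
            divPow (gen Gen.E) (r - j)) =
          qInt ((r : ℤ) + 1 - j) • (divPow (gen Gen.F) (s - j) * binK (2 * j - r - s - 2) j *
            divPow (gen Gen.E) (r + 1 - j)) +
          divPow (gen Gen.F) (s - (j + 1)) * (qK (1 - s + j) * binK (2 * j - r - s) j) *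
            divPow (gen Gen.E) (r - j) := by
        intro j hj
        have hj' : j < s := by simpa using hj
        obtain ⟨p, rfl⟩ : ∃ p, s = p + 1 + j := ⟨s - 1 - j, by omega⟩
        obtain ⟨q, rfl⟩ : ∃ q, r = q + j := ⟨r - j, by omega⟩
        rw [show p + 1 + j - j = p + 1 by omega, show p + 1 + j - (j + 1) = p by omega,
          show q + j - j = q by omega, show q + j + 1 - j = q + 1 by omega, ← mul_assoc,
          ← mul_assoc, E_divPow_F, add_mul, add_mul, mul_assoc _ (gen Gen.E), E_binK,
          mul_assoc _ _ (divPow (gen Gen.E) q), mul_assoc _ (gen Gen.E), mul_divPow]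
        push_cast
        rw [show ((q : ℤ) + j + 1 - j) = q + 1 by ring,
          show (1 - ((p : ℤ) + 1 + j) + j) = -p by ring]
        simp only [mul_smul_comm, mul_assoc]
      -- In the last term no `F` is left, so `E` only passes the Cartan factor and no second summand
      -- arises.
      have last : gen Gen.E * (divPow (gen Gen.F) (s - s) * binK (2 * s - r - s) s *
            divPow (gen Gen.E) (r - s)) =
          qInt ((r : ℤ) + 1 - s) • (divPow (gen Gen.F) (s - s) * binK (2 * s - r - s - 2) s *
            divPow (gen Gen.E) (r + 1 - s)) := by
        obtain ⟨q, rfl⟩ : ∃ q, r = q + s := ⟨r - s, by omega⟩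
        rw [Nat.sub_self, divPow_zero, one_mul, one_mul, ← mul_assoc, E_binK, mul_assoc,
          show q + s - s = q by omega, show q + s + 1 - s = q + 1 by omega, mul_divPow,
          mul_smul_comm]
        push_cast
        rw [show ((q : ℤ) + s + 1 - s) = q + 1 by ring]
      rw [Finset.sum_range_succ, last, Finset.sum_congr rfl step, Finset.sum_add_distrib,
        add_right_comm,
        ← Finset.sum_range_succ (fun j => qInt ((r : ℤ) + 1 - j) • (divPow (gen Gen.F) (s - j) *
          binK (2 * j - r - s - 2) j * divPow (gen Gen.E) (r + 1 - j))), Finset.smul_sum,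
        Finset.sum_range_succ' _ s, Finset.sum_range_succ' _ s, add_right_comm,
        ← Finset.sum_add_distrib]
      congr 1
      · refine Finset.sum_congr rfl fun i _ => ?_
        rw [show r + 1 - (i + 1) = r - i by omega]
        push_cast
        rw [show (r : ℤ) + 1 - (i + 1) = r - i by ring,
          show 2 * ((i : ℤ) + 1) - r - s - 2 = 2 * i - r - s by ring,
          show 2 * ((i : ℤ) + 1) - (r + 1) - s = 2 * i - r - s + 1 by ring,
          ← smul_mul_assoc, ← mul_smul_comm, ← add_mul, ← mul_add, coeff_identity,
          mul_smul_comm, smul_mul_assoc]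
    have := congrArg (fun x => (qInt ((r : ℤ) + 1))⁻¹ • x) key
    simpa only [smul_smul, inv_mul_cancel₀ hr, one_smul] using this

lemma divPow_E_mul_divPow_F (r s : ℕ) :
    divPow (gen Gen.E) r * divPow (gen Gen.F) s =
      ∑ j ∈ Finset.range (min r s + 1), divPow (gen Gen.F) (s - j) * binK (2 * j - r - s) j *
        divPow (gen Gen.E) (r - j) := by
  rcases le_total r s with h | h
  · rw [min_eq_left h, divPow_E_divPow_F r s h]
  · rw [min_eq_right h, divPow_E_divPow_F_of_ge r s h]

/-! ### Representations of the quantum group over `ℚ(v)` -/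

section lift
variable {B : Type*} [Ring B] [Algebra Qv B]

/-- The images of the generators under a homomorphism to be constructed. -/
def genImage (e f k k' : B) : Gen → B
  | Gen.E => e
  | Gen.F => f
  | Gen.K => k
  | Gen.Kinv => k'

lemma exists_algHom_of_relations (e f k k' : B) (h1 : k * k' = 1) (h2 : k' * k = 1)
    (h3 : k * e = v ^ (2 : ℤ) • (e * k)) (h4 : k * f = v ^ (-2 : ℤ) • (f * k))
    (h5 : e * f = f * e + (v - v⁻¹)⁻¹ • (k - k')) :
    ∃ φ : U →ₐ[Qv] B, φ (gen Gen.E) = e ∧ φ (gen Gen.F) = f ∧ φ (gen Gen.K) = k ∧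
      φ (gen Gen.Kinv) = k' := by
  have h : ∀ ⦃x y⦄, Rel x y → FreeAlgebra.lift Qv (genImage e f k k') x =
      FreeAlgebra.lift Qv (genImage e f k k') y := by
    intro x y hxy
    cases hxy <;> simp only [map_mul, map_add, map_sub, map_smul, map_one, FreeAlgebra.lift_ι_apply,
      genImage, h1, h2, h3, h4, h5]
  let φ : U →ₐ[Qv] B := RingQuot.liftAlgHom Qv ⟨FreeAlgebra.lift Qv (genImage e f k k'), h⟩
  have hφ : ∀ g, φ (gen g) = genImage e f k k' g := by
    intro g
    have := RingQuot.liftAlgHom_mkAlgHom_apply Qv (FreeAlgebra.lift Qv (genImage e f k k')) h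
      (FreeAlgebra.ι Qv g)
    rw [FreeAlgebra.lift_ι_apply] at this
    exact this
  exact ⟨φ, hφ _, hφ _, hφ _, hφ _⟩

end lift

/-- The basis vectors of the Verma module of `U`. -/
abbrev vermaVec (n : ℕ) : ℕ →₀ Qv := Finsupp.single n 1

/-- The action of `E` on the Verma module of highest weight `lam`. -/
def vermaE (lam : ℤ) : Module.End Qv (ℕ →₀ Qv) :=
  Finsupp.linearCombination Qv fun n => match n with
    | 0 => 0
    | n + 1 => qInt (lam - n) • vermaVec n

/-- The action of `F` on the Verma module. -/
def vermaF : Module.End Qv (ℕ →₀ Qv) :=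
  Finsupp.linearCombination Qv fun n => qInt ((n : ℤ) + 1) • vermaVec (n + 1)

/-- The action of `K^ε` on the Verma module of highest weight `lam`. -/
def vermaK (lam ε : ℤ) : Module.End Qv (ℕ →₀ Qv) :=
  Finsupp.linearCombination Qv fun n => v ^ (ε * (lam - 2 * n)) • vermaVec n

lemma vermaE_zero (lam : ℤ) : vermaE lam (vermaVec 0) = 0 := by
  simp [vermaE]

lemma vermaE_succ (lam : ℤ) (n : ℕ) :
    vermaE lam (vermaVec (n + 1)) = qInt (lam - n) • vermaVec n := by
  simp only [vermaE, Finsupp.linearCombination_single, one_smul]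

lemma vermaF_vec (n : ℕ) : vermaF (vermaVec n) = qInt ((n : ℤ) + 1) • vermaVec (n + 1) := by
  simp only [vermaF, Finsupp.linearCombination_single, one_smul]

lemma vermaK_vec (lam ε : ℤ) (n : ℕ) :
    vermaK lam ε (vermaVec n) = v ^ (ε * (lam - 2 * n)) • vermaVec n := by
  simp only [vermaK, Finsupp.linearCombination_single, one_smul]

/-- The only relation that is not a comparison of weights is the one for `EF - FE`; on the `n`-th
vector it says `[n+1][λ-n] - [n][λ-n+1] = [λ-2n]`. -/
lemma exists_verma_rep (lam : ℤ) : ∃ φ : U →ₐ[Qv] Module.End Qv (ℕ →₀ Qv),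
    φ (gen Gen.E) = vermaE lam ∧ φ (gen Gen.F) = vermaF ∧ φ (gen Gen.K) = vermaK lam 1 ∧
      φ (gen Gen.Kinv) = vermaK lam (-1) := by
  have hv := v_ne_zero
  have hd := v_sub_ne
  refine exists_algHom_of_relations (B := Module.End Qv (ℕ →₀ Qv)) _ _ _ _ ?_ ?_ ?_ ?_ ?_
  · refine Finsupp.lhom_ext' fun n => LinearMap.ext_ring ?_
    simp only [LinearMap.comp_apply, Finsupp.lsingle_apply, Module.End.mul_apply, vermaK_vec,
      map_smul, smul_smul, ← zpow_add₀ hv, Module.End.one_apply]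
    rw [show -1 * (lam - 2 * n) + 1 * (lam - 2 * n) = 0 by ring, zpow_zero, one_smul]
  · refine Finsupp.lhom_ext' fun n => LinearMap.ext_ring ?_
    simp only [LinearMap.comp_apply, Finsupp.lsingle_apply, Module.End.mul_apply, vermaK_vec,
      map_smul, smul_smul, ← zpow_add₀ hv, Module.End.one_apply]
    rw [show 1 * (lam - 2 * n) + -1 * (lam - 2 * n) = 0 by ring, zpow_zero, one_smul]
  · refine Finsupp.lhom_ext' fun n => LinearMap.ext_ring ?_
    simp only [LinearMap.comp_apply, Finsupp.lsingle_apply, Module.End.mul_apply,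
      LinearMap.smul_apply]
    cases n with
    | zero => simp only [vermaE_zero, vermaK_vec, map_zero, map_smul, smul_zero]
    | succ n =>
      simp only [vermaE_succ, vermaK_vec, map_smul, smul_smul, ← zpow_add₀ hv]
      rw [← mul_assoc, ← zpow_add₀ hv, mul_comm (qInt _)]
      push_cast
      ring_nf
  · refine Finsupp.lhom_ext' fun n => LinearMap.ext_ring ?_
    simp only [LinearMap.comp_apply, Finsupp.lsingle_apply, Module.End.mul_apply,
      LinearMap.smul_apply]
    simp only [vermaF_vec, vermaK_vec, map_smul, smul_smul]
    rw [← mul_assoc, ← zpow_add₀ hv]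
    push_cast
    ring_nf
  · refine Finsupp.lhom_ext' fun n => LinearMap.ext_ring ?_
    simp only [LinearMap.comp_apply, Finsupp.lsingle_apply, Module.End.mul_apply,
      LinearMap.smul_apply, LinearMap.add_apply, LinearMap.sub_apply]
    have key : ∀ n : ℤ, qInt (n + 1) * qInt (lam - n) = qInt n * qInt (lam - n + 1) +
        (v - v⁻¹)⁻¹ * (v ^ (lam - 2 * n) - v ^ (-(lam - 2 * n))) := by
      intro n
      have h1 : v ^ n ≠ 0 := zpow_ne_zero _ hv
      have h2 : v ^ lam ≠ 0 := zpow_ne_zero _ hv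
      simp only [qInt, neg_add_rev, neg_neg, neg_sub, two_mul, zpow_add₀ hv, zpow_sub₀ hv, zpow_neg,
        zpow_one]
      field_simp
      ring
    rw [vermaF_vec, map_smul, vermaE_succ, vermaK_vec, vermaK_vec, smul_smul, ← sub_smul, key n,
      add_smul, smul_smul]
    congr 1
    · cases n with
      | zero => simp [vermaE_zero, qInt_zero]
      | succ n =>
        rw [vermaE_succ, map_smul, vermaF_vec, smul_smul, mul_comm]
        push_cast
        ring_nf
    · simp

/-- The action of `U` on its Verma module of highest weight `lam`. -/
def vermaRep (lam : ℤ) : U →ₐ[Qv] Module.End Qv (ℕ →₀ Qv) := (exists_verma_rep lam).choose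

/-- The basis vectors of the standard monomial model of `U`. -/
abbrev pbwVec (a : ℕ) (b : ℤ) (c : ℕ) : ℕ × ℤ × ℕ →₀ Qv := Finsupp.single (a, b, c) 1

/-- Left multiplication by `E` in the standard monomial model of `U`. -/
def pbwE : Module.End Qv (ℕ × ℤ × ℕ →₀ Qv) :=
  Finsupp.linearCombination Qv fun p => v ^ (-2 * p.2.1) • pbwVec p.1 p.2.1 (p.2.2 + 1) +
    (qInt p.1 * (v - v⁻¹)⁻¹) • (v ^ (1 - (p.1 : ℤ)) • pbwVec (p.1 - 1) (p.2.1 + 1) p.2.2 -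
      v ^ ((p.1 : ℤ) - 1) • pbwVec (p.1 - 1) (p.2.1 - 1) p.2.2)

/-- Left multiplication by `F` in the standard monomial model of `U`. -/
def pbwF : Module.End Qv (ℕ × ℤ × ℕ →₀ Qv) :=
  Finsupp.linearCombination Qv fun p => pbwVec (p.1 + 1) p.2.1 p.2.2

/-- Left multiplication by `K^ε` in the standard monomial model of `U`. -/
def pbwK (ε : ℤ) : Module.End Qv (ℕ × ℤ × ℕ →₀ Qv) :=
  Finsupp.linearCombination Qv fun p => v ^ (-2 * ε * p.1) • pbwVec p.1 (p.2.1 + ε) p.2.2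

lemma pbwE_vec (a : ℕ) (b : ℤ) (c : ℕ) : pbwE (pbwVec a b c) =
    v ^ (-2 * b) • pbwVec a b (c + 1) + (qInt a * (v - v⁻¹)⁻¹) •
      (v ^ (1 - (a : ℤ)) • pbwVec (a - 1) (b + 1) c -
        v ^ ((a : ℤ) - 1) • pbwVec (a - 1) (b - 1) c) := by
  simp only [pbwE, Finsupp.linearCombination_single, one_smul]

lemma pbwF_vec (a : ℕ) (b : ℤ) (c : ℕ) : pbwF (pbwVec a b c) = pbwVec (a + 1) b c := by
  simp only [pbwF, Finsupp.linearCombination_single, one_smul]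

lemma pbwK_vec (ε : ℤ) (a : ℕ) (b : ℤ) (c : ℕ) :
    pbwK ε (pbwVec a b c) = v ^ (-2 * ε * a) • pbwVec a (b + ε) c := by
  simp only [pbwK, Finsupp.linearCombination_single, one_smul]

/-- The basis vector `(a, b, c)` stands for `F^a K^b E^c`, and the operators are what left
multiplication must be. Checking the relations on them gives the independence half of the PBW
theorem. The truncated `a - 1` in `pbwE` is harmless at `a = 0`, its coefficient being `[0] = 0`. -/
lemma exists_pbw_rep : ∃ φ : U →ₐ[Qv] Module.End Qv (ℕ × ℤ × ℕ →₀ Qv),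
    φ (gen Gen.E) = pbwE ∧ φ (gen Gen.F) = pbwF ∧ φ (gen Gen.K) = pbwK 1 ∧
      φ (gen Gen.Kinv) = pbwK (-1) := by
  have hv := v_ne_zero
  have hd := v_sub_ne
  refine exists_algHom_of_relations (B := Module.End Qv (ℕ × ℤ × ℕ →₀ Qv)) _ _ _ _ ?_ ?_ ?_ ?_ ?_
  · refine Finsupp.lhom_ext' fun ⟨a, b, c⟩ => LinearMap.ext_ring ?_
    simp only [LinearMap.comp_apply, Finsupp.lsingle_apply, Module.End.mul_apply, pbwK_vec,
      map_smul, smul_smul, ← zpow_add₀ hv, Module.End.one_apply]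
    rw [show -2 * -1 * (a : ℤ) + -2 * 1 * a = 0 by ring, zpow_zero, one_smul, neg_add_cancel_right]
  · refine Finsupp.lhom_ext' fun ⟨a, b, c⟩ => LinearMap.ext_ring ?_
    simp only [LinearMap.comp_apply, Finsupp.lsingle_apply, Module.End.mul_apply, pbwK_vec,
      map_smul, smul_smul, ← zpow_add₀ hv, Module.End.one_apply]
    rw [show -2 * 1 * (a : ℤ) + -2 * -1 * a = 0 by ring, zpow_zero, one_smul, add_neg_cancel_right]
  · refine Finsupp.lhom_ext' fun ⟨a, b, c⟩ => LinearMap.ext_ring ?_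
    simp only [LinearMap.comp_apply, Finsupp.lsingle_apply, Module.End.mul_apply,
      LinearMap.smul_apply]
    simp only [pbwE_vec, pbwK_vec, map_smul, map_add, map_sub, smul_add, smul_sub, smul_smul]
    rw [show b + 1 - 1 = b - 1 + 1 by ring]
    have h1 : v ^ (a : ℤ) ≠ 0 := zpow_ne_zero _ hv
    have h2 : v ^ b ≠ 0 := zpow_ne_zero _ hv
    have hz : ∀ n : ℤ, v ^ (-2 * n) = (v ^ n)⁻¹ * (v ^ n)⁻¹ := fun n => by
      rw [← zpow_neg, ← zpow_add₀ hv]; ring_nf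
    cases a with
    | zero =>
      simp only [Nat.cast_zero, qInt_zero, zero_mul, zero_smul, sub_zero, add_zero, mul_zero]
      generalize pbwVec _ _ _ = x
      congr 1
      rw [← zpow_add₀ hv, ← zpow_add₀ hv, ← zpow_add₀ hv]
      ring_nf
    | succ a =>
      simp only [Nat.add_sub_cancel]
      refine congrArg₂ _ (congrArg (· • _) ?_)
        (congrArg₂ _ (congrArg (· • _) ?_) (congrArg (· • _) ?_))
      · rw [← zpow_add₀ hv, ← zpow_add₀ hv, ← zpow_add₀ hv]
        ring_nf
      all_goals
        rw [mul_assoc (qInt _ * _), ← zpow_add₀ hv, mul_left_comm (v ^ (_ : ℤ)) (qInt _ * _),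
          mul_left_comm (v ^ (_ : ℤ)) (qInt _ * _), ← zpow_add₀ hv, ← zpow_add₀ hv]
        push_cast
        ring_nf
  · refine Finsupp.lhom_ext' fun ⟨a, b, c⟩ => LinearMap.ext_ring ?_
    simp only [LinearMap.comp_apply, Finsupp.lsingle_apply, Module.End.mul_apply,
      LinearMap.smul_apply]
    simp only [pbwF_vec, pbwK_vec, map_smul, smul_smul, ← zpow_add₀ hv]
    push_cast
    ring_nf
  · refine Finsupp.lhom_ext' fun ⟨a, b, c⟩ => LinearMap.ext_ring ?_
    simp only [LinearMap.comp_apply, Finsupp.lsingle_apply, Module.End.mul_apply,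
      LinearMap.smul_apply, LinearMap.add_apply, LinearMap.sub_apply]
    rw [pbwF_vec, pbwE_vec, pbwE_vec, pbwK_vec, pbwK_vec, Nat.add_sub_cancel]
    simp only [map_add, map_sub, map_smul, pbwF_vec]
    have h1 : v ^ (a : ℤ) ≠ 0 := zpow_ne_zero _ hv
    have h2 : v ^ b ≠ 0 := zpow_ne_zero _ hv
    -- The coefficients of `K` (`e = 1`) and of `K⁻¹` (`e = -1`) in the relation for `EF - FE`.
    have hK : ∀ e : ℤ, e = 1 ∨ e = -1 →
        qInt ((a : ℤ) + 1) * (v - v⁻¹)⁻¹ * v ^ (e * -a) =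
        qInt a * (v - v⁻¹)⁻¹ * v ^ (e * (1 - a)) + (v - v⁻¹)⁻¹ * v ^ (-2 * e * a) := by
      rintro e (rfl | rfl)
      all_goals
        simp only [qInt, neg_mul, one_mul, mul_one, neg_add_rev, neg_neg, neg_sub, two_mul,
          mul_neg, zpow_add₀ hv, zpow_sub₀ hv, zpow_neg, zpow_one]
        field_simp
        ring
    have e1 := hK 1 (Or.inl rfl)
    have e2 := hK (-1) (Or.inr rfl)
    rw [one_mul, one_mul] at e1
    rw [neg_mul, one_mul, neg_neg, neg_mul, one_mul, neg_sub] at e2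
    rw [Nat.cast_add, Nat.cast_one, show 1 - ((a : ℤ) + 1) = -a by ring, add_sub_cancel_right,
      smul_sub, smul_smul, smul_smul, e1, e2, add_assoc, ← sub_eq_add_neg b]
    refine congrArg₂ _ rfl ?_
    cases a with
    | zero =>
      simp only [Nat.cast_zero, qInt_zero, zero_mul, zero_smul, sub_zero, zero_add, mul_zero,
        smul_sub, smul_smul]
    | succ a =>
      rw [Nat.add_sub_cancel, smul_sub, smul_sub, smul_smul, smul_smul, smul_smul, smul_smul,
        add_smul, add_smul, add_sub_add_comm]

/-! ### Coordinates on the quantum group over `ℚ(v)` -/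

section omega
variable (lam : ℤ)

lemma vermaRep_E : vermaRep lam (gen Gen.E) = vermaE lam := (exists_verma_rep lam).choose_spec.1

lemma vermaRep_F : vermaRep lam (gen Gen.F) = vermaF := (exists_verma_rep lam).choose_spec.2.1

lemma vermaRep_K : vermaRep lam (gen Gen.K) = vermaK lam 1 :=
  (exists_verma_rep lam).choose_spec.2.2.1

lemma vermaRep_Kinv : vermaRep lam (gen Gen.Kinv) = vermaK lam (-1) :=
  (exists_verma_rep lam).choose_spec.2.2.2

lemma vermaRep_divPow_E (k : ℕ) (hk : 1 ≤ k) :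
    vermaRep lam (divPow (gen Gen.E) k) (vermaVec 0) = 0 := by
  obtain ⟨k, rfl⟩ : ∃ j, k = j + 1 := ⟨k - 1, by omega⟩
  rw [divPow, pow_succ, map_smul, map_mul, vermaRep_E, LinearMap.smul_apply, Module.End.mul_apply,
    vermaE_zero, map_zero, smul_zero]

lemma vermaRep_binK (c : ℤ) (t : ℕ) :
    vermaRep lam (binK c t) (vermaVec 0) = qBin (lam + c) t • vermaVec 0 := by
  have hv := v_ne_zero
  have hd := v_sub_ne
  induction t with
  | zero => simp [binK, qBin_zero_right]
  | succ t ih =>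
    have ht : qInt ((t : ℤ) + 1) ≠ 0 := qInt_ne (by positivity)
    rw [binK_succ, map_smul, map_mul, LinearMap.smul_apply, Module.End.mul_apply, qK, map_smul,
      map_sub, map_smul, map_smul, vermaRep_K, vermaRep_Kinv]
    simp only [LinearMap.smul_apply, LinearMap.sub_apply, vermaK_vec, smul_smul,
      ← zpow_add₀ hv, ← sub_smul]
    rw [map_smul, ih, smul_smul, smul_smul, qBin_succ]
    congr 1
    simp only [qInt]
    push_cast
    ring_nf

lemma vermaRep_divPow_F (a : ℕ) :
    vermaRep lam (divPow (gen Gen.F) a) (vermaVec 0) = vermaVec a := by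
  induction a with
  | zero => simp [divPow_zero]
  | succ a ih =>
    have ha : qInt ((a : ℤ) + 1) ≠ 0 := qInt_ne (by positivity)
    have h := congrArg (fun x => vermaRep lam x (vermaVec 0)) (mul_divPow (gen Gen.F) a)
    simp only [map_mul, Module.End.mul_apply, map_smul, LinearMap.smul_apply, ih, vermaRep_F,
      vermaF_vec] at h
    exact (smul_right_injective _ ha h).symm

/-- The coefficient of the `n`-th basis vector of the Verma module in `u` times the highest weight
vector. -/
def omega (n : ℕ) : U →ₗ[Qv] Qv :=
  Finsupp.lapply n ∘ₗ LinearMap.applyₗ (vermaVec 0) ∘ₗ (vermaRep lam).toLinearMap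

lemma omega_apply (n : ℕ) (u : U) : omega lam n u = vermaRep lam u (vermaVec 0) n := rfl

lemma omega_mul (n : ℕ) (u w : U) (s : Qv)
    (h : vermaRep lam w (vermaVec 0) = s • vermaVec 0) :
    omega lam n (u * w) = s * omega lam n u := by
  rw [omega_apply, map_mul, Module.End.mul_apply, h, map_smul]
  rfl

lemma omega_mul_divPow_E (n : ℕ) (u : U) (k : ℕ) (hk : 1 ≤ k) :
    omega lam n (u * divPow (gen Gen.E) k) = 0 := by
  rw [omega_mul lam n u _ 0 (by rw [vermaRep_divPow_E lam k hk, zero_smul]), zero_mul]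

lemma omega_mul_K (n : ℕ) (u : U) : omega lam n (u * gen Gen.K) = v ^ lam * omega lam n u :=
  omega_mul lam n u _ _ (by rw [vermaRep_K, vermaK_vec]; simp)

lemma omega_mul_binK (n : ℕ) (u : U) (c : ℤ) (t : ℕ) :
    omega lam n (u * binK c t) = qBin (lam + c) t * omega lam n u :=
  omega_mul lam n u _ _ (vermaRep_binK lam c t)

lemma omega_divPow_F (n a : ℕ) :
    omega lam n (divPow (gen Gen.F) a) = if a = n then 1 else 0 := by
  rw [omega_apply, vermaRep_divPow_F, Finsupp.single_apply]

/-- The `n`-th vector has weight `lam - 2n`. At `v = ξ` the `ℓ`-th power of this scalar is `1`,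
which later makes `omega` descend to the quotient by `K^ℓ = 1`. -/
lemma omega_K_mul (n : ℕ) (u : U) :
    omega lam n (gen Gen.K * u) = v ^ (lam - 2 * n) * omega lam n u := by
  have h : Finsupp.lapply n ∘ₗ vermaK lam 1 =
      v ^ (lam - 2 * n) • (Finsupp.lapply n : (ℕ →₀ Qv) →ₗ[Qv] Qv) := by
    refine Finsupp.lhom_ext' fun m => LinearMap.ext_ring ?_
    simp only [LinearMap.comp_apply, Finsupp.lsingle_apply, vermaK_vec, LinearMap.smul_apply,
      map_smul, Finsupp.lapply_apply, one_mul]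
    by_cases hm : m = n
    · rw [hm]
    · simp [Finsupp.single_apply, hm]
  rw [omega_apply, map_mul, vermaRep_K]
  exact LinearMap.congr_fun h _

end omega

/-! ### Coefficients of `E⁽ⁿ⁾` over the nonpositive part -/

section proj

/-- The action of `U` on its standard monomial model. -/
def pbwRep : U →ₐ[Qv] Module.End Qv (ℕ × ℤ × ℕ →₀ Qv) := exists_pbw_rep.choose

lemma pbwRep_E : pbwRep (gen Gen.E) = pbwE := exists_pbw_rep.choose_spec.1

lemma pbwRep_F : pbwRep (gen Gen.F) = pbwF := exists_pbw_rep.choose_spec.2.1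

lemma pbwRep_K : pbwRep (gen Gen.K) = pbwK 1 := exists_pbw_rep.choose_spec.2.2.1

/-- The element `K` as a unit. -/
def unitK : Uˣ := ⟨gen Gen.K, gen Gen.Kinv, K_Kinv, Kinv_K⟩

/-- The map sending the monomial `F^a K^b E^c` to `[n]! F^a K^b` if `c = n`, and to `0`
otherwise. -/
def pbwCoeff (n : ℕ) : (ℕ × ℤ × ℕ →₀ Qv) →ₗ[Qv] U :=
  Finsupp.linearCombination Qv fun p =>
    if p.2.2 = n then qFact n • (gen Gen.F ^ p.1 * ((unitK ^ p.2.1 : Uˣ) : U)) else 0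

lemma pbwCoeff_vec (n a : ℕ) (b : ℤ) (c : ℕ) : pbwCoeff n (pbwVec a b c) =
    if c = n then qFact n • (gen Gen.F ^ a * ((unitK ^ b : Uˣ) : U)) else 0 := by
  simp only [pbwCoeff, Finsupp.linearCombination_single, one_smul]

/-- The coefficient of `E⁽ⁿ⁾` of an element of `U`, with respect to the basis `E⁽ⁿ⁾` of `U` over
its nonpositive part. -/
def projU (n : ℕ) : U →ₗ[Qv] U :=
  pbwCoeff n ∘ₗ LinearMap.applyₗ (pbwVec 0 0 0) ∘ₗ pbwRep.toLinearMap

lemma projU_apply (n : ℕ) (u : U) : projU n u = pbwCoeff n (pbwRep u (pbwVec 0 0 0)) := rfl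

lemma pow_eq_smul_divPow (x : U) (n : ℕ) : x ^ n = qFact n • divPow x n := by
  rw [divPow, smul_smul, mul_inv_cancel₀ (qFact_ne n), one_smul]

lemma projU_F_mul (n : ℕ) (u : U) : projU n (gen Gen.F * u) = gen Gen.F * projU n u := by
  have h : pbwCoeff n ∘ₗ pbwF = LinearMap.mulLeft Qv (gen Gen.F) ∘ₗ pbwCoeff n := by
    refine Finsupp.lhom_ext' fun ⟨a, b, c⟩ => LinearMap.ext_ring ?_
    simp only [LinearMap.comp_apply, Finsupp.lsingle_apply, pbwF_vec, pbwCoeff_vec,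
      LinearMap.mulLeft_apply]
    split_ifs
    · rw [mul_smul_comm, pow_succ', mul_assoc]
    · rw [mul_zero]
  rw [projU_apply, map_mul, pbwRep_F]
  exact LinearMap.congr_fun h _

lemma projU_K_mul (n : ℕ) (u : U) : projU n (gen Gen.K * u) = gen Gen.K * projU n u := by
  have h : pbwCoeff n ∘ₗ pbwK 1 = LinearMap.mulLeft Qv (gen Gen.K) ∘ₗ pbwCoeff n := by
    refine Finsupp.lhom_ext' fun ⟨a, b, c⟩ => LinearMap.ext_ring ?_
    simp only [LinearMap.comp_apply, Finsupp.lsingle_apply, pbwK_vec, map_smul, pbwCoeff_vec,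
      LinearMap.mulLeft_apply]
    split_ifs
    · rw [mul_smul_comm, smul_comm, ← mul_assoc, pow_eq_smul_divPow, mul_smul_comm, K_divPow_F,
        add_comm b 1, zpow_add, zpow_one]
      simp only [smul_mul_assoc, mul_assoc, smul_smul, Units.val_mul, zpow_one, mul_one]
      rw [mul_comm (v ^ (_ : ℤ))]
      rfl
    · rw [mul_zero, smul_zero]
  rw [projU_apply, map_mul, pbwRep_K]
  exact LinearMap.congr_fun h _

lemma projU_Kinv_mul (n : ℕ) (u : U) : projU n (gen Gen.Kinv * u) = gen Gen.Kinv * projU n u := by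
  calc projU n (gen Gen.Kinv * u)
      = gen Gen.Kinv * (gen Gen.K * projU n (gen Gen.Kinv * u)) := by
        rw [← mul_assoc, Kinv_K, one_mul]
    _ = _ := by rw [← projU_K_mul, ← mul_assoc, K_Kinv, one_mul]

lemma projU_divPow_E (n m : ℕ) :
    projU n (divPow (gen Gen.E) m) = if m = n then 1 else 0 := by
  have h : ∀ m : ℕ, pbwRep (gen Gen.E ^ m) (pbwVec 0 0 0) = pbwVec 0 0 m := by
    intro m
    induction m with
    | zero => simp
    | succ m ih =>
      rw [pow_succ', map_mul, Module.End.mul_apply, ih, pbwRep_E, pbwE_vec]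
      simp [qInt_zero]
  rw [divPow, map_smul, projU_apply, h, pbwCoeff_vec]
  split_ifs with hm
  · subst hm
    simp [smul_smul, inv_mul_cancel₀ (qFact_ne m)]
  · rw [smul_zero]

/-- The nonpositive part of `U`. -/
def nonposU : Subalgebra Qv U := Algebra.adjoin Qv {gen Gen.F, gen Gen.K, gen Gen.Kinv}

lemma F_mem_nonposU : gen Gen.F ∈ nonposU := Algebra.subset_adjoin (by simp)

lemma K_mem_nonposU : gen Gen.K ∈ nonposU := Algebra.subset_adjoin (by simp)

lemma Kinv_mem_nonposU : gen Gen.Kinv ∈ nonposU := Algebra.subset_adjoin (by simp)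

lemma divPow_F_mem_nonposU (n : ℕ) : divPow (gen Gen.F) n ∈ nonposU :=
  nonposU.smul_mem (nonposU.pow_mem F_mem_nonposU n) _

lemma binK_mem_nonposU (c : ℤ) (t : ℕ) : binK c t ∈ nonposU := by
  induction t with
  | zero => exact nonposU.one_mem
  | succ t ih =>
    exact nonposU.mul_mem ih (nonposU.smul_mem (nonposU.sub_mem
      (nonposU.smul_mem K_mem_nonposU _) (nonposU.smul_mem Kinv_mem_nonposU _)) _)

/-- This linearity is what makes the coefficient map, once specialized, a homomorphism of left
`B_ℓ⁻`-modules, hence an element of the semiregular module. -/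
lemma projU_mul_of_mem (n : ℕ) {b : U} (hb : b ∈ nonposU) (u : U) :
    projU n (b * u) = b * projU n u := by
  induction hb using Algebra.adjoin_induction generalizing u with
  | mem x hx =>
    rcases hx with rfl | rfl | rfl
    · exact projU_F_mul n u
    · exact projU_K_mul n u
    · exact projU_Kinv_mul n u
  | algebraMap r => simp only [← Algebra.smul_def, map_smul]
  | add x y _ _ hx hy => rw [add_mul, map_add, hx, hy, add_mul]
  | mul x y _ _ hx hy => rw [mul_assoc, hx, hy, mul_assoc]

end proj

/-! ### Normal form in the integral form -/

/-- `E⁽ⁿ⁾` in the integral form. -/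
def EA (n : ℕ) : UA := ⟨divPow (gen Gen.E) n, E_mem n⟩

/-- `F⁽ⁿ⁾` in the integral form. -/
def FA (n : ℕ) : UA := ⟨divPow (gen Gen.F) n, F_mem n⟩

/-- `K` in the integral form. -/
def KA : UA := ⟨gen Gen.K, K_mem⟩

/-- `K⁻¹` in the integral form. -/
def KinvA : UA := ⟨gen Gen.Kinv, Kinv_mem⟩

/-- `[K; c; t]` in the integral form. -/
def binA (c : ℤ) (t : ℕ) : UA := ⟨binK c t, binK_mem c t⟩

lemma KA_KinvA : KA * KinvA = 1 := Subtype.ext K_Kinv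

lemma KinvA_KA : KinvA * KA = 1 := Subtype.ext Kinv_K

lemma EA_zero : EA 0 = 1 := Subtype.ext (divPow_zero _)

lemma FA_zero : FA 0 = 1 := Subtype.ext (divPow_zero _)

lemma EA_mul_EA (m n : ℕ) : EA m * EA n = qBinA ((m : ℤ) + n) m • EA (m + n) :=
  Subtype.ext ((divPow_mul_divPow _ m n).trans (qBinA_smul _ _ _).symm)

lemma FA_mul_FA (m n : ℕ) : FA m * FA n = qBinA ((m : ℤ) + n) m • FA (m + n) :=
  Subtype.ext ((divPow_mul_divPow _ m n).trans (qBinA_smul _ _ _).symm)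

lemma KA_mul_EA (n : ℕ) : KA * EA n = (T (2 * (n : ℤ)) : A) • (EA n * KA) :=
  Subtype.ext ((K_divPow_E n).trans (T_smul _ _).symm)

lemma KinvA_mul_EA (n : ℕ) : KinvA * EA n = (T (-(2 * (n : ℤ))) : A) • (EA n * KinvA) :=
  Subtype.ext ((Kinv_mul_of_K_mul (K_divPow_E n)).trans (T_smul _ _).symm)

lemma KA_mul_FA (n : ℕ) : KA * FA n = (T (-2 * (n : ℤ)) : A) • (FA n * KA) :=
  Subtype.ext ((K_divPow_F n).trans (T_smul _ _).symm)

lemma KinvA_mul_FA (n : ℕ) : KinvA * FA n = (T (-(-2 * (n : ℤ))) : A) • (FA n * KinvA) :=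
  Subtype.ext ((Kinv_mul_of_K_mul (K_divPow_F n)).trans (T_smul _ _).symm)

lemma EA_mul_binA (n : ℕ) (c : ℤ) (t : ℕ) : EA n * binA c t = binA (c - 2 * n) t * EA n :=
  Subtype.ext (divPow_E_binK n c t)

lemma binA_mul_FA (n : ℕ) (c : ℤ) (t : ℕ) : binA c t * FA n = FA n * binA (c - 2 * n) t :=
  Subtype.ext (binK_divPow_F n c t)

lemma EA_mul_FA (r s : ℕ) : EA r * FA s =
    ∑ j ∈ Finset.range (min r s + 1), FA (s - j) * binA (2 * j - r - s) j * EA (r - j) := by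
  apply Subtype.ext
  rw [AddSubmonoidClass.coe_finsetSum]
  exact divPow_E_mul_divPow_F r s

lemma T_smul_T_neg_smul {M : Type*} [AddCommGroup M] [Module A M] (n : ℤ) (x : M) :
    (T n : A) • (T (-n) : A) • x = x := by
  rw [smul_smul, ← T_add, add_neg_cancel, T_zero, one_smul]

lemma EA_mul_KA (n : ℕ) : EA n * KA = (T (-(2 * (n : ℤ))) : A) • (KA * EA n) := by
  have := T_smul_T_neg_smul (-(2 * (n : ℤ))) (EA n * KA)
  rw [neg_neg, ← KA_mul_EA] at this
  exact this.symm

lemma EA_mul_KinvA (n : ℕ) : EA n * KinvA = (T (2 * (n : ℤ)) : A) • (KinvA * EA n) := by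
  rw [KinvA_mul_EA, T_smul_T_neg_smul]

lemma binA_shift (c : ℤ) (t : ℕ) : binA (c + 1) (t + 1) =
    (T ((t : ℤ) + 1) : A) • binA c (t + 1) + (T ((t : ℤ) - c) : A) • (KinvA * binA c t) :=
  Subtype.ext ((binK_shift c t).trans (congrArg₂ _ (T_smul _ _).symm (T_smul _ _).symm))

lemma binA_zero (c : ℤ) : binA c 0 = 1 := rfl

/-- The Cartan part of the integral form. -/
def cartanA : Subalgebra A UA := Algebra.adjoin A ({KA, KinvA} ∪ {x | ∃ c t, x = binA c t})

lemma KA_mem : KA ∈ cartanA := Algebra.subset_adjoin (Or.inl (Or.inl rfl))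

lemma KinvA_mem : KinvA ∈ cartanA := Algebra.subset_adjoin (Or.inl (Or.inr rfl))

lemma binA_mem (c : ℤ) (t : ℕ) : binA c t ∈ cartanA := Algebra.subset_adjoin (Or.inr ⟨c, t, rfl⟩)

lemma exists_cartanA_mul_FA {h : UA} (hh : h ∈ cartanA) (a : ℕ) :
    ∃ h' ∈ cartanA, h * FA a = FA a * h' := by
  induction hh using Algebra.adjoin_induction with
  | mem x hx =>
    rcases hx with (rfl | rfl) | ⟨c, t, rfl⟩
    · exact ⟨_, cartanA.smul_mem KA_mem _, by rw [KA_mul_FA, mul_smul_comm]⟩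
    · exact ⟨_, cartanA.smul_mem KinvA_mem _, by rw [KinvA_mul_FA, mul_smul_comm]⟩
    · exact ⟨_, binA_mem _ _, binA_mul_FA _ _ _⟩
  | algebraMap r => exact ⟨_, cartanA.algebraMap_mem r, Algebra.commutes _ _⟩
  | add x y _ _ hx hy =>
    obtain ⟨x', hx', ex⟩ := hx
    obtain ⟨y', hy', ey⟩ := hy
    exact ⟨_, cartanA.add_mem hx' hy', by rw [add_mul, ex, ey, mul_add]⟩
  | mul x y _ _ hx hy =>
    obtain ⟨x', hx', ex⟩ := hx
    obtain ⟨y', hy', ey⟩ := hy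
    exact ⟨_, cartanA.mul_mem hx' hy', by rw [mul_assoc, ey, ← mul_assoc, ex, mul_assoc]⟩

lemma exists_EA_mul_cartanA {h : UA} (hh : h ∈ cartanA) (c : ℕ) :
    ∃ h' ∈ cartanA, EA c * h = h' * EA c := by
  induction hh using Algebra.adjoin_induction with
  | mem x hx =>
    rcases hx with (rfl | rfl) | ⟨d, t, rfl⟩
    · exact ⟨_, cartanA.smul_mem KA_mem _, by rw [EA_mul_KA, smul_mul_assoc]⟩
    · exact ⟨_, cartanA.smul_mem KinvA_mem _, by rw [EA_mul_KinvA, smul_mul_assoc]⟩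
    · exact ⟨_, binA_mem _ _, EA_mul_binA _ _ _⟩
  | algebraMap r => exact ⟨_, cartanA.algebraMap_mem r, (Algebra.commutes _ _).symm⟩
  | add x y _ _ hx hy =>
    obtain ⟨x', hx', ex⟩ := hx
    obtain ⟨y', hy', ey⟩ := hy
    exact ⟨_, cartanA.add_mem hx' hy', by rw [mul_add, ex, ey, add_mul]⟩
  | mul x y _ _ hx hy =>
    obtain ⟨x', hx', ex⟩ := hx
    obtain ⟨y', hy', ey⟩ := hy
    exact ⟨_, cartanA.mul_mem hx' hy', by rw [← mul_assoc, ex, mul_assoc, ey, mul_assoc]⟩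

/-- The span of the ordered monomials of degree `d` in the integral form. -/
def normalForm (d : ℤ) : Submodule A UA :=
  Submodule.span A {x | ∃ (a c : ℕ) (h : UA), (c : ℤ) - a = d ∧ h ∈ cartanA ∧ x = FA a * h * EA c}

lemma mem_normalForm {a c : ℕ} {h : UA} {d : ℤ} (hd : (c : ℤ) - a = d) (hh : h ∈ cartanA) :
    FA a * h * EA c ∈ normalForm d := Submodule.subset_span ⟨a, c, h, hd, hh, rfl⟩

lemma mul_mem_normalForm_of {x : UA} {d e : ℤ}
    (hx : ∀ (a c : ℕ) (h : UA), (c : ℤ) - a = d → h ∈ cartanA →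
      x * (FA a * h * EA c) ∈ normalForm e) {y : UA} (hy : y ∈ normalForm d) :
    x * y ∈ normalForm e := by
  induction hy using Submodule.span_induction with
  | mem y hy =>
    obtain ⟨a, c, h, hd, hh, rfl⟩ := hy
    exact hx a c h hd hh
  | zero => rw [mul_zero]; exact zero_mem _
  | add y z _ _ hy hz => rw [mul_add]; exact add_mem hy hz
  | smul r y _ hy => rw [mul_smul_comm]; exact Submodule.smul_mem _ _ hy

lemma cartanA_mul_mem_normalForm {x : UA} (hx : x ∈ cartanA) {d : ℤ} {y : UA}
    (hy : y ∈ normalForm d) : x * y ∈ normalForm d := by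
  refine mul_mem_normalForm_of (fun a c h hd hh => ?_) hy
  obtain ⟨x', hx', e⟩ := exists_cartanA_mul_FA hx a
  rw [← mul_assoc, ← mul_assoc, e, mul_assoc (FA a)]
  exact mem_normalForm hd (cartanA.mul_mem hx' hh)

lemma FA_mul_mem_normalForm (n : ℕ) {d : ℤ} {y : UA} (hy : y ∈ normalForm d) :
    FA n * y ∈ normalForm (-n + d) := by
  refine mul_mem_normalForm_of (fun a c h hd hh => ?_) hy
  rw [← mul_assoc, ← mul_assoc, FA_mul_FA, smul_mul_assoc, smul_mul_assoc]
  exact Submodule.smul_mem _ _ (mem_normalForm (by push_cast; linarith) hh)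

/-- The straightening step: `E` is moved past `F` by `EA_mul_FA` and past the Cartan part. The bound
`j ≤ min n a` makes the truncated subtractions exact, so each term has the right degree. -/
lemma EA_mul_mem_normalForm (n : ℕ) {d : ℤ} {y : UA} (hy : y ∈ normalForm d) :
    EA n * y ∈ normalForm (n + d) := by
  refine mul_mem_normalForm_of (fun a c h hd hh => ?_) hy
  rw [← mul_assoc, ← mul_assoc, EA_mul_FA, Finset.sum_mul, Finset.sum_mul]
  refine Submodule.sum_mem _ fun j hj => ?_
  have hj' : j ≤ n ∧ j ≤ a := by
    have := Finset.mem_range.mp hj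
    omega
  obtain ⟨h', hh', e⟩ := exists_EA_mul_cartanA hh (n - j)
  rw [mul_assoc _ _ h, e, mul_assoc, mul_assoc h', EA_mul_EA, mul_smul_comm, mul_smul_comm,
    ← mul_assoc, mul_assoc (FA _)]
  refine Submodule.smul_mem _ _ (mem_normalForm ?_ (cartanA.mul_mem (binA_mem _ _) hh'))
  omega

lemma one_mem_normalForm : (1 : UA) ∈ normalForm 0 := by
  have := mem_normalForm (a := 0) (c := 0) (d := 0) (by simp) cartanA.one_mem
  rwa [FA_zero, EA_zero, mul_one, mul_one] at this

/-- The ordered monomials span the integral form. -/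
lemma mem_iSup_normalForm (y : UA) : y ∈ ⨆ d, normalForm d := by
  -- Left multiplication by every element of `UA` preserves the span of ordered monomials; apply
  -- this to `1`.
  suffices h : ∀ x ∈ UA, ∀ hx : x ∈ UA, ∀ z ∈ ⨆ d, normalForm d, (⟨x, hx⟩ : UA) * z ∈
      ⨆ d, normalForm d by
    have := h y.1 y.2 y.2 1 (Submodule.mem_iSup_of_mem 0 one_mem_normalForm)
    rwa [mul_one] at this
  have key : ∀ (x : UA) (k : ℤ), (∀ d, ∀ z ∈ normalForm d, x * z ∈ normalForm (k + d)) →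
      ∀ z ∈ ⨆ d, normalForm d, x * z ∈ ⨆ d, normalForm d := by
    intro x k hx z hz
    induction hz using Submodule.iSup_induction' with
    | mem d z hz => exact Submodule.mem_iSup_of_mem _ (hx d z hz)
    | zero => rw [mul_zero]; exact zero_mem _
    | add z w _ _ hz hw => rw [mul_add]; exact add_mem hz hw
  intro x hx
  induction hx using Algebra.adjoin_induction with
  | mem x hx =>
    intro hx'
    rcases hx with (⟨n, rfl⟩ | ⟨n, rfl⟩) | rfl | rfl
    · exact key (EA n) n fun d z hz => EA_mul_mem_normalForm n hz
    · exact key (FA n) (-n) fun d z hz => FA_mul_mem_normalForm n hz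
    · exact key KA 0 fun d z hz => by
        rw [zero_add]; exact cartanA_mul_mem_normalForm KA_mem hz
    · exact key KinvA 0 fun d z hz => by
        rw [zero_add]; exact cartanA_mul_mem_normalForm KinvA_mem hz
  | algebraMap r =>
    intro _ z hz
    have : (algebraMap A UA r) * z ∈ ⨆ d, normalForm d := by
      rw [← Algebra.smul_def]; exact Submodule.smul_mem _ _ hz
    exact this
  | add x y hx hy ihx ihy =>
    intro _ z hz
    have : ((⟨x, hx⟩ : UA) + ⟨y, hy⟩) * z ∈ ⨆ d, normalForm d := by
      rw [add_mul]; exact add_mem (ihx hx z hz) (ihy hy z hz)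
    exact this
  | mul x y hx hy ihx ihy =>
    intro _ z hz
    have : ((⟨x, hx⟩ : UA) * ⟨y, hy⟩) * z ∈ ⨆ d, normalForm d := by
      rw [mul_assoc]; exact ihx hx _ (ihy hy z hz)
    exact this

lemma induction_UA {p : UA → Prop}
    (hmon : ∀ (a c : ℕ) (h : UA), h ∈ cartanA → p (FA a * h * EA c))
    (hadd : ∀ x y, p x → p y → p (x + y)) (hsmul : ∀ (r : A) x, p x → p (r • x)) (y : UA) :
    p y := by
  have h0 : p 0 := by simpa using hsmul 0 _ (hmon 0 0 1 cartanA.one_mem)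
  have := mem_iSup_normalForm y
  induction this using Submodule.iSup_induction' with
  | mem d z hz =>
    induction hz using Submodule.span_induction with
    | mem y hy =>
      obtain ⟨a, c, h, -, hh, rfl⟩ := hy
      exact hmon a c h hh
    | zero => exact h0
    | add y z _ _ hy hz => exact hadd _ _ hy hz
    | smul r y _ hy => exact hsmul _ _ hy
  | zero => exact h0
  | add z w _ _ hz hw => exact hadd _ _ hz hw

/-! ### Coordinates on the integral form -/

lemma coe_smul_UA (a : A) (x : UA) : ((a • x : UA) : U) = algebraMap A Qv a • (x : U) := rfl

/-- The Cartan generators act on the highest weight vector by powers of `v` and by quantum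
binomials, and the latter lie in `𝒜` by `exists_qBinA`. -/
lemma exists_vermaRep_cartanA (lam : ℤ) {h : UA} (hh : h ∈ cartanA) :
    ∃ s : A, vermaRep lam (h : U) (vermaVec 0) = algebraMap A Qv s • vermaVec 0 := by
  induction hh using Algebra.adjoin_induction with
  | mem x hx =>
    rcases hx with (rfl | rfl) | ⟨c, t, rfl⟩
    · exact ⟨T lam, by simp [KA, vermaRep_K, vermaK_vec, algebraMap_T]⟩
    · exact ⟨T (-lam), by simp [KinvA, vermaRep_Kinv, vermaK_vec, algebraMap_T]⟩
    · exact ⟨qBinA (lam + c) t, by rw [algebraMap_qBinA]; exact vermaRep_binK lam c t⟩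
  | algebraMap r =>
    refine ⟨r, ?_⟩
    have : ((algebraMap A UA r : UA) : U) = algebraMap A Qv r • (1 : U) := by
      rw [Algebra.algebraMap_eq_smul_one]; rfl
    rw [this, map_smul, map_one]
    rfl
  | add x y _ _ hx hy =>
    obtain ⟨s, hs⟩ := hx
    obtain ⟨t, ht⟩ := hy
    exact ⟨s + t, by rw [Subalgebra.coe_add, map_add, LinearMap.add_apply, hs, ht, map_add,
      add_smul]⟩
  | mul x y _ _ hx hy =>
    obtain ⟨s, hs⟩ := hx
    obtain ⟨t, ht⟩ := hy
    exact ⟨t * s, by rw [Subalgebra.coe_mul, map_mul, Module.End.mul_apply, ht, map_smul, hs,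
      smul_smul, map_mul]⟩

/-- On `F⁽ᵃ⁾ h E⁽ᶜ⁾` the coordinate is `0` if `c ≥ 1`; otherwise it is the scalar of `h` times `0`
or `1`. Ordered monomials span, so all values are integral. -/
lemma exists_omega_UA (lam : ℤ) (n : ℕ) (y : UA) :
    ∃ s : A, algebraMap A Qv s = omega lam n (y : U) := by
  refine induction_UA (p := fun y => ∃ s : A, algebraMap A Qv s = omega lam n (y : U))
    (fun a c h hh => ?_) (fun x y hx hy => ?_) (fun r x hx => ?_) y
  · rcases Nat.eq_zero_or_pos c with rfl | hc
    · obtain ⟨s, hs⟩ := exists_vermaRep_cartanA lam hh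
      refine ⟨s * if a = n then 1 else 0, ?_⟩
      rw [EA_zero, mul_one, Subalgebra.coe_mul, omega_mul lam n _ _ _ hs]
      change _ = _ * omega lam n (divPow _ _)
      rw [omega_divPow_F, map_mul]
      split_ifs <;> simp
    · refine ⟨0, ?_⟩
      rw [map_zero, Subalgebra.coe_mul]
      exact (omega_mul_divPow_E lam n _ c hc).symm
  · obtain ⟨s, hs⟩ := hx
    obtain ⟨t, ht⟩ := hy
    exact ⟨s + t, by rw [map_add, hs, ht, Subalgebra.coe_add, map_add]⟩
  · obtain ⟨s, hs⟩ := hx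
    exact ⟨r * s, by rw [map_mul, hs, coe_smul_UA, map_smul, smul_eq_mul]⟩

/-- The restriction of `omega` to the integral form. -/
def omegaA (lam : ℤ) (n : ℕ) (y : UA) : A := (exists_omega_UA lam n y).choose

lemma algebraMap_omegaA (lam : ℤ) (n : ℕ) (y : UA) :
    algebraMap A Qv (omegaA lam n y) = omega lam n (y : U) := (exists_omega_UA lam n y).choose_spec

lemma omegaA_add (lam : ℤ) (n : ℕ) (x y : UA) :
    omegaA lam n (x + y) = omegaA lam n x + omegaA lam n y :=
  algebraMap_A_injective (by simp only [map_add, algebraMap_omegaA, Subalgebra.coe_add])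

lemma omegaA_smul (lam : ℤ) (n : ℕ) (r : A) (y : UA) : omegaA lam n (r • y) = r * omegaA lam n y :=
  algebraMap_A_injective (by rw [map_mul, algebraMap_omegaA, algebraMap_omegaA, coe_smul_UA,
    map_smul, smul_eq_mul])

lemma omegaA_mul_EA (lam : ℤ) (n : ℕ) (y : UA) (k : ℕ) (hk : 1 ≤ k) :
    omegaA lam n (y * EA k) = 0 :=
  algebraMap_A_injective (by
    rw [algebraMap_omegaA, map_zero]; exact omega_mul_divPow_E lam n _ k hk)

lemma omegaA_mul_KA (lam : ℤ) (n : ℕ) (y : UA) : omegaA lam n (y * KA) = T lam * omegaA lam n y :=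
  algebraMap_A_injective (by
    rw [map_mul, algebraMap_omegaA, algebraMap_omegaA, algebraMap_T]; exact omega_mul_K lam n _)

lemma omegaA_mul_binA (lam : ℤ) (n : ℕ) (y : UA) (c : ℤ) (t : ℕ) :
    omegaA lam n (y * binA c t) = qBinA (lam + c) t * omegaA lam n y :=
  algebraMap_A_injective (by
    rw [map_mul, algebraMap_omegaA, algebraMap_omegaA, algebraMap_qBinA]
    exact omega_mul_binK lam n _ c t)

lemma omegaA_FA (lam : ℤ) (n a : ℕ) : omegaA lam n (FA a) = if a = n then 1 else 0 :=
  algebraMap_A_injective (by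
    rw [algebraMap_omegaA]
    refine (omega_divPow_F lam n a).trans ?_
    split_ifs <;> simp)

lemma omegaA_KA_mul (lam : ℤ) (n : ℕ) (y : UA) :
    omegaA lam n (KA * y) = T (lam - 2 * n) * omegaA lam n y :=
  algebraMap_A_injective (by
    rw [map_mul, algebraMap_omegaA, algebraMap_omegaA, algebraMap_T]; exact omega_K_mul lam n _)

lemma cartanA_coe_mem_nonposU {h : UA} (hh : h ∈ cartanA) : (h : U) ∈ nonposU := by
  induction hh using Algebra.adjoin_induction with
  | mem x hx =>
    rcases hx with (rfl | rfl) | ⟨c, t, rfl⟩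
    · exact K_mem_nonposU
    · exact Kinv_mem_nonposU
    · exact binK_mem_nonposU c t
  | algebraMap r => exact nonposU.algebraMap_mem (algebraMap A Qv r)
  | add x y _ _ hx hy => exact nonposU.add_mem hx hy
  | mul x y _ _ hx hy => exact nonposU.mul_mem hx hy

lemma projU_monomial (n a c : ℕ) {h : UA} (hh : h ∈ cartanA) :
    projU n ((FA a * h * EA c : UA) : U) = if c = n then ((FA a * h : UA) : U) else 0 := by
  have hb : ((FA a * h : UA) : U) ∈ nonposU :=
    nonposU.mul_mem (divPow_F_mem_nonposU a) (cartanA_coe_mem_nonposU hh)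
  rw [Subalgebra.coe_mul, projU_mul_of_mem n hb]
  change _ * projU n (divPow _ _) = _
  rw [projU_divPow_E]
  split_ifs
  · rw [mul_one]
  · rw [mul_zero]

/-- Checked on ordered monomials, where the coefficient is `F⁽ᵃ⁾ h` or `0`. -/
lemma projU_mem (n : ℕ) (y : UA) : projU n (y : U) ∈ UA := by
  refine induction_UA (p := fun y => projU n (y : U) ∈ UA)
    (fun a c h hh => ?_) (fun x y hx hy => ?_) (fun r x hx => ?_) y
  · rw [projU_monomial n a c hh]
    split_ifs
    · exact Subtype.property _
    · exact zero_mem _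
  · rw [Subalgebra.coe_add, map_add]; exact add_mem hx hy
  · rw [coe_smul_UA, map_smul]; exact UA.smul_mem hx r

/-- The coefficient of `E⁽ⁿ⁾` of an element of the integral form. -/
def projA (n : ℕ) : UA →ₗ[A] UA where
  toFun y := ⟨projU n (y : U), projU_mem n y⟩
  map_add' x y := Subtype.ext (map_add (projU n) (x : U) y)
  map_smul' r x := Subtype.ext (map_smul (projU n) (algebraMap A Qv r) (x : U))

lemma projA_monomial (n a c : ℕ) {h : UA} (hh : h ∈ cartanA) :
    projA n (FA a * h * EA c) = if c = n then FA a * h else 0 := by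
  apply Subtype.ext
  refine (projU_monomial n a c hh).trans ?_
  split_ifs <;> rfl

lemma projA_mul_of_mem (n : ℕ) {b : UA} (hb : (b : U) ∈ nonposU) (y : UA) :
    projA n (b * y) = b * projA n y := Subtype.ext (projU_mul_of_mem n hb y)

/-! ### Descent to the specialization -/

section descent
variable {ℓ : ℕ} {ξ : ℂˣ}

lemma specHom_T (n : ℤ) : specHom ξ (T n) = ((ξ ^ n : ℂˣ) : ℂ) := by
  rw [specHom, LaurentPolynomial.eval₂_T]

lemma toUtilde_smul (a : A) (y : UA) : toUtilde ξ (a • y) = specHom ξ a • toUtilde ξ y := by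
  change (1 : Cspec ξ) ⊗ₜ[A] (a • y) = specHom ξ a • ((1 : Cspec ξ) ⊗ₜ[A] y)
  rw [← TensorProduct.smul_tmul, TensorProduct.smul_tmul']
  rfl

lemma tmul_eq_smul_toUtilde (c : ℂ) (y : UA) :
    (show Cspec ξ from c) ⊗ₜ[A] y = c • toUtilde ξ y := by
  change _ = c • ((1 : Cspec ξ) ⊗ₜ[A] y)
  rw [TensorProduct.smul_tmul']
  congr 1
  exact (mul_one c).symm

/-- Induction on elements of the specialized integral form. -/
lemma Utilde_induction {p : Utilde ξ → Prop} (h : ∀ (c : ℂ) (y : UA), p (c • toUtilde ξ y))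
    (hadd : ∀ x y, p x → p y → p (x + y)) (x : Utilde ξ) : p x := by
  induction x using TensorProduct.induction_on with
  | zero => simpa using h 0 0
  | tmul c y => exact (tmul_eq_smul_toUtilde (ξ := ξ) c y) ▸ h c y
  | add x y hx hy => exact hadd x y hx hy

/-- The linear extension of a semilinear map on the integral form. -/
lemma exists_Utilde_lift {W : Type*} [AddCommGroup W] [Module ℂ W] (θ : UA →+ W)
    (hθ : ∀ (a : A) (y : UA), θ (a • y) = specHom ξ a • θ y) :
    ∃ Θ : Utilde ξ →ₗ[ℂ] W, ∀ y, Θ (toUtilde ξ y) = θ y := by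
  -- `W` carries no `𝒜`-module structure, so the lift is taken additively, with semilinearity as the
  -- balancing condition; `ℂ`-linearity is verified afterwards.
  let f : Cspec ξ →+ UA →+ W :=
    { toFun := fun c =>
        { toFun := fun y => (show ℂ from c) • θ y
          map_zero' := by rw [map_zero, smul_zero]
          map_add' := fun x y => by rw [map_add, smul_add] }
      map_zero' := by ext y; exact zero_smul ℂ (θ y)
      map_add' := fun c d => by ext y; exact add_smul (show ℂ from c) (show ℂ from d) (θ y) }
  have hf : ∀ (a : A) (c : Cspec ξ) (y : UA), f (a • c) y = f c (a • y) := by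
    intro a c y
    change (specHom ξ a * (show ℂ from c)) • θ y = (show ℂ from c) • θ (a • y)
    rw [hθ, smul_smul, mul_comm]
  let Θ := TensorProduct.liftAddHom f hf
  have h1 : ∀ (c : ℂ) (y : UA), Θ (c • toUtilde ξ y) = c • θ y := by
    intro c y
    rw [← tmul_eq_smul_toUtilde]
    rfl
  have h2 : ∀ y, Θ (toUtilde ξ y) = θ y := fun y => by simpa using h1 1 y
  refine ⟨{ Θ with map_smul' := fun c x => ?_ }, h2⟩
  change Θ (c • x) = c • Θ x
  induction x using Utilde_induction with
  | h d y => rw [smul_smul, h1, h1, smul_smul]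
  | hadd x y hx hy => rw [smul_add, map_add, hx, hy, map_add, smul_add]

/-- Every generator `y` satisfies `K y = vⁿ y K` for some `n`, so `K^ℓ` commutes with it up to
`ξ^(nℓ) = 1`. -/
lemma toUtilde_KA_pow_commute (hξ : ξ ^ ℓ = 1) (x : Utilde ξ) :
    Commute (toUtilde ξ KA ^ ℓ) x := by
  have hT : ∀ n : ℤ, specHom ξ (T n) ^ ℓ = 1 := by
    intro n
    rw [specHom_T, ← Units.val_pow_eq_pow_val, ← zpow_natCast, zpow_comm, zpow_natCast, hξ,
      one_zpow, Units.val_one]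
  have hcomm : ∀ (y : UA) (n : ℤ), KA * y = (T n : A) • (y * KA) →
      Commute (toUtilde ξ KA ^ ℓ) (toUtilde ξ y) := by
    intro y n hy
    have h1 : toUtilde ξ KA * toUtilde ξ y =
        specHom ξ (T n) • (toUtilde ξ y * toUtilde ξ KA) := by
      rw [← map_mul, hy, toUtilde_smul, map_mul]
    have h2 : ∀ m : ℕ, toUtilde ξ KA ^ m * toUtilde ξ y =
        specHom ξ (T n) ^ m • (toUtilde ξ y * toUtilde ξ KA ^ m) := by
      intro m
      induction m with
      | zero => simp
      | succ m ih =>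
        rw [pow_succ', mul_assoc, ih, mul_smul_comm, ← mul_assoc, h1, smul_mul_assoc, smul_smul,
          mul_assoc, ← pow_succ]
    change _ = _
    rw [h2, hT, one_smul]
  have hUA : ∀ y ∈ UA, ∀ hy : y ∈ UA, Commute (toUtilde ξ KA ^ ℓ) (toUtilde ξ ⟨y, hy⟩) := by
    intro y hy
    induction hy using Algebra.adjoin_induction with
    | mem x hx =>
      intro hx'
      rcases hx with (⟨n, rfl⟩ | ⟨n, rfl⟩) | rfl | rfl
      · exact hcomm _ _ (KA_mul_EA n)
      · exact hcomm _ _ (KA_mul_FA n)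
      · exact hcomm KA 0 (by rw [T_zero, one_smul])
      · exact hcomm KinvA 0 (by rw [T_zero, one_smul, KA_KinvA, KinvA_KA])
    | algebraMap r =>
      intro h
      have : toUtilde ξ ⟨algebraMap A U r, h⟩ = algebraMap ℂ (Utilde ξ) (specHom ξ r) := by
        have h1 : (⟨algebraMap A U r, h⟩ : UA) = r • (1 : UA) :=
          Subtype.ext (Algebra.algebraMap_eq_smul_one r)
        rw [h1, toUtilde_smul, map_one, Algebra.algebraMap_eq_smul_one]
      rw [this]
      exact (Algebra.commutes _ _).symm
    | add x y hx hy ihx ihy =>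
      intro h
      have : (⟨x + y, h⟩ : UA) = ⟨x, hx⟩ + ⟨y, hy⟩ := rfl
      rw [this, map_add]
      exact (ihx hx).add_right (ihy hy)
    | mul x y hx hy ihx ihy =>
      intro h
      have : (⟨x * y, h⟩ : UA) = ⟨x, hx⟩ * ⟨y, hy⟩ := rfl
      rw [this, map_mul]
      exact (ihx hx).mul_right (ihy hy)
  induction x using Utilde_induction with
  | h c y => exact (hUA y.1 y.2 y.2).smul_right c
  | hadd x y hx hy => exact hx.add_right hy

/-- The quotient map `Utilde → U_ℓ`. -/
def quotUℓ (ℓ : ℕ) (ξ : ℂˣ) : Utilde ξ →ₐ[ℂ] Uℓ ℓ ξ := RingQuot.mkAlgHom ℂ (KRel ℓ ξ)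

lemma quotUℓ_surjective : Function.Surjective (quotUℓ ℓ ξ) :=
  RingQuot.mkAlgHom_surjective ℂ (KRel ℓ ξ)

lemma toUℓ_apply (y : UA) : toUℓ ℓ ξ y = quotUℓ ℓ ξ (toUtilde ξ y) := rfl

/-- As `K^ℓ - 1` is central, the left ideal it generates is two-sided, so the kernel consists of
plain multiples. -/
lemma exists_of_quotUℓ_eq_zero (hξ : ξ ^ ℓ = 1) {x : Utilde ξ} (hx : quotUℓ ℓ ξ x = 0) :
    ∃ z, x = (toUtilde ξ KA ^ ℓ - 1) * z := by
  have hc : ∀ x : Utilde ξ, (toUtilde ξ KA ^ ℓ - 1) * x = x * (toUtilde ξ KA ^ ℓ - 1) :=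
    fun x => ((toUtilde_KA_pow_commute hξ x).sub_left (Commute.one_left x)).eq
  let I : Ideal (Utilde ξ) := Ideal.span {toUtilde ξ KA ^ ℓ - 1}
  have hI : ∀ {x}, x ∈ I ↔ ∃ z, z * (toUtilde ξ KA ^ ℓ - 1) = x := Ideal.mem_span_singleton'
  have : I.IsTwoSided := ⟨fun {a} b ha => by
    obtain ⟨z, rfl⟩ := hI.mp ha
    exact hI.mpr ⟨z * b, by rw [mul_assoc, ← hc, mul_assoc]⟩⟩
  have hrel : ∀ ⦃x y : Utilde ξ⦄, KRel ℓ ξ x y →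
      Ideal.Quotient.mkₐ ℂ I x = Ideal.Quotient.mkₐ ℂ I y := by
    intro x y hxy
    cases hxy
    exact Ideal.Quotient.eq.mpr (hI.mpr ⟨1, one_mul _⟩)
  have h1 := RingQuot.liftAlgHom_mkAlgHom_apply ℂ (Ideal.Quotient.mkₐ ℂ I) hrel x
  have h2 : RingQuot.mkAlgHom ℂ (KRel ℓ ξ) x = 0 := hx
  rw [h2, map_zero] at h1
  obtain ⟨z, hz⟩ := hI.mp (Ideal.Quotient.eq_zero_iff_mem.mp h1.symm)
  exact ⟨z, by rw [hc, hz]⟩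

/-- A semilinear map on the integral form that is invariant under `K^ℓ` descends to `U_ℓ`. -/
lemma exists_Uℓ_lift (hξ : ξ ^ ℓ = 1) {W : Type*} [AddCommGroup W] [Module ℂ W] (θ : UA →+ W)
    (hθ : ∀ (a : A) (y : UA), θ (a • y) = specHom ξ a • θ y)
    (hK : ∀ y, θ (KA ^ ℓ * y) = θ y) :
    ∃ Θ : Uℓ ℓ ξ →ₗ[ℂ] W, ∀ y, Θ (toUℓ ℓ ξ y) = θ y := by
  obtain ⟨Θ, hΘ⟩ := exists_Utilde_lift θ hθ
  -- The kernel consists of the elements `(K^ℓ - 1) z`, and `hK` says that these are killed.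
  have hker : LinearMap.ker (quotUℓ ℓ ξ).toLinearMap ≤ LinearMap.ker Θ := by
    intro x hx
    obtain ⟨z, rfl⟩ := exists_of_quotUℓ_eq_zero hξ (LinearMap.mem_ker.mp hx)
    rw [LinearMap.mem_ker]
    clear hx
    induction z using Utilde_induction with
    | h c y =>
      rw [mul_smul_comm, map_smul, sub_mul, one_mul, map_sub, ← map_pow, ← map_mul, hΘ, hΘ, hK,
        sub_self, smul_zero]
    | hadd x y hx hy =>
      rw [mul_add, map_add, hx, hy, add_zero]
  let e := (quotUℓ ℓ ξ).toLinearMap.quotKerEquivOfSurjective quotUℓ_surjective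
  refine ⟨(LinearMap.ker (quotUℓ ℓ ξ).toLinearMap).liftQ Θ hker ∘ₗ e.symm.toLinearMap, fun y => ?_⟩
  have : e.symm (toUℓ ℓ ξ y) = Submodule.Quotient.mk (toUtilde ξ y) := by
    rw [LinearEquiv.symm_apply_eq]
    rfl
  rw [LinearMap.comp_apply, LinearEquiv.coe_coe, this]
  exact hΘ y

lemma toUℓ_smul (a : A) (y : UA) : toUℓ ℓ ξ (a • y) = specHom ξ a • toUℓ ℓ ξ y := by
  rw [toUℓ_apply, toUtilde_smul, map_smul, ← toUℓ_apply]

/-- Induction on elements of `U_ℓ`. -/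
lemma Uℓ_induction {p : Uℓ ℓ ξ → Prop} (h : ∀ (c : ℂ) (y : UA), p (c • toUℓ ℓ ξ y))
    (hadd : ∀ x y, p x → p y → p (x + y)) (x : Uℓ ℓ ξ) : p x := by
  obtain ⟨x, rfl⟩ := quotUℓ_surjective x
  induction x using Utilde_induction with
  | h c y => rw [map_smul]; exact h c y
  | hadd x y hx hy => rw [map_add]; exact hadd _ _ hx hy

lemma K_pow : K ℓ ξ ^ ℓ = 1 := by
  have h := RingQuot.mkAlgHom_rel ℂ (KRel.K_pow (ℓ := ℓ) (ξ := ξ))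
  rw [map_pow, map_one] at h
  exact h

end descent

/-! ### Quantum binomial coefficients at a root of unity -/

/-- The quantum binomial coefficient `[m; t]` at `v = ξ`. -/
def qBinAt (ξ : ℂˣ) (m : ℤ) (t : ℕ) : ℂ := specHom ξ (qBinA m t)

section
variable {ℓ : ℕ} {ξ : ℂˣ}

lemma qBinAt_zero_right (m : ℤ) : qBinAt ξ m 0 = 1 := by rw [qBinAt, qBinA_zero_right, map_one]

lemma qBinAt_shift (c : ℤ) (t : ℕ) : qBinAt ξ (c + 1) (t + 1) =
    ((ξ ^ ((t : ℤ) + 1) : ℂˣ) : ℂ) * qBinAt ξ c (t + 1) +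
      ((ξ ^ ((t : ℤ) - c) : ℂˣ) : ℂ) * qBinAt ξ c t := by
  simp only [qBinAt, qBinA_shift, map_add, map_mul, specHom_T]

lemma qBinAt_neg (m : ℤ) (t : ℕ) : qBinAt ξ (-m) t = (-1) ^ t * qBinAt ξ (m + t - 1) t := by
  simp only [qBinAt, qBinA_neg, map_mul, map_pow, map_neg, map_one]

lemma qBinAt_eq_zero {m t : ℕ} (h : m < t) : qBinAt ξ m t = 0 := by
  rw [qBinAt, qBinA_eq_zero h, map_zero]

lemma qBinAt_self (m : ℕ) : qBinAt ξ m m = 1 := by rw [qBinAt, qBinA_self, map_one]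

lemma qBinAt_symm (m n : ℕ) : qBinAt ξ ((m : ℤ) + n) m = qBinAt ξ ((m : ℤ) + n) n := by
  rw [qBinAt, qBinA_symm, qBinAt]

/-- Some `[p + k; k]` with `k ≥ 1` does not vanish at `v = ξ`. -/
lemma exists_qBinAt_ne_zero (p : ℕ) : ∃ k : ℕ, 1 ≤ k ∧ qBinAt ξ ((p : ℤ) + k) k ≠ 0 := by
  by_contra! hcon
  -- If all `[p+k; k]` with `k ≥ 1` vanished, symmetry would give `[m; p] = 0` for all `m > p`. The
  -- Pascal rule then carries the vanishing from lower index `t+1` to `t`, down to `[m; 0] = 1`.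
  have h : ∀ j t : ℕ, t + j = p → ∀ m : ℕ, p + 1 ≤ m → qBinAt ξ m t = 0 := by
    intro j
    induction j with
    | zero =>
      rintro t rfl m hm
      obtain ⟨k, rfl⟩ : ∃ k, m = t + k := ⟨m - t, by omega⟩
      push_cast
      rw [qBinAt_symm]
      exact hcon k (by omega)
    | succ j ih =>
      intro t ht m hm
      have h1 := qBinAt_shift (ξ := ξ) m t
      have h2 := ih (t + 1) (by omega) m hm
      have h3 := ih (t + 1) (by omega) (m + 1) (by omega)
      push_cast at h3
      rw [h2, h3, mul_zero, zero_add] at h1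
      exact (mul_eq_zero.mp h1.symm).resolve_left (Units.ne_zero _)
  have := h p 0 (by omega) (p + 1) le_rfl
  rw [qBinAt_zero_right] at this
  exact one_ne_zero this

/-! ### Relations in `U_ℓ` -/

lemma E_zero : E ℓ ξ 0 = 1 := (congrArg (toUℓ ℓ ξ) EA_zero).trans (map_one _)

lemma F_zero : F ℓ ξ 0 = 1 := (congrArg (toUℓ ℓ ξ) FA_zero).trans (map_one _)

lemma bin_zero (c : ℤ) : bin ℓ ξ c 0 = 1 := (congrArg (toUℓ ℓ ξ) (binA_zero c)).trans (map_one _)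

lemma Kinv_mul_K : Kinv ℓ ξ * K ℓ ξ = 1 := by
  have := congrArg (toUℓ ℓ ξ) KinvA_KA
  rwa [map_mul, map_one] at this

lemma K_mul_Kinv : K ℓ ξ * Kinv ℓ ξ = 1 := by
  have := congrArg (toUℓ ℓ ξ) KA_KinvA
  rwa [map_mul, map_one] at this

lemma E_mul_E (m n : ℕ) : E ℓ ξ m * E ℓ ξ n = qBinAt ξ ((m : ℤ) + n) m • E ℓ ξ (m + n) := by
  have := congrArg (toUℓ ℓ ξ) (EA_mul_EA m n)
  rwa [map_mul, toUℓ_smul] at this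

lemma F_mul_F (m n : ℕ) : F ℓ ξ m * F ℓ ξ n = qBinAt ξ ((m : ℤ) + n) m • F ℓ ξ (m + n) := by
  have := congrArg (toUℓ ℓ ξ) (FA_mul_FA m n)
  rwa [map_mul, toUℓ_smul] at this

lemma K_mul_F (n : ℕ) :
    K ℓ ξ * F ℓ ξ n = ((ξ ^ (-2 * (n : ℤ)) : ℂˣ) : ℂ) • (F ℓ ξ n * K ℓ ξ) := by
  have := congrArg (toUℓ ℓ ξ) (KA_mul_FA n)
  rwa [map_mul, toUℓ_smul, map_mul, specHom_T] at this

lemma E_mul_K (n : ℕ) :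
    E ℓ ξ n * K ℓ ξ = ((ξ ^ (-(2 * (n : ℤ))) : ℂˣ) : ℂ) • (K ℓ ξ * E ℓ ξ n) := by
  have := congrArg (toUℓ ℓ ξ) (EA_mul_KA n)
  rwa [map_mul, toUℓ_smul, map_mul, specHom_T] at this

lemma bin_mul_F (n : ℕ) (c : ℤ) (t : ℕ) :
    bin ℓ ξ c t * F ℓ ξ n = F ℓ ξ n * bin ℓ ξ (c - 2 * n) t := by
  have := congrArg (toUℓ ℓ ξ) (binA_mul_FA n c t)
  rwa [map_mul, map_mul] at this

lemma E_mul_F (r s : ℕ) : E ℓ ξ r * F ℓ ξ s = ∑ j ∈ Finset.range (min r s + 1),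
    F ℓ ξ (s - j) * bin ℓ ξ (2 * j - r - s) j * E ℓ ξ (r - j) := by
  have := congrArg (toUℓ ℓ ξ) (EA_mul_FA r s)
  rw [map_mul, map_sum] at this
  simp only [map_mul] at this
  exact this

lemma bin_shift (c : ℤ) (t : ℕ) : bin ℓ ξ (c + 1) (t + 1) =
    ((ξ ^ ((t : ℤ) + 1) : ℂˣ) : ℂ) • bin ℓ ξ c (t + 1) +
      ((ξ ^ ((t : ℤ) - c) : ℂˣ) : ℂ) • (Kinv ℓ ξ * bin ℓ ξ c t) := by
  have := congrArg (toUℓ ℓ ξ) (binA_shift c t)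
  rwa [map_add, toUℓ_smul, toUℓ_smul, specHom_T, specHom_T, map_mul] at this

/-! ### Coordinates on `U_ℓ` -/

/-- Invariance under `K^ℓ` holds because `K` scales the coordinate by a power of `ξ`, and `ξ^ℓ = 1`.
-/
lemma exists_omegaℓ (hξ : ξ ^ ℓ = 1) (lam : ℤ) (n : ℕ) :
    ∃ Θ : Uℓ ℓ ξ →ₗ[ℂ] ℂ, ∀ y, Θ (toUℓ ℓ ξ y) = specHom ξ (omegaA lam n y) := by
  refine exists_Uℓ_lift hξ (AddMonoidHom.mk' (fun y => specHom ξ (omegaA lam n y))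
    fun x y => by rw [omegaA_add, map_add]) (fun a y => ?_) (fun y => ?_)
  · simp only [AddMonoidHom.mk'_apply, omegaA_smul, map_mul, smul_eq_mul]
  · have h : ∀ m : ℕ, omegaA lam n (KA ^ m * y) = T (lam - 2 * n) ^ m * omegaA lam n y := by
      intro m
      induction m with
      | zero => simp
      | succ m ih => rw [pow_succ', mul_assoc, omegaA_KA_mul, ih, pow_succ', mul_assoc]
    simp only [AddMonoidHom.mk'_apply, h, map_mul, map_pow, specHom_T]
    rw [← Units.val_pow_eq_pow_val, ← zpow_natCast, zpow_comm, zpow_natCast, hξ, one_zpow,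
      Units.val_one, one_mul]

/-- The coefficient of the `n`-th basis vector of the Verma module of highest weight `lam` in `u`
times the highest weight vector. -/
def omegaℓ (hξ : ξ ^ ℓ = 1) (lam : ℤ) (n : ℕ) : Uℓ ℓ ξ →ₗ[ℂ] ℂ := (exists_omegaℓ hξ lam n).choose

lemma omegaℓ_toUℓ (hξ : ξ ^ ℓ = 1) (lam : ℤ) (n : ℕ) (y : UA) :
    omegaℓ hξ lam n (toUℓ ℓ ξ y) = specHom ξ (omegaA lam n y) :=
  (exists_omegaℓ hξ lam n).choose_spec y

lemma omegaℓ_mul_of (hξ : ξ ^ ℓ = 1) (lam : ℤ) (n : ℕ) (x : UA) (s : A)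
    (h : ∀ y, omegaA lam n (y * x) = s * omegaA lam n y) (u : Uℓ ℓ ξ) :
    omegaℓ hξ lam n (u * toUℓ ℓ ξ x) = specHom ξ s * omegaℓ hξ lam n u := by
  induction u using Uℓ_induction with
  | h c y =>
    rw [smul_mul_assoc, map_smul, map_smul, ← map_mul, omegaℓ_toUℓ, omegaℓ_toUℓ, h, map_mul,
      smul_eq_mul, smul_eq_mul, mul_left_comm]
  | hadd x y hx hy => rw [add_mul, map_add, hx, hy, map_add, mul_add]

lemma omegaℓ_mul_E (hξ : ξ ^ ℓ = 1) (lam : ℤ) (n : ℕ) (u : Uℓ ℓ ξ) (k : ℕ) (hk : 1 ≤ k) :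
    omegaℓ hξ lam n (u * E ℓ ξ k) = 0 :=
  (omegaℓ_mul_of hξ lam n (EA k) 0
    (fun y => by rw [omegaA_mul_EA lam n y k hk, zero_mul]) u).trans (by rw [map_zero, zero_mul])

lemma omegaℓ_mul_K (hξ : ξ ^ ℓ = 1) (lam : ℤ) (n : ℕ) (u : Uℓ ℓ ξ) :
    omegaℓ hξ lam n (u * K ℓ ξ) = ((ξ ^ lam : ℂˣ) : ℂ) * omegaℓ hξ lam n u :=
  (omegaℓ_mul_of hξ lam n KA _ (omegaA_mul_KA lam n) u).trans (by rw [specHom_T])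

lemma omegaℓ_mul_bin (hξ : ξ ^ ℓ = 1) (lam : ℤ) (n : ℕ) (u : Uℓ ℓ ξ) (c : ℤ) (t : ℕ) :
    omegaℓ hξ lam n (u * bin ℓ ξ c t) = qBinAt ξ (lam + c) t * omegaℓ hξ lam n u :=
  omegaℓ_mul_of hξ lam n (binA c t) _ (fun y => omegaA_mul_binA lam n y c t) u

lemma omegaℓ_F (hξ : ξ ^ ℓ = 1) (lam : ℤ) (n a : ℕ) :
    omegaℓ hξ lam n (F ℓ ξ a) = if a = n then 1 else 0 := by
  refine (omegaℓ_toUℓ hξ lam n (FA a)).trans ?_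
  rw [omegaA_FA]
  split_ifs <;> simp

lemma exists_projℓ (hξ : ξ ^ ℓ = 1) (n : ℕ) :
    ∃ Θ : Uℓ ℓ ξ →ₗ[ℂ] Uℓ ℓ ξ, ∀ y, Θ (toUℓ ℓ ξ y) = toUℓ ℓ ξ (projA n y) := by
  refine exists_Uℓ_lift hξ ((toUℓ ℓ ξ).toAddMonoidHom.comp (projA n).toAddMonoidHom)
    (fun a y => ?_) (fun y => ?_)
  · change toUℓ ℓ ξ (projA n (a • y)) = _ • toUℓ ℓ ξ (projA n y)
    rw [map_smul, toUℓ_smul]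
  · change toUℓ ℓ ξ (projA n (KA ^ ℓ * y)) = toUℓ ℓ ξ (projA n y)
    have h : ((KA ^ ℓ : UA) : U) ∈ nonposU := by
      rw [Subalgebra.coe_pow]
      exact nonposU.pow_mem K_mem_nonposU _
    rw [projA_mul_of_mem n h, map_mul, map_pow]
    have h2 : toUℓ ℓ ξ KA ^ ℓ = 1 := K_pow
    rw [h2, one_mul]

/-- The coefficient of `E⁽ⁿ⁾` of an element of `U_ℓ`, with respect to the basis `E⁽ⁿ⁾` of `U_ℓ`
over `B_ℓ⁻`. -/
def projℓ (hξ : ξ ^ ℓ = 1) (n : ℕ) : Uℓ ℓ ξ →ₗ[ℂ] Uℓ ℓ ξ := (exists_projℓ hξ n).choose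

lemma projℓ_toUℓ (hξ : ξ ^ ℓ = 1) (n : ℕ) (y : UA) :
    projℓ hξ n (toUℓ ℓ ξ y) = toUℓ ℓ ξ (projA n y) := (exists_projℓ hξ n).choose_spec y

lemma F_mem_Bneg (n : ℕ) : F ℓ ξ n ∈ Bneg ℓ ξ := Algebra.subset_adjoin (Or.inl ⟨n, rfl⟩)

lemma K_mem_Bneg : K ℓ ξ ∈ Bneg ℓ ξ := Algebra.subset_adjoin (Or.inr (Or.inl (Or.inl rfl)))

lemma Kinv_mem_Bneg : Kinv ℓ ξ ∈ Bneg ℓ ξ := Algebra.subset_adjoin (Or.inr (Or.inl (Or.inr rfl)))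

lemma bin_mem_Bneg (c : ℤ) (t : ℕ) : bin ℓ ξ c t ∈ Bneg ℓ ξ :=
  Algebra.subset_adjoin (Or.inr (Or.inr ⟨c, t, rfl⟩))

/-- Inherited from `projA` for each generator of `B_ℓ⁻`, these being images of integral elements of
the nonpositive part. -/
lemma projℓ_mul_of_mem (hξ : ξ ^ ℓ = 1) (n : ℕ) {b : Uℓ ℓ ξ} (hb : b ∈ Bneg ℓ ξ) (u : Uℓ ℓ ξ) :
    projℓ hξ n (b * u) = b * projℓ hξ n u := by
  have hof : ∀ b : UA, (b : U) ∈ nonposU → ∀ u : Uℓ ℓ ξ,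
      projℓ hξ n (toUℓ ℓ ξ b * u) = toUℓ ℓ ξ b * projℓ hξ n u := by
    intro b hb u
    induction u using Uℓ_induction with
    | h c y =>
      rw [mul_smul_comm, map_smul, map_smul, mul_smul_comm, ← map_mul, projℓ_toUℓ, projℓ_toUℓ,
        projA_mul_of_mem n hb, map_mul]
    | hadd x y hx hy => rw [mul_add, map_add, hx, hy, map_add, mul_add]
  induction hb using Algebra.adjoin_induction generalizing u with
  | mem x hx =>
    rcases hx with ⟨k, rfl⟩ | (rfl | rfl) | ⟨c, t, rfl⟩
    · exact hof (FA k) (divPow_F_mem_nonposU k) u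
    · exact hof KA K_mem_nonposU u
    · exact hof KinvA Kinv_mem_nonposU u
    · exact hof (binA c t) (binK_mem_nonposU c t) u
  | algebraMap r => simp only [← Algebra.smul_def, map_smul]
  | add x y _ _ hx hy => rw [add_mul, map_add, hx, hy, add_mul]
  | mul x y _ _ hx hy => rw [mul_assoc, hx, hy, mul_assoc]

lemma projℓ_E (hξ : ξ ^ ℓ = 1) (n m : ℕ) :
    projℓ hξ n (E ℓ ξ m) = if m = n then 1 else 0 := by
  have h := projA_monomial n 0 m cartanA.one_mem
  rw [FA_zero, one_mul, one_mul] at h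
  refine (projℓ_toUℓ hξ n (EA m)).trans ?_
  rw [h]
  split_ifs <;> simp

/-- The Cartan part `U_ℓ⁰`. -/
def cartanℓ (ℓ : ℕ) (ξ : ℂˣ) : Subalgebra ℂ (Uℓ ℓ ξ) := Algebra.adjoin ℂ (cartanGens ℓ ξ)

lemma toUℓ_mem_cartanℓ {h : UA} (hh : h ∈ cartanA) : toUℓ ℓ ξ h ∈ cartanℓ ℓ ξ := by
  induction hh using Algebra.adjoin_induction with
  | mem x hx =>
    rcases hx with (rfl | rfl) | ⟨c, t, rfl⟩
    · exact Algebra.subset_adjoin (Or.inl (Or.inl rfl))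
    · exact Algebra.subset_adjoin (Or.inl (Or.inr rfl))
    · exact Algebra.subset_adjoin (Or.inr ⟨c, t, rfl⟩)
  | algebraMap r =>
    rw [Algebra.algebraMap_eq_smul_one, toUℓ_smul, map_one]
    exact (cartanℓ ℓ ξ).smul_mem (cartanℓ ℓ ξ).one_mem _
  | add x y _ _ hx hy => rw [map_add]; exact (cartanℓ ℓ ξ).add_mem hx hy
  | mul x y _ _ hx hy => rw [map_mul]; exact (cartanℓ ℓ ξ).mul_mem hx hy

lemma cartanℓ_le_Bneg : cartanℓ ℓ ξ ≤ Bneg ℓ ξ := Algebra.adjoin_mono Set.subset_union_right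

/-- Induction on elements of `U_ℓ`, as combinations of ordered monomials. -/
lemma Uℓ_monomial_induction {p : Uℓ ℓ ξ → Prop}
    (hmon : ∀ (a c : ℕ) (h : Uℓ ℓ ξ), h ∈ cartanℓ ℓ ξ → p (F ℓ ξ a * h * E ℓ ξ c))
    (hadd : ∀ x y, p x → p y → p (x + y)) (hsmul : ∀ (r : ℂ) x, p x → p (r • x)) (u : Uℓ ℓ ξ) :
    p u := by
  induction u using Uℓ_induction with
  | h c y =>
    refine hsmul c _ (induction_UA (p := fun y => p (toUℓ ℓ ξ y)) ?_ ?_ ?_ y)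
    · intro a c h hh
      rw [map_mul, map_mul]
      exact hmon a c _ (toUℓ_mem_cartanℓ hh)
    · intro x y hx hy
      rw [map_add]
      exact hadd _ _ hx hy
    · intro r x hx
      rw [toUℓ_smul]
      exact hsmul _ _ hx
  | hadd x y hx hy => exact hadd x y hx hy

lemma projℓ_monomial (hξ : ξ ^ ℓ = 1) (n a c : ℕ) {h : Uℓ ℓ ξ} (hh : h ∈ cartanℓ ℓ ξ) :
    projℓ hξ n (F ℓ ξ a * h * E ℓ ξ c) = if c = n then F ℓ ξ a * h else 0 := by
  rw [projℓ_mul_of_mem hξ n ((Bneg ℓ ξ).mul_mem (F_mem_Bneg a) (cartanℓ_le_Bneg hh)), projℓ_E]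
  split_ifs
  · rw [mul_one]
  · rw [mul_zero]

lemma projℓ_mem_Bneg (hξ : ξ ^ ℓ = 1) (n : ℕ) (u : Uℓ ℓ ξ) : projℓ hξ n u ∈ Bneg ℓ ξ := by
  induction u using Uℓ_monomial_induction with
  | hmon a c h hh =>
    rw [projℓ_monomial hξ n a c hh]
    split_ifs
    · exact (Bneg ℓ ξ).mul_mem (F_mem_Bneg a) (cartanℓ_le_Bneg hh)
    · exact zero_mem _
  | hadd x y hx hy => rw [map_add]; exact add_mem hx hy
  | hsmul r x hx => rw [map_smul]; exact (Bneg ℓ ξ).smul_mem hx r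

/-- Thus `projℓ hξ 0` retracts `U_ℓ` onto `B_ℓ⁻`, and facts about ordered monomials of `U_ℓ`
transfer to `B_ℓ⁻`. -/
lemma projℓ_zero_of_mem (hξ : ξ ^ ℓ = 1) {b : Uℓ ℓ ξ} (hb : b ∈ Bneg ℓ ξ) : projℓ hξ 0 b = b := by
  have := projℓ_mul_of_mem hξ 0 hb 1
  have h1 := projℓ_E (ℓ := ℓ) hξ 0 0
  rw [E_zero, if_pos rfl] at h1
  rwa [mul_one, h1, mul_one] at this

/-- Induction on elements of `B_ℓ⁻`, as combinations of ordered monomials. -/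
lemma Bneg_induction (hξ : ξ ^ ℓ = 1) {p : Uℓ ℓ ξ → Prop}
    (hmon : ∀ (a : ℕ) (h : Uℓ ℓ ξ), h ∈ cartanℓ ℓ ξ → p (F ℓ ξ a * h))
    (hadd : ∀ x y, p x → p y → p (x + y)) (hsmul : ∀ (r : ℂ) x, p x → p (r • x)) {b : Uℓ ℓ ξ}
    (hb : b ∈ Bneg ℓ ξ) : p b := by
  rw [← projℓ_zero_of_mem hξ hb]
  clear hb
  induction b using Uℓ_monomial_induction with
  | hmon a c h hh =>
    rw [projℓ_monomial hξ 0 a c hh]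
    split_ifs
    · exact hmon a h hh
    · simpa using hsmul 0 _ (hmon 0 1 (cartanℓ ℓ ξ).one_mem)
  | hadd x y hx hy => rw [map_add]; exact hadd _ _ hx hy
  | hsmul r x hx => rw [map_smul]; exact hsmul r _ hx

/-! ### The grading -/

lemma IsMonomial.mul {x y : Uℓ ℓ ξ} {d e : ℤ} (hx : IsMonomial ℓ ξ x d)
    (hy : IsMonomial ℓ ξ y e) : IsMonomial ℓ ξ (x * y) (d + e) := by
  induction hx with
  | one => rwa [one_mul, zero_add]
  | E_mul n x d _ ih => rw [mul_assoc, add_assoc]; exact .E_mul n _ _ ih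
  | F_mul n x d _ ih => rw [mul_assoc, add_assoc]; exact .F_mul n _ _ ih
  | K_mul x d _ ih => rw [mul_assoc]; exact .K_mul _ _ ih
  | Kinv_mul x d _ ih => rw [mul_assoc]; exact .Kinv_mul _ _ ih

lemma mul_mem_degPart {x y : Uℓ ℓ ξ} {d e : ℤ} (hx : x ∈ degPart ℓ ξ d) (hy : y ∈ degPart ℓ ξ e) :
    x * y ∈ degPart ℓ ξ (d + e) := by
  have h := Submodule.mul_mem_mul hx hy
  rw [degPart, degPart, Submodule.span_mul_span] at h
  refine Submodule.span_mono ?_ h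
  rintro _ ⟨x, hx, y, hy, rfl⟩
  exact IsMonomial.mul hx hy

lemma one_mem_degPart : (1 : Uℓ ℓ ξ) ∈ degPart ℓ ξ 0 := Submodule.subset_span .one

lemma E_mem_degPart (n : ℕ) : E ℓ ξ n ∈ degPart ℓ ξ n := by
  have := IsMonomial.E_mul (ℓ := ℓ) (ξ := ξ) n _ _ .one
  rw [mul_one, add_zero] at this
  exact Submodule.subset_span this

lemma F_mem_degPart (n : ℕ) : F ℓ ξ n ∈ degPart ℓ ξ (-n) := by
  have := IsMonomial.F_mul (ℓ := ℓ) (ξ := ξ) n _ _ .one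
  rw [mul_one, add_zero] at this
  exact Submodule.subset_span this

lemma K_mem_degPart : K ℓ ξ ∈ degPart ℓ ξ 0 := by
  have := IsMonomial.K_mul (ℓ := ℓ) (ξ := ξ) _ _ .one
  rw [mul_one] at this
  exact Submodule.subset_span this

lemma Kinv_mem_degPart : Kinv ℓ ξ ∈ degPart ℓ ξ 0 := by
  have := IsMonomial.Kinv_mul (ℓ := ℓ) (ξ := ξ) _ _ .one
  rw [mul_one] at this
  exact Submodule.subset_span this

/-- The `[K; c; t]` are not among the generators that define the grading. For `c = 0` the element is
isolated from `E⁽ᵗ⁾F⁽ᵗ⁾` by subtracting terms with smaller `t`; other `c` are reached by `bin_shift`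
in either direction. -/
lemma bin_mem_degPart (c : ℤ) (t : ℕ) : bin ℓ ξ c t ∈ degPart ℓ ξ 0 := by
  have hz : ∀ {x y : Uℓ ℓ ξ}, x ∈ degPart ℓ ξ 0 → y ∈ degPart ℓ ξ 0 → x * y ∈ degPart ℓ ξ 0 := by
    intro x y hx hy
    have := mul_mem_degPart hx hy
    rwa [add_zero] at this
  induction t using Nat.strong_induction_on generalizing c with
  | _ t ih =>
    cases t with
    | zero => rw [bin_zero]; exact one_mem_degPart
    | succ t =>
      induction c using Int.induction_on with
      | zero =>
        have h := E_mul_F (ℓ := ℓ) (ξ := ξ) (t + 1) (t + 1)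
        rw [min_self, Finset.sum_range_succ, Nat.sub_self, F_zero, E_zero, one_mul, mul_one,
          show (2 * ((t + 1 : ℕ) : ℤ) - (t + 1 : ℕ) - (t + 1 : ℕ)) = 0 by ring,
          ← sub_eq_iff_eq_add'] at h
        rw [← h]
        refine sub_mem ?_ (Submodule.sum_mem _ fun j hj => ?_)
        · have := mul_mem_degPart (E_mem_degPart (ℓ := ℓ) (ξ := ξ) (t + 1)) (F_mem_degPart (t + 1))
          rwa [add_neg_cancel] at this
        · have := mul_mem_degPart (mul_mem_degPart (F_mem_degPart (ℓ := ℓ) (ξ := ξ) (t + 1 - j))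
            (ih j (Finset.mem_range.mp hj) (2 * j - (t + 1 : ℕ) - (t + 1 : ℕ))))
            (E_mem_degPart (t + 1 - j))
          rwa [add_zero, neg_add_cancel] at this
      | succ c hc =>
        rw [bin_shift]
        exact add_mem (Submodule.smul_mem _ _ hc)
          (Submodule.smul_mem _ _ (hz Kinv_mem_degPart (ih t (Nat.lt_succ_self t) _)))
      | pred c hc =>
        have h := bin_shift (ℓ := ℓ) (ξ := ξ) (-(c : ℤ) - 1) t
        rw [sub_add_cancel, ← sub_eq_iff_eq_add] at h
        rw [← Submodule.smul_mem_iff _ (Units.ne_zero (ξ ^ ((t : ℤ) + 1))), ← h]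
        exact sub_mem hc
          (Submodule.smul_mem _ _ (hz Kinv_mem_degPart (ih t (Nat.lt_succ_self t) _)))

lemma cartanℓ_le_degPart {h : Uℓ ℓ ξ} (hh : h ∈ cartanℓ ℓ ξ) : h ∈ degPart ℓ ξ 0 := by
  induction hh using Algebra.adjoin_induction with
  | mem x hx =>
    rcases hx with (rfl | rfl) | ⟨c, t, rfl⟩
    · exact K_mem_degPart
    · exact Kinv_mem_degPart
    · exact bin_mem_degPart c t
  | algebraMap r =>
    rw [Algebra.algebraMap_eq_smul_one]; exact Submodule.smul_mem _ _ one_mem_degPart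
  | add x y _ _ hx hy => exact add_mem hx hy
  | mul x y _ _ hx hy =>
    have := mul_mem_degPart hx hy
    rwa [add_zero] at this

lemma F_mul_mem_degPart (a : ℕ) {h : Uℓ ℓ ξ} (hh : h ∈ cartanℓ ℓ ξ) :
    F ℓ ξ a * h ∈ degPart ℓ ξ (-a) := by
  have := mul_mem_degPart (F_mem_degPart a) (cartanℓ_le_degPart hh)
  rwa [add_zero] at this

lemma mem_iSup_degPart (u : Uℓ ℓ ξ) : u ∈ ⨆ d, degPart ℓ ξ d := by
  induction u using Uℓ_monomial_induction with
  | hmon a c h hh =>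
    exact Submodule.mem_iSup_of_mem _ (mul_mem_degPart (F_mul_mem_degPart a hh) (E_mem_degPart c))
  | hadd x y hx hy => exact add_mem hx hy
  | hsmul r x hx => exact Submodule.smul_mem _ _ hx

/-- Straightening in the integral form respects degree, so a homogeneous element is a combination of
ordered monomials of its own degree. -/
lemma IsMonomial.exists_normalForm {x : Uℓ ℓ ξ} {d : ℤ} (hx : IsMonomial ℓ ξ x d) :
    ∃ y ∈ normalForm d, toUℓ ℓ ξ y = x := by
  induction hx with
  | one => exact ⟨1, one_mem_normalForm, map_one _⟩
  | E_mul n x d _ ih =>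
    obtain ⟨y, hy, rfl⟩ := ih
    exact ⟨_, EA_mul_mem_normalForm n hy, map_mul _ _ _⟩
  | F_mul n x d _ ih =>
    obtain ⟨y, hy, rfl⟩ := ih
    exact ⟨_, FA_mul_mem_normalForm n hy, map_mul _ _ _⟩
  | K_mul x d _ ih =>
    obtain ⟨y, hy, rfl⟩ := ih
    exact ⟨_, cartanA_mul_mem_normalForm KA_mem hy, map_mul _ _ _⟩
  | Kinv_mul x d _ ih =>
    obtain ⟨y, hy, rfl⟩ := ih
    exact ⟨_, cartanA_mul_mem_normalForm KinvA_mem hy, map_mul _ _ _⟩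

/-- Induction on homogeneous elements of `U_ℓ`, as combinations of ordered monomials. -/
lemma degPart_induction {d : ℤ} {p : Uℓ ℓ ξ → Prop} (hzero : p 0)
    (hmon : ∀ (a c : ℕ) (h : Uℓ ℓ ξ), (c : ℤ) - a = d → h ∈ cartanℓ ℓ ξ →
      p (F ℓ ξ a * h * E ℓ ξ c))
    (hadd : ∀ x y, p x → p y → p (x + y)) (hsmul : ∀ (r : ℂ) x, p x → p (r • x)) {u : Uℓ ℓ ξ}
    (hu : u ∈ degPart ℓ ξ d) : p u := by
  induction hu using Submodule.span_induction with
  | mem x hx =>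
    obtain ⟨y, hy, rfl⟩ := IsMonomial.exists_normalForm hx
    clear hx
    induction hy using Submodule.span_induction with
    | mem y hy =>
      obtain ⟨a, c, h, hd, hh, rfl⟩ := hy
      rw [map_mul, map_mul]
      exact hmon a c _ hd (toUℓ_mem_cartanℓ hh)
    | zero => rwa [map_zero]
    | add y z _ _ hy hz => rw [map_add]; exact hadd _ _ hy hz
    | smul r y _ hy => rw [toUℓ_smul]; exact hsmul _ _ hy
  | zero => exact hzero
  | add y z _ _ hy hz => exact hadd _ _ hy hz
  | smul r y _ hy => exact hsmul _ _ hy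

lemma projℓ_mem_degPart (hξ : ξ ^ ℓ = 1) (n : ℕ) {d : ℤ} {u : Uℓ ℓ ξ} (hu : u ∈ degPart ℓ ξ d) :
    projℓ hξ n u ∈ degPart ℓ ξ (d + -n) := by
  refine degPart_induction (p := fun u => projℓ hξ n u ∈ degPart ℓ ξ (d + -n)) ?_
    (fun a c h hd hh => ?_) (fun x y hx hy => ?_) (fun r x hx => ?_) hu
  · rw [map_zero]; exact zero_mem _
  · rw [projℓ_monomial hξ n a c hh]
    split_ifs with hc
    · rw [← hd, hc, show (n : ℤ) - a + -n = -a by ring]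
      exact F_mul_mem_degPart a hh
    · exact zero_mem _
  · rw [map_add]; exact add_mem hx hy
  · rw [map_smul]; exact Submodule.smul_mem _ _ hx

/-- An ordered monomial of positive degree contains some `E⁽ᶜ⁾` with `c ≥ 1`, so the retraction onto
`B_ℓ⁻` kills it. -/
lemma eq_zero_of_mem_Bneg_of_mem_degPart (hξ : ξ ^ ℓ = 1) {d : ℤ} (hd : 0 < d) {b : Uℓ ℓ ξ}
    (hb : b ∈ Bneg ℓ ξ) (hb' : b ∈ degPart ℓ ξ d) : b = 0 := by
  rw [← projℓ_zero_of_mem hξ hb]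
  refine degPart_induction (p := fun b => projℓ hξ 0 b = 0) (map_zero _)
    (fun a c h hd' hh => ?_) (fun x y hx hy => ?_) (fun r x hx => ?_) hb'
  · rw [projℓ_monomial hξ 0 a c hh, if_neg (by omega)]
  · rw [map_add, hx, hy, add_zero]
  · rw [map_smul, hx, smul_zero]

end

/-! ### Verma modules -/

/-- Modulo `J`, a product of elements that are scalars is again a scalar. This serves the Cartan
part acting on a Verma module as well as `B_ℓ⁻` modulo the kernel of its character. -/
lemma exists_sub_smul_one_mem {R : Type*} [Ring R] [Algebra ℂ R] {G : Set R} {J : Submodule ℂ R}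
    (hJ : ∀ b ∈ Algebra.adjoin ℂ G, ∀ x ∈ J, b * x ∈ J)
    (hG : ∀ g ∈ G, ∃ s : ℂ, g - s • (1 : R) ∈ J) {b : R} (hb : b ∈ Algebra.adjoin ℂ G) :
    ∃ s : ℂ, b - s • (1 : R) ∈ J := by
  induction hb using Algebra.adjoin_induction with
  | mem x hx => exact hG x hx
  | algebraMap r =>
    exact ⟨r, by rw [Algebra.algebraMap_eq_smul_one, sub_self]; exact zero_mem _⟩
  | add x y _ _ hx hy =>
    obtain ⟨s, hs⟩ := hx
    obtain ⟨t, ht⟩ := hy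
    exact ⟨s + t, by rw [add_smul, add_sub_add_comm]; exact add_mem hs ht⟩
  | mul x y hx' hy' hx hy =>
    obtain ⟨s, hs⟩ := hx
    obtain ⟨t, ht⟩ := hy
    refine ⟨t * s, ?_⟩
    have : x * y - (t * s) • (1 : R) = x * (y - t • 1) + t • (x - s • 1) := by
      rw [mul_sub, mul_smul_comm, mul_one, smul_sub, smul_smul]; abel
    rw [this]
    exact add_mem (hJ x hx' _ ht) (Submodule.smul_mem _ _ hs)

section
variable {ℓ : ℕ} {ξ : ℂˣ} {lam : ℤ} {J : Submodule ℂ (Uℓ ℓ ξ)}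

lemma Kinv_sub_mem (hJ : ∀ x ∈ J, Kinv ℓ ξ * x ∈ J)
    (hK : K ℓ ξ - ((ξ ^ lam : ℂˣ) : ℂ) • (1 : Uℓ ℓ ξ) ∈ J) :
    Kinv ℓ ξ - ((ξ ^ (-lam) : ℂˣ) : ℂ) • (1 : Uℓ ℓ ξ) ∈ J := by
  have h1 := hJ _ hK
  rw [mul_sub, Kinv_mul_K, mul_smul_comm, mul_one] at h1
  have h2 := Submodule.smul_mem J (-((ξ ^ (-lam) : ℂˣ) : ℂ)) h1
  rw [smul_sub, smul_smul, neg_mul, ← Units.val_mul, ← zpow_add, neg_add_cancel, zpow_zero,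
    Units.val_one, neg_smul, neg_smul, one_smul, sub_neg_eq_add, neg_add_eq_sub] at h2
  exact h2

/-- Only the elements with `c = -lam` are imposed in `weightKer`. Since `bin_shift` and
`qBinAt_shift` are the same recursion, they determine the scalars for all `c`, by induction on `t`
and then away from `c = -lam` in both directions. -/
lemma bin_sub_mem (hJ : ∀ x ∈ J, Kinv ℓ ξ * x ∈ J)
    (hK : K ℓ ξ - ((ξ ^ lam : ℂˣ) : ℂ) • (1 : Uℓ ℓ ξ) ∈ J)
    (hbin : ∀ t : ℕ, 1 ≤ t → bin ℓ ξ (-lam) t ∈ J) (c : ℤ) (t : ℕ) :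
    bin ℓ ξ c t - qBinAt ξ (lam + c) t • (1 : Uℓ ℓ ξ) ∈ J := by
  induction t generalizing c with
  | zero => rw [bin_zero, qBinAt_zero_right, one_smul, sub_self]; exact zero_mem _
  | succ t ih =>
    have hR : ∀ c : ℤ, Kinv ℓ ξ * bin ℓ ξ c t -
        (((ξ ^ (-lam) : ℂˣ) : ℂ) * qBinAt ξ (lam + c) t) • (1 : Uℓ ℓ ξ) ∈ J := by
      intro c
      have h1 := add_mem (hJ _ (ih c))
        (Submodule.smul_mem J (qBinAt ξ (lam + c) t) (Kinv_sub_mem hJ hK))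
      rwa [mul_sub, mul_smul_comm, mul_one, smul_sub, smul_smul, sub_add_sub_cancel,
        mul_comm (qBinAt _ _ _)] at h1
    have hstep : ∀ c : ℤ, bin ℓ ξ (c + 1) (t + 1) -
        qBinAt ξ (lam + (c + 1)) (t + 1) • (1 : Uℓ ℓ ξ) =
        ((ξ ^ ((t : ℤ) + 1) : ℂˣ) : ℂ) •
          (bin ℓ ξ c (t + 1) - qBinAt ξ (lam + c) (t + 1) • (1 : Uℓ ℓ ξ)) +
        ((ξ ^ ((t : ℤ) - c) : ℂˣ) : ℂ) • (Kinv ℓ ξ * bin ℓ ξ c t -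
          (((ξ ^ (-lam) : ℂˣ) : ℂ) * qBinAt ξ (lam + c) t) • (1 : Uℓ ℓ ξ)) := by
      intro c
      rw [bin_shift, ← add_assoc lam, qBinAt_shift, smul_sub, smul_sub, smul_smul, smul_smul,
        ← mul_assoc, ← Units.val_mul, ← zpow_add, add_smul,
        show (t : ℤ) - c + -lam = t - (lam + c) by ring]
      abel
    -- At the base point `c = -lam` the scalar is `[0; t+1] = 0`.
    induction c using Int.inductionOn' (b := -lam) with
    | zero =>
      have : qBinAt ξ (lam + -lam) (t + 1) = 0 := by
        rw [add_neg_cancel]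
        exact qBinAt_eq_zero (m := 0) (Nat.succ_pos t)
      rw [this, zero_smul, sub_zero]
      exact hbin _ (Nat.succ_pos t)
    | succ c _ hc =>
      rw [hstep]
      exact add_mem (Submodule.smul_mem _ _ hc) (Submodule.smul_mem _ _ (hR c))
    | pred c _ hc =>
      have h := hstep (c - 1)
      rw [sub_add_cancel, ← sub_eq_iff_eq_add] at h
      rw [← Submodule.smul_mem_iff _ (Units.ne_zero (ξ ^ ((t : ℤ) + 1))), ← h]
      exact sub_mem hc (Submodule.smul_mem _ _ (hR _))

lemma exists_cartan_sub_mem (hJ : ∀ x ∈ J, Kinv ℓ ξ * x ∈ J)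
    (hK : K ℓ ξ - ((ξ ^ lam : ℂˣ) : ℂ) • (1 : Uℓ ℓ ξ) ∈ J)
    (hbin : ∀ t : ℕ, 1 ≤ t → bin ℓ ξ (-lam) t ∈ J) {g : Uℓ ℓ ξ} (hg : g ∈ cartanGens ℓ ξ) :
    ∃ s : ℂ, g - s • (1 : Uℓ ℓ ξ) ∈ J := by
  rcases hg with (rfl | rfl) | ⟨c, t, rfl⟩
  · exact ⟨_, hK⟩
  · exact ⟨_, Kinv_sub_mem hJ hK⟩
  · exact ⟨_, bin_sub_mem hJ hK hbin c t⟩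

lemma K_sub_mem_weightKer :
    K ℓ ξ - ((ξ ^ lam : ℂˣ) : ℂ) • (1 : Uℓ ℓ ξ) ∈ weightKer ℓ ξ lam :=
  Or.inl (by rw [Algebra.algebraMap_eq_smul_one]; exact Set.mem_singleton _)

lemma bin_mem_weightKer {t : ℕ} (ht : 1 ≤ t) : bin ℓ ξ (-lam) t ∈ weightKer ℓ ξ lam :=
  Or.inr ⟨t, ht, rfl⟩

end

section verma
variable {ℓ : ℕ} {ξ : ℂˣ} {lam : ℤ}

/-- The kernel of the projection of `U_ℓ` onto the Verma module. -/
abbrev vermaKer (ℓ : ℕ) (ξ : ℂˣ) (lam : ℤ) : Submodule (Uℓ ℓ ξ) (Uℓ ℓ ξ) :=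
  Submodule.span (Uℓ ℓ ξ) (posKer ℓ ξ lam)

/-- The projection of `U_ℓ` onto the Verma module. -/
def toVerma (ℓ : ℕ) (ξ : ℂˣ) (lam : ℤ) : Uℓ ℓ ξ →ₗ[Uℓ ℓ ξ] Verma ℓ ξ lam :=
  (vermaKer ℓ ξ lam).mkQ

lemma toVerma_smul (c : ℂ) (u : Uℓ ℓ ξ) : toVerma ℓ ξ lam (c • u) = c • toVerma ℓ ξ lam u := rfl

lemma smul_toVerma (u w : Uℓ ℓ ξ) : u • toVerma ℓ ξ lam w = toVerma ℓ ξ lam (u * w) := rfl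

lemma toVerma_mul_eq {u w : Uℓ ℓ ξ} {s : ℂ} (h : w - s • (1 : Uℓ ℓ ξ) ∈ vermaKer ℓ ξ lam) :
    toVerma ℓ ξ lam (u * w) = s • toVerma ℓ ξ lam u := by
  rw [← toVerma_smul, ← sub_eq_zero, ← map_sub, ← LinearMap.mem_ker, toVerma, Submodule.ker_mkQ]
  have := (vermaKer ℓ ξ lam).smul_mem u h
  rwa [smul_eq_mul, mul_sub, mul_smul_comm, mul_one] at this

lemma toVerma_mul_E (u : Uℓ ℓ ξ) {n : ℕ} (hn : 1 ≤ n) : toVerma ℓ ξ lam (u * E ℓ ξ n) = 0 := by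
  rw [toVerma_mul_eq (s := 0), zero_smul]
  rw [zero_smul, sub_zero]
  exact Submodule.subset_span (Or.inl ⟨n, hn, rfl⟩)

lemma toVerma_mul_K (u : Uℓ ℓ ξ) :
    toVerma ℓ ξ lam (u * K ℓ ξ) = ((ξ ^ lam : ℂˣ) : ℂ) • toVerma ℓ ξ lam u :=
  toVerma_mul_eq (Submodule.subset_span (Or.inr K_sub_mem_weightKer))

lemma toVerma_mul_bin (u : Uℓ ℓ ξ) (c : ℤ) (t : ℕ) :
    toVerma ℓ ξ lam (u * bin ℓ ξ c t) = qBinAt ξ (lam + c) t • toVerma ℓ ξ lam u :=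
  toVerma_mul_eq (bin_sub_mem (J := (vermaKer ℓ ξ lam).restrictScalars ℂ)
    (fun _ hx => (vermaKer ℓ ξ lam).smul_mem _ hx)
    (Submodule.subset_span (Or.inr K_sub_mem_weightKer))
    (fun _ ht => Submodule.subset_span (Or.inr (bin_mem_weightKer ht))) c t)

lemma exists_toVerma_mul_cartan {h : Uℓ ℓ ξ} (hh : h ∈ cartanℓ ℓ ξ) :
    ∃ s : ℂ, ∀ u, toVerma ℓ ξ lam (u * h) = s • toVerma ℓ ξ lam u := by
  obtain ⟨s, hs⟩ := exists_sub_smul_one_mem (J := (vermaKer ℓ ξ lam).restrictScalars ℂ)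
    (fun b _ _ hx => (vermaKer ℓ ξ lam).smul_mem b hx)
    (fun g hg => exists_cartan_sub_mem (lam := lam) (J := (vermaKer ℓ ξ lam).restrictScalars ℂ)
      (fun x hx => (vermaKer ℓ ξ lam).smul_mem _ hx)
      (Submodule.subset_span (Or.inr K_sub_mem_weightKer))
      (fun _ ht => Submodule.subset_span (Or.inr (bin_mem_weightKer ht))) hg) hh
  exact ⟨s, fun u => toVerma_mul_eq hs⟩

lemma span_toVerma_F : Submodule.span ℂ (Set.range fun n => toVerma ℓ ξ lam (F ℓ ξ n)) = ⊤ := by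
  rw [eq_top_iff]
  rintro y -
  obtain ⟨u, rfl⟩ := Submodule.mkQ_surjective _ y
  induction u using Uℓ_monomial_induction with
  | hmon a c h hh =>
    rcases Nat.eq_zero_or_pos c with rfl | hc
    · obtain ⟨s, hs⟩ := exists_toVerma_mul_cartan (lam := lam) hh
      rw [E_zero, mul_one]
      have := hs (F ℓ ξ a)
      rw [toVerma] at this
      rw [this]
      exact Submodule.smul_mem _ _ (Submodule.subset_span ⟨a, rfl⟩)
    · have := toVerma_mul_E (lam := lam) (F ℓ ξ a * h) hc
      rw [toVerma] at this
      rw [this]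
      exact zero_mem _
  | hadd x y hx hy => rw [map_add]; exact add_mem hx hy
  | hsmul r x hx => exact Submodule.smul_mem _ r hx

/-- The extra factor `u` is what lets the induction over the left ideal pass through multiplication.
-/
lemma omegaℓ_mul_eq_zero (hξ : ξ ^ ℓ = 1) (n : ℕ) {w : Uℓ ℓ ξ} (hw : w ∈ vermaKer ℓ ξ lam)
    (u : Uℓ ℓ ξ) : omegaℓ hξ lam n (u * w) = 0 := by
  induction hw using Submodule.span_induction generalizing u with
  | mem x hx =>
    rcases hx with ⟨k, hk, rfl⟩ | hx | ⟨t, ht, rfl⟩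
    · exact omegaℓ_mul_E hξ lam n u k hk
    · rw [Set.mem_singleton_iff.mp hx, mul_sub, map_sub, omegaℓ_mul_K, Algebra.algebraMap_eq_smul_one,
        mul_smul_comm, mul_one, map_smul, smul_eq_mul, sub_self]
    · rw [omegaℓ_mul_bin, add_neg_cancel, show qBinAt ξ 0 t = 0 from qBinAt_eq_zero (m := 0) ht,
        zero_mul]
  | zero => rw [mul_zero, map_zero]
  | add x y _ _ hx hy => rw [mul_add, map_add, hx, hy, add_zero]
  | smul r x _ hx => rw [smul_eq_mul, ← mul_assoc, hx]

/-- The coordinates on the Verma module with respect to the vectors `F⁽ⁿ⁾`. -/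
def vermaCoord (hξ : ξ ^ ℓ = 1) (lam : ℤ) (n : ℕ) : Verma ℓ ξ lam →ₗ[ℂ] ℂ :=
  ((vermaKer ℓ ξ lam).restrictScalars ℂ).liftQ (omegaℓ hξ lam n) (fun u hu => by
    have := omegaℓ_mul_eq_zero hξ n hu 1
    rwa [one_mul] at this) ∘ₗ
  (Submodule.Quotient.restrictScalarsEquiv ℂ (vermaKer ℓ ξ lam)).symm.toLinearMap

lemma vermaCoord_toVerma (hξ : ξ ^ ℓ = 1) (n : ℕ) (u : Uℓ ℓ ξ) :
    vermaCoord hξ lam n (toVerma ℓ ξ lam u) = omegaℓ hξ lam n u := rfl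

/-- The basis of the Verma module. -/
def vermaBasis (hξ : ξ ^ ℓ = 1) (lam : ℤ) : Module.Basis ℕ ℂ (Verma ℓ ξ lam) :=
  Module.Basis.mk (v := fun n => toVerma ℓ ξ lam (F ℓ ξ n)) (by
    rw [linearIndependent_iff']
    intro s g hg i hi
    have h := congrArg (vermaCoord hξ lam i) hg
    simp only [map_sum, map_smul, map_zero, vermaCoord_toVerma, omegaℓ_F, smul_eq_mul, mul_ite,
      mul_one, mul_zero, Finset.sum_ite_eq', if_pos hi] at h
    exact h) span_toVerma_F.ge

lemma vermaBasis_apply (hξ : ξ ^ ℓ = 1) (n : ℕ) :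
    vermaBasis hξ lam n = toVerma ℓ ξ lam (F ℓ ξ n) := Module.Basis.mk_apply _ _ _

variable (hξ : ξ ^ ℓ = 1)

lemma F_smul_vermaBasis (k n : ℕ) : F ℓ ξ k • vermaBasis hξ lam n =
    qBinAt ξ ((k : ℤ) + n) k • vermaBasis hξ lam (k + n) := by
  rw [vermaBasis_apply, vermaBasis_apply, smul_toVerma, F_mul_F, toVerma_smul]

/-- Of the terms of `E⁽ᵏ⁾F⁽ⁿ⁺ᵏ⁾` only `j = k` survives; the others end in a positive divided power
of `E`, which kills the highest weight vector. -/
lemma E_smul_vermaBasis_add (k n : ℕ) : E ℓ ξ k • vermaBasis hξ lam (n + k) =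
    qBinAt ξ (lam - n) k • vermaBasis hξ lam n := by
  rw [vermaBasis_apply, vermaBasis_apply, smul_toVerma, E_mul_F, map_sum,
    min_eq_left (Nat.le_add_left k n), Finset.sum_range_succ, Finset.sum_eq_zero, zero_add,
    Nat.sub_self, E_zero, mul_one, toVerma_mul_bin, Nat.add_sub_cancel]
  · push_cast
    rw [show lam + (2 * (k : ℤ) - k - (n + k)) = lam - n by ring]
  · intro j hj
    exact toVerma_mul_E _ (Nat.sub_pos_of_lt (Finset.mem_range.mp hj))

lemma E_smul_vermaBasis_of_lt {k n : ℕ} (h : n < k) : E ℓ ξ k • vermaBasis hξ lam n = 0 := by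
  rw [vermaBasis_apply, smul_toVerma, E_mul_F, map_sum]
  refine Finset.sum_eq_zero fun j hj => toVerma_mul_E _ ?_
  have := Finset.mem_range.mp hj
  omega

lemma K_smul_vermaBasis (n : ℕ) : K ℓ ξ • vermaBasis hξ lam n =
    ((ξ ^ (lam - 2 * n) : ℂˣ) : ℂ) • vermaBasis hξ lam n := by
  rw [vermaBasis_apply, smul_toVerma, K_mul_F, toVerma_smul, toVerma_mul_K, smul_smul,
    ← Units.val_mul, ← zpow_add, show -2 * (n : ℤ) + lam = lam - 2 * n by ring]

lemma bin_smul_vermaBasis (c : ℤ) (t n : ℕ) : bin ℓ ξ c t • vermaBasis hξ lam n =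
    qBinAt ξ (lam + c - 2 * n) t • vermaBasis hξ lam n := by
  rw [vermaBasis_apply, smul_toVerma, bin_mul_F, toVerma_mul_bin, add_sub_assoc]

/-! ### Submodules of finite codimension -/

/-- At a root of unity `K` has only finitely many eigenvalues and cannot separate the basis vectors,
but the `[K; c; t]` can: the vector of least index is split off first, then one inducts on the rest.
-/
lemma smul_vermaBasis_mem_of_sum_mem (N : Submodule (Uℓ ℓ ξ) (Verma ℓ ξ lam)) (g : ℕ → ℂ)
    (s : Finset ℕ) (h : ∑ n ∈ s, g n • vermaBasis hξ lam n ∈ N) :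
    ∀ n ∈ s, g n • vermaBasis hξ lam n ∈ N := by
  induction s using Finset.induction_on_min with
  | empty => intro n hn; simp at hn
  | insert a s ha ih =>
    have has : a ∉ s := fun h => lt_irrefl _ (ha a h)
    obtain ⟨D, hD⟩ : ∃ D, ∀ n ∈ s, n ≤ a + D :=
      ⟨s.sup id, fun n hn => (Finset.le_sup (f := id) hn).trans (Nat.le_add_left _ _)⟩
    -- On the `n`-th vector this element acts by `[2(a+D-n); 2D]`. This is `1` at `n = a`, and for
    -- `a < n ≤ a+D` it is `0`, as the upper entry is nonnegative and smaller than `2D`.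
    have h1 : bin ℓ ξ (2 * (a + D) - lam) (2 * D) •
        ∑ n ∈ insert a s, g n • vermaBasis hξ lam n = g a • vermaBasis hξ lam a := by
      rw [Finset.smul_sum, Finset.sum_insert has, Finset.sum_eq_zero, add_zero, smul_comm,
        bin_smul_vermaBasis, show lam + (2 * ((a : ℤ) + D) - lam) - 2 * a = (2 * D : ℕ) by
          push_cast; ring, qBinAt_self, one_smul]
      intro n hn
      obtain ⟨m, hm⟩ : ∃ m, a + D = n + m := ⟨a + D - n, by have := hD n hn; omega⟩
      have hlt : 2 * m < 2 * D := by have := ha n hn; omega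
      have hcast : lam + (2 * ((a : ℤ) + D) - lam) - 2 * n = (2 * m : ℕ) := by
        have : (a : ℤ) + D = n + m := by exact_mod_cast hm
        rw [this]; push_cast; ring
      rw [smul_comm, bin_smul_vermaBasis, hcast, qBinAt_eq_zero hlt, zero_smul, smul_zero]
    have ha' : g a • vermaBasis hξ lam a ∈ N := h1 ▸ N.smul_mem _ h
    rw [Finset.sum_insert has] at h
    have h2 := ih ((N.add_mem_iff_right ha').mp h)
    intro n hn
    rcases Finset.mem_insert.mp hn with rfl | hn
    · exact ha'
    · exact h2 n hn

/-- By the separation above, the basis vectors outside `N` stay independent modulo `N`, so there are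
finitely many of them. -/
lemma exists_vermaBasis_mem (N : Submodule (Uℓ ℓ ξ) (Verma ℓ ξ lam))
    [FiniteDimensional ℂ (Verma ℓ ξ lam ⧸ N)] : ∃ M, ∀ n, M ≤ n → vermaBasis hξ lam n ∈ N := by
  have hind : LinearIndependent ℂ
      (fun n : {n : ℕ | vermaBasis hξ lam n ∉ N} => N.mkQ (vermaBasis hξ lam n)) := by
    rw [linearIndependent_iff']
    intro s g hg i hi
    classical
    let g' : ℕ → ℂ := fun n => if h : vermaBasis hξ lam n ∉ N then g ⟨n, h⟩ else 0
    have hg' : ∀ i : {n : ℕ | vermaBasis hξ lam n ∉ N}, g' i = g i := fun i => dif_pos (show _ ∉ N from i.2)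
    have h1 : ∑ n ∈ s.map (Function.Embedding.subtype _), g' n • vermaBasis hξ lam n ∈ N := by
      rw [Finset.sum_map]
      refine (Submodule.Quotient.mk_eq_zero N).mp ((map_sum N.mkQ _ _).trans (Eq.trans ?_ hg))
      refine Finset.sum_congr rfl fun n _ => ?_
      rw [Function.Embedding.subtype_apply, hg']
      rfl
    have h2 := smul_vermaBasis_mem_of_sum_mem hξ N g' _ h1 i
      (Finset.mem_map.mpr ⟨i, hi, rfl⟩)
    by_contra hne
    rw [hg'] at h2
    have h3 := (N.restrictScalars ℂ).smul_mem (g i)⁻¹ h2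
    rw [smul_smul, inv_mul_cancel₀ hne, one_smul] at h3
    exact i.2 h3
  have hfin : {n : ℕ | vermaBasis hξ lam n ∉ N}.Finite :=
    Set.finite_coe_iff.mp hind.finite_of_isNoetherian
  obtain ⟨M, hM⟩ := hfin.bddAbove
  refine ⟨M + 1, fun n hn => ?_⟩
  by_contra hnot
  have := hM hnot
  omega

/-- A submodule of finite codimension contains all basis vectors `F⁽ⁿ⁾` with `n > μ`. -/
lemma vermaBasis_mem_of_finiteDimensional {μ : ℕ} (N : Submodule (Uℓ ℓ ξ) (Verma ℓ ξ μ))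
    [FiniteDimensional ℂ (Verma ℓ ξ μ ⧸ N)] {n : ℕ} (hn : μ < n) : vermaBasis hξ μ n ∈ N := by
  obtain ⟨M, hM⟩ := exists_vermaBasis_mem hξ N
  -- Descending induction on `n`, with `j` bounding the distance to the range `M ≤ n` that is
  -- already known.
  suffices h : ∀ j n : ℕ, μ < n → M ≤ n + j → vermaBasis hξ μ n ∈ N from h M n hn (by omega)
  intro j
  induction j with
  | zero => exact fun n _ h => hM n h
  | succ j ih =>
    intro n hn hj
    obtain ⟨p, rfl⟩ : ∃ p, n = μ + 1 + p := ⟨n - μ - 1, by omega⟩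
    -- This `k` makes `E⁽ᵏ⁾` carry the vector of index `n + k`, already in `N`, to a nonzero
    -- multiple of the vector of index `n`.
    obtain ⟨k, hk, hne⟩ := exists_qBinAt_ne_zero (ξ := ξ) p
    have h1 := E_smul_vermaBasis_add (lam := μ) hξ k (μ + 1 + p)
    have h2 : qBinAt ξ ((μ : ℤ) - (μ + 1 + p : ℕ)) k ≠ 0 := by
      push_cast
      rw [show (μ : ℤ) - (μ + 1 + p) = -(p + 1) by ring, qBinAt_neg,
        show (p : ℤ) + 1 + k - 1 = p + k by ring]
      exact mul_ne_zero (pow_ne_zero _ (by norm_num)) hne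
    have h3 := N.smul_mem (E ℓ ξ k) (ih (μ + 1 + p + k) (by omega) (by omega))
    rw [h1] at h3
    have h4 := (N.restrictScalars ℂ).smul_mem (qBinAt ξ ((μ : ℤ) - (μ + 1 + p : ℕ)) k)⁻¹ h3
    rwa [smul_smul, inv_mul_cancel₀ h2, one_smul] at h4

end verma

/-! ### Coordinates on the Verma module -/

section coord
variable {ℓ : ℕ} {ξ : ℂˣ} {lam : ℤ} (hξ : ξ ^ ℓ = 1)

lemma vermaCoord_vermaBasis (m n : ℕ) :
    vermaCoord hξ lam m (vermaBasis hξ lam n) = if n = m then 1 else 0 := by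
  rw [vermaBasis_apply, vermaCoord_toVerma, omegaℓ_F]

lemma vermaBasis_repr (y : Verma ℓ ξ lam) (m : ℕ) :
    (vermaBasis hξ lam).repr y m = vermaCoord hξ lam m y := by
  have : Finsupp.lapply m ∘ₗ (vermaBasis hξ lam).repr.toLinearMap = vermaCoord hξ lam m := by
    refine (vermaBasis hξ lam).ext fun n => ?_
    rw [LinearMap.comp_apply, LinearEquiv.coe_coe, Module.Basis.repr_self, Finsupp.lapply_apply,
      Finsupp.single_apply, vermaCoord_vermaBasis]
  exact LinearMap.congr_fun this y

lemma verma_ext {y z : Verma ℓ ξ lam} (h : ∀ m, vermaCoord hξ lam m y = vermaCoord hξ lam m z) :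
    y = z :=
  (vermaBasis hξ lam).repr.injective (Finsupp.ext fun m => by
    rw [vermaBasis_repr, vermaBasis_repr, h])

lemma vermaCoord_smul_of {u : Uℓ ℓ ξ} {m : ℕ} {p : Verma ℓ ξ lam →ₗ[ℂ] ℂ}
    (h : ∀ n, vermaCoord hξ lam m (u • vermaBasis hξ lam n) = p (vermaBasis hξ lam n))
    (y : Verma ℓ ξ lam) : vermaCoord hξ lam m (u • y) = p y := by
  have : vermaCoord hξ lam m ∘ₗ Algebra.lsmul ℂ ℂ (Verma ℓ ξ lam) u = p :=
    (vermaBasis hξ lam).ext h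
  exact LinearMap.congr_fun this y

lemma vermaCoord_F_smul_add (k m : ℕ) (y : Verma ℓ ξ lam) :
    vermaCoord hξ lam (k + m) (F ℓ ξ k • y) =
      qBinAt ξ ((k : ℤ) + m) k * vermaCoord hξ lam m y := by
  refine vermaCoord_smul_of hξ (p := qBinAt ξ ((k : ℤ) + m) k • vermaCoord hξ lam m)
    (fun n => ?_) y
  rw [F_smul_vermaBasis, map_smul, LinearMap.smul_apply, vermaCoord_vermaBasis,
    vermaCoord_vermaBasis]
  by_cases h : n = m
  · rw [h, if_pos rfl, if_pos rfl]
  · rw [if_neg h, if_neg (by omega), smul_zero, smul_zero]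

lemma vermaCoord_F_smul_of_lt {k m : ℕ} (hm : m < k) (y : Verma ℓ ξ lam) :
    vermaCoord hξ lam m (F ℓ ξ k • y) = 0 := by
  refine vermaCoord_smul_of hξ (p := 0) (fun n => ?_) y
  rw [F_smul_vermaBasis, map_smul, vermaCoord_vermaBasis, if_neg (by omega), smul_zero,
    LinearMap.zero_apply]

lemma vermaCoord_E_smul (k m : ℕ) (y : Verma ℓ ξ lam) :
    vermaCoord hξ lam m (E ℓ ξ k • y) =
      qBinAt ξ (lam - m) k * vermaCoord hξ lam (m + k) y := by
  refine vermaCoord_smul_of hξ (p := qBinAt ξ (lam - m) k • vermaCoord hξ lam (m + k))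
    (fun n => ?_) y
  rw [LinearMap.smul_apply, vermaCoord_vermaBasis]
  rcases lt_or_ge n k with h | h
  · rw [E_smul_vermaBasis_of_lt hξ h, map_zero, if_neg (by omega), smul_zero]
  · obtain ⟨n, rfl⟩ : ∃ j, n = j + k := ⟨n - k, by omega⟩
    rw [E_smul_vermaBasis_add, map_smul, vermaCoord_vermaBasis]
    by_cases h : n = m
    · rw [h]; simp
    · rw [if_neg h, if_neg (by omega), smul_zero, smul_zero]

lemma vermaCoord_K_smul (m : ℕ) (y : Verma ℓ ξ lam) :
    vermaCoord hξ lam m (K ℓ ξ • y) =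
      ((ξ ^ (lam - 2 * m) : ℂˣ) : ℂ) * vermaCoord hξ lam m y := by
  refine vermaCoord_smul_of hξ (p := ((ξ ^ (lam - 2 * m) : ℂˣ) : ℂ) • vermaCoord hξ lam m)
    (fun n => ?_) y
  rw [K_smul_vermaBasis, map_smul, LinearMap.smul_apply, vermaCoord_vermaBasis]
  by_cases h : n = m
  · rw [h]
  · rw [if_neg h, smul_zero, smul_zero]

lemma vermaCoord_bin_smul (c : ℤ) (t m : ℕ) (y : Verma ℓ ξ lam) :
    vermaCoord hξ lam m (bin ℓ ξ c t • y) =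
      qBinAt ξ (lam + c - 2 * m) t * vermaCoord hξ lam m y := by
  refine vermaCoord_smul_of hξ (p := qBinAt ξ (lam + c - 2 * m) t • vermaCoord hξ lam m)
    (fun n => ?_) y
  rw [bin_smul_vermaBasis, map_smul, LinearMap.smul_apply, vermaCoord_vermaBasis]
  by_cases h : n = m
  · rw [h]
  · rw [if_neg h, smul_zero, smul_zero]

/-! ### The character of `B_ℓ⁻` -/

/-- On `B_ℓ⁻`, the character of weight `lam`. -/
abbrev chi (lam : ℤ) : Uℓ ℓ ξ →ₗ[ℂ] ℂ := omegaℓ hξ lam 0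

/-- The vectors `F⁽ⁿ⁾v` with `n ≥ 1` span a `B_ℓ⁻`-submodule of the Verma module, and `B_ℓ⁻` acts on
the one-dimensional quotient by a character. This is how the character of `B_ℓ⁻` is shown to exist.
-/
lemma exists_vermaCoord_zero_smul {b : Uℓ ℓ ξ} (hb : b ∈ Bneg ℓ ξ) : ∃ s : ℂ,
    ∀ y : Verma ℓ ξ lam, vermaCoord hξ lam 0 (b • y) = s * vermaCoord hξ lam 0 y := by
  induction hb using Algebra.adjoin_induction with
  | mem x hx =>
    rcases hx with ⟨k, rfl⟩ | (rfl | rfl) | ⟨c, t, rfl⟩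
    · rcases Nat.eq_zero_or_pos k with rfl | hk
      · exact ⟨_, vermaCoord_F_smul_add hξ 0 0⟩
      · exact ⟨0, fun y => by rw [vermaCoord_F_smul_of_lt hξ hk, zero_mul]⟩
    · exact ⟨_, vermaCoord_K_smul hξ 0⟩
    · refine ⟨((ξ ^ (lam - 2 * (0 : ℕ)) : ℂˣ) : ℂ)⁻¹, fun y => ?_⟩
      have h := vermaCoord_K_smul hξ 0 (Kinv ℓ ξ • y)
      rw [smul_smul, K_mul_Kinv, one_smul] at h
      rw [h, inv_mul_cancel_left₀ (Units.ne_zero _)]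
    · exact ⟨_, vermaCoord_bin_smul hξ c t 0⟩
  | algebraMap r =>
    refine ⟨r, fun y => ?_⟩
    rw [algebraMap_smul, map_smul, smul_eq_mul]
  | add x y _ _ hx hy =>
    obtain ⟨s, hs⟩ := hx
    obtain ⟨t, ht⟩ := hy
    exact ⟨s + t, fun z => by rw [add_smul, map_add, hs, ht, add_mul]⟩
  | mul x y _ _ hx hy =>
    obtain ⟨s, hs⟩ := hx
    obtain ⟨t, ht⟩ := hy
    exact ⟨s * t, fun z => by rw [mul_smul, hs, ht, mul_assoc]⟩

lemma chi_one : chi hξ lam (1 : Uℓ ℓ ξ) = 1 := by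
  have := omegaℓ_F hξ lam 0 0
  rwa [F_zero, if_pos rfl] at this

lemma chi_mul {b : Uℓ ℓ ξ} (hb : b ∈ Bneg ℓ ξ) (w : Uℓ ℓ ξ) :
    chi hξ lam (b * w) = chi hξ lam b * chi hξ lam w := by
  obtain ⟨s, hs⟩ := exists_vermaCoord_zero_smul (lam := lam) hξ hb
  have h : ∀ w : Uℓ ℓ ξ, chi hξ lam (b * w) = s * chi hξ lam w := fun w =>
    hs (toVerma ℓ ξ lam w)
  have h1 := h 1
  rw [mul_one, chi_one, mul_one] at h1
  rw [h, h1]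

lemma chi_F {n : ℕ} (hn : 1 ≤ n) : chi hξ lam (F ℓ ξ n) = 0 := by
  rw [omegaℓ_F, if_neg (by omega)]

lemma chi_K : chi hξ lam (K ℓ ξ) = ((ξ ^ lam : ℂˣ) : ℂ) := by
  have := omegaℓ_mul_K hξ lam 0 (1 : Uℓ ℓ ξ)
  rwa [one_mul, chi_one, mul_one] at this

lemma chi_bin (c : ℤ) (t : ℕ) : chi hξ lam (bin ℓ ξ c t) = qBinAt ξ (lam + c) t := by
  have := omegaℓ_mul_bin hξ lam 0 (1 : Uℓ ℓ ξ) c t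
  rwa [one_mul, chi_one, mul_one] at this

lemma chi_negKer {g : Uℓ ℓ ξ} (hg : g ∈ negKer ℓ ξ lam) : chi hξ lam g = 0 := by
  rcases hg with ⟨n, hn, rfl⟩ | hg | ⟨t, ht, rfl⟩
  · exact chi_F hξ hn
  · rw [Set.mem_singleton_iff.mp hg, map_sub, chi_K, Algebra.algebraMap_eq_smul_one, map_smul,
      chi_one, smul_eq_mul, mul_one, sub_self]
  · rw [chi_bin, add_neg_cancel]
    exact qBinAt_eq_zero (m := 0) ht

/-- The left ideal of `B_ℓ⁻` generated by `negKer`. -/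
def negIdeal (ℓ : ℕ) (ξ : ℂˣ) (lam : ℤ) : Submodule ℂ (Uℓ ℓ ξ) :=
  Submodule.span ℂ {x | ∃ b ∈ Bneg ℓ ξ, ∃ g ∈ negKer ℓ ξ lam, x = b * g}

lemma mul_mem_negIdeal {b x : Uℓ ℓ ξ} (hb : b ∈ Bneg ℓ ξ) (hx : x ∈ negIdeal ℓ ξ lam) :
    b * x ∈ negIdeal ℓ ξ lam := by
  induction hx using Submodule.span_induction with
  | mem x hx =>
    obtain ⟨b', hb', g, hg, rfl⟩ := hx
    exact Submodule.subset_span ⟨_, (Bneg ℓ ξ).mul_mem hb hb', g, hg, (mul_assoc _ _ _).symm⟩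
  | zero => rw [mul_zero]; exact zero_mem _
  | add x y _ _ hx hy => rw [mul_add]; exact add_mem hx hy
  | smul r x _ hx => rw [mul_smul_comm]; exact Submodule.smul_mem _ _ hx

lemma negKer_mem_negIdeal {g : Uℓ ℓ ξ} (hg : g ∈ negKer ℓ ξ lam) : g ∈ negIdeal ℓ ξ lam :=
  Submodule.subset_span ⟨1, (Bneg ℓ ξ).one_mem, g, hg, (one_mul g).symm⟩

lemma chi_negIdeal {x : Uℓ ℓ ξ} (hx : x ∈ negIdeal ℓ ξ lam) : chi hξ lam x = 0 := by
  induction hx using Submodule.span_induction with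
  | mem x hx =>
    obtain ⟨b, hb, g, hg, rfl⟩ := hx
    rw [chi_mul hξ hb, chi_negKer hξ hg, mul_zero]
  | zero => exact map_zero _
  | add x y _ _ hx hy => rw [map_add, hx, hy, add_zero]
  | smul r x _ hx => rw [map_smul, hx, smul_zero]

/-- Modulo `negIdeal` every element of `B_ℓ⁻` is a scalar, and applying `chi` identifies it. So
`negKer` does generate the whole kernel of the character. -/
lemma mem_negIdeal_of_chi_eq_zero {b : Uℓ ℓ ξ} (hb : b ∈ Bneg ℓ ξ) (h : chi hξ lam b = 0) :
    b ∈ negIdeal ℓ ξ lam := by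
  have hK := negKer_mem_negIdeal (lam := lam) (Or.inr (K_sub_mem_weightKer (ℓ := ℓ) (ξ := ξ)))
  have hgen : ∀ g ∈ Set.range (F ℓ ξ) ∪ cartanGens ℓ ξ,
      ∃ s : ℂ, g - s • (1 : Uℓ ℓ ξ) ∈ negIdeal ℓ ξ lam := by
    rintro g (⟨n, rfl⟩ | hg)
    · rcases Nat.eq_zero_or_pos n with rfl | hn
      · exact ⟨1, by rw [F_zero, one_smul, sub_self]; exact zero_mem _⟩
      · exact ⟨0, by rw [zero_smul, sub_zero]; exact negKer_mem_negIdeal (Or.inl ⟨n, hn, rfl⟩)⟩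
    · exact exists_cartan_sub_mem (lam := lam) (fun x hx => mul_mem_negIdeal Kinv_mem_Bneg hx) hK
        (fun _ ht => negKer_mem_negIdeal (Or.inr (bin_mem_weightKer ht))) hg
  obtain ⟨s, hs⟩ := exists_sub_smul_one_mem (fun b hb x hx => mul_mem_negIdeal hb hx) hgen hb
  have h1 := chi_negIdeal hξ hs
  rw [map_sub, h, map_smul, chi_one, smul_eq_mul, mul_one, zero_sub, neg_eq_zero] at h1
  rwa [h1, zero_smul, sub_zero] at hs

end coord

/-! ### The semiregular module -/

section semiregular
variable {ℓ : ℕ} {ξ : ℂˣ}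

lemma HomB.add_apply (φ ψ : HomB ℓ ξ) (x : Uℓ ℓ ξ) : (φ + ψ) x = φ x + ψ x := rfl

lemma HomB.smul_apply (u : Uℓ ℓ ξ) (φ : HomB ℓ ξ) (x : Uℓ ℓ ξ) : (u • φ) x = φ (x * u) := rfl

lemma HomB.mulRight_apply (φ : HomB ℓ ξ) (b : Bneg ℓ ξ) (x : Uℓ ℓ ξ) :
    φ.mulRight ℓ ξ b x = φ x * b := rfl

lemma HomB.map_add (φ : HomB ℓ ξ) (x y : Uℓ ℓ ξ) : φ (x + y) = φ x + φ y :=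
  LinearMap.map_add (φ : Uℓ ℓ ξ →ₗ[Bneg ℓ ξ] Bneg ℓ ξ) x y

lemma HomB.map_mul (φ : HomB ℓ ξ) {b : Uℓ ℓ ξ} (hb : b ∈ Bneg ℓ ξ) (x : Uℓ ℓ ξ) :
    φ (b * x) = (⟨b, hb⟩ : Bneg ℓ ξ) * φ x :=
  LinearMap.map_smul (φ : Uℓ ℓ ξ →ₗ[Bneg ℓ ξ] Bneg ℓ ξ) (⟨b, hb⟩ : Bneg ℓ ξ) x

lemma HomB.map_smul (φ : HomB ℓ ξ) (c : ℂ) (x : Uℓ ℓ ξ) : φ (c • x) = c • φ x := by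
  rw [Algebra.smul_def, HomB.map_mul φ ((Bneg ℓ ξ).algebraMap_mem c), Algebra.smul_def]
  rfl

/-- Evaluation at `x`. -/
def HomB.eval (x : Uℓ ℓ ξ) : HomB ℓ ξ →+ Bneg ℓ ξ := AddMonoidHom.mk' (fun φ => φ x) fun _ _ => rfl

lemma HomB.eval_apply (x : Uℓ ℓ ξ) (φ : HomB ℓ ξ) : HomB.eval x φ = φ x := rfl

lemma HomB.map_sum {ι : Type*} (φ : HomB ℓ ξ) (s : Finset ι) (x : ι → Uℓ ℓ ξ) :
    φ (∑ i ∈ s, x i) = ∑ i ∈ s, φ (x i) :=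
  _root_.map_sum (AddMonoidHom.mk' φ (HomB.map_add φ)) x s

/-- A homomorphism of `B_ℓ⁻`-modules is determined by its values at `E⁽ⁿ⁾`. -/
lemma HomB.ext_E {φ ψ : HomB ℓ ξ} (h : ∀ n, φ (E ℓ ξ n) = ψ (E ℓ ξ n)) : φ = ψ := by
  refine DFunLike.ext _ _ fun x => ?_
  induction x using Uℓ_monomial_induction with
  | hmon a c x hx =>
    have hb := (Bneg ℓ ξ).mul_mem (F_mem_Bneg a) (cartanℓ_le_Bneg hx)
    rw [HomB.map_mul φ hb, HomB.map_mul ψ hb, h]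
  | hadd x y hx hy => rw [HomB.map_add, HomB.map_add, hx, hy]
  | hsmul r x hx => rw [HomB.map_smul, HomB.map_smul, hx]

lemma HomB.IsHomogeneous.smul {φ : HomB ℓ ξ} {d e : ℤ} (hφ : φ.IsHomogeneous ℓ ξ e) {u : Uℓ ℓ ξ}
    (hu : u ∈ degPart ℓ ξ d) : (u • φ).IsHomogeneous ℓ ξ (d + e) := by
  intro d' x hx
  have := hφ _ _ (mul_mem_degPart hx hu)
  rwa [add_assoc] at this

lemma HomB.IsHomogeneous.mulRight {φ : HomB ℓ ξ} {d e : ℤ} (hφ : φ.IsHomogeneous ℓ ξ e)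
    {b : Bneg ℓ ξ} (hb : (b : Uℓ ℓ ξ) ∈ degPart ℓ ξ d) :
    (φ.mulRight ℓ ξ b).IsHomogeneous ℓ ξ (e + d) := by
  intro d' x hx
  have := mul_mem_degPart (hφ _ _ hx) hb
  rwa [add_assoc] at this

lemma HomB.IsHomogeneous.mem_Semiregular {φ : HomB ℓ ξ} {e : ℤ} (hφ : φ.IsHomogeneous ℓ ξ e) :
    φ ∈ Semiregular ℓ ξ := Submodule.subset_span ⟨e, hφ⟩

/-- Every element of the semiregular module is a sum of homogeneous ones. -/
lemma Semiregular_induction {p : HomB ℓ ξ → Prop}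
    (hhom : ∀ (φ : HomB ℓ ξ) (e : ℤ), φ.IsHomogeneous ℓ ξ e → p φ) (hzero : p 0)
    (hadd : ∀ φ ψ, φ ∈ Semiregular ℓ ξ → ψ ∈ Semiregular ℓ ξ → p φ → p ψ → p (φ + ψ))
    {φ : HomB ℓ ξ} (hφ : φ ∈ Semiregular ℓ ξ) : p φ := by
  -- The `U_ℓ`-span of the homogeneous homomorphisms is no larger than their additive span, because
  -- `U_ℓ` is the sum of its graded parts.
  have hC : ∀ {φ : HomB ℓ ξ}, φ ∈ Semiregular ℓ ξ →
      φ ∈ AddSubmonoid.closure {φ : HomB ℓ ξ | ∃ e : ℤ, φ.IsHomogeneous ℓ ξ e} := by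
    intro φ hφ
    induction hφ using Submodule.span_induction with
    | mem φ hφ => exact AddSubmonoid.subset_closure hφ
    | zero => exact zero_mem _
    | add φ ψ _ _ hφ hψ => exact add_mem hφ hψ
    | smul u φ hmem hφ =>
      clear hmem
      induction hφ using AddSubmonoid.closure_induction with
      | mem φ hφ =>
        obtain ⟨e, he⟩ := hφ
        have hu := mem_iSup_degPart u
        induction hu using Submodule.iSup_induction' with
        | mem d u hu => exact AddSubmonoid.subset_closure ⟨_, he.smul hu⟩
        | zero => rw [zero_smul]; exact zero_mem _
        | add u w _ _ hu hw => rw [add_smul]; exact add_mem hu hw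
      | zero => rw [smul_zero]; exact zero_mem _
      | add φ ψ _ _ hφ hψ => rw [smul_add]; exact add_mem hφ hψ
  have hS : AddSubmonoid.closure {φ : HomB ℓ ξ | ∃ e : ℤ, φ.IsHomogeneous ℓ ξ e} ≤
      (Semiregular ℓ ξ).toAddSubmonoid := by
    rw [AddSubmonoid.closure_le]
    rintro φ ⟨e, he⟩
    exact he.mem_Semiregular
  have hφ' := hC hφ
  clear hφ
  induction hφ' using AddSubmonoid.closure_induction with
  | mem φ hφ => exact hφ.elim fun e he => hhom φ e he
  | zero => exact hzero
  | add φ ψ hφ hψ ihφ ihψ => exact hadd φ ψ (hS hφ) (hS hψ) ihφ ihψ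

lemma HomB.mulRight_add (φ : HomB ℓ ξ) (b c : Bneg ℓ ξ) :
    φ.mulRight ℓ ξ (b + c) = φ.mulRight ℓ ξ b + φ.mulRight ℓ ξ c :=
  DFunLike.ext _ _ fun z => mul_add (φ z) b c

/-- `HomB` is given only a `U_ℓ`-module structure, so complex scalars act on it through
`algebraMap`. -/
lemma HomB.mulRight_smul (φ : HomB ℓ ξ) (r : ℂ) (b : Bneg ℓ ξ) :
    φ.mulRight ℓ ξ (r • b) = algebraMap ℂ (Uℓ ℓ ξ) r • φ.mulRight ℓ ξ b := by
  refine DFunLike.ext _ _ fun z => ?_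
  rw [HomB.smul_apply, ← Algebra.commutes, ← Algebra.smul_def, HomB.map_smul]
  exact mul_smul_comm r (φ z) b

lemma HomB.mulRight_zero (φ : HomB ℓ ξ) : φ.mulRight ℓ ξ 0 = 0 :=
  DFunLike.ext _ _ fun z => mul_zero (φ z)

lemma HomB.mulRight_mul (φ : HomB ℓ ξ) (b c : Bneg ℓ ξ) :
    φ.mulRight ℓ ξ (b * c) = (φ.mulRight ℓ ξ b).mulRight ℓ ξ c :=
  DFunLike.ext _ _ fun z => (mul_assoc (φ z) b c).symm

variable (hξ : ξ ^ ℓ = 1)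

/-- If `φ` has degree `e`, then `φ(E⁽ⁿ⁾)` has degree `n + e`, and `B_ℓ⁻` has no nonzero elements of
positive degree. This is where gradedness of the homomorphisms enters. -/
lemma Semiregular_support_finite (hξ : ξ ^ ℓ = 1) {φ : HomB ℓ ξ} (hφ : φ ∈ Semiregular ℓ ξ) :
    {n | φ (E ℓ ξ n) ≠ 0}.Finite := by
  refine Semiregular_induction (p := fun φ => {n | φ (E ℓ ξ n) ≠ 0}.Finite) ?_ ?_ ?_ hφ
  · intro φ e he
    refine (Set.finite_Iic (-e).toNat).subset fun n hn => ?_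
    by_contra hne
    refine hn (Subtype.ext (eq_zero_of_mem_Bneg_of_mem_degPart hξ (d := n + e) ?_ (φ _).2
      (he _ _ (E_mem_degPart n))))
    have := not_le.mp (show ¬ n ≤ (-e).toNat from hne)
    omega
  · have : {n | (0 : HomB ℓ ξ) (E ℓ ξ n) ≠ 0} = ∅ :=
      Set.eq_empty_of_forall_notMem fun n hn => hn rfl
    rw [this]
    exact Set.finite_empty
  · intro φ ψ _ _ hφ hψ
    refine (hφ.union hψ).subset fun n hn => ?_
    by_contra hne
    simp only [Set.mem_union, Set.mem_ofPred_eq, not_or, not_not] at hne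
    exact hn (by rw [HomB.add_apply, hne.1, hne.2, add_zero])

/-- Right multiplication by a homogeneous element shifts the degree, and `B_ℓ⁻` is spanned by the
homogeneous elements `F⁽ᵃ⁾ h`. -/
lemma mulRight_mem_Semiregular (hξ : ξ ^ ℓ = 1) {φ : HomB ℓ ξ} (hφ : φ ∈ Semiregular ℓ ξ) (b : Bneg ℓ ξ) :
    φ.mulRight ℓ ξ b ∈ Semiregular ℓ ξ := by
  refine Semiregular_induction (p := fun φ => φ.mulRight ℓ ξ b ∈ Semiregular ℓ ξ) ?_ ?_ ?_ hφ
  · intro φ e he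
    -- Membership in `B_ℓ⁻` is carried inside the predicate, since the induction principle runs over
    -- elements of `U_ℓ`.
    suffices h : ∃ hb : (b : Uℓ ℓ ξ) ∈ Bneg ℓ ξ, φ.mulRight ℓ ξ ⟨b, hb⟩ ∈ Semiregular ℓ ξ from
      h.choose_spec
    refine Bneg_induction hξ (p := fun b => ∃ hb : b ∈ Bneg ℓ ξ,
      φ.mulRight ℓ ξ ⟨b, hb⟩ ∈ Semiregular ℓ ξ) ?_ ?_ ?_ b.2
    · intro a h hh
      exact ⟨(Bneg ℓ ξ).mul_mem (F_mem_Bneg a) (cartanℓ_le_Bneg hh),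
        (he.mulRight (F_mul_mem_degPart a hh)).mem_Semiregular⟩
    · rintro x y ⟨hx, hx'⟩ ⟨hy, hy'⟩
      exact ⟨add_mem hx hy, (φ.mulRight_add ⟨x, hx⟩ ⟨y, hy⟩).symm ▸ add_mem hx' hy'⟩
    · rintro r x ⟨hx, hx'⟩
      exact ⟨(Bneg ℓ ξ).smul_mem hx r,
        (φ.mulRight_smul r ⟨x, hx⟩).symm ▸ Submodule.smul_mem _ _ hx'⟩
  · have : (0 : HomB ℓ ξ).mulRight ℓ ξ b = 0 := DFunLike.ext _ _ fun z => zero_mul b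
    rw [this]
    exact zero_mem _
  · intro φ ψ _ _ hφ hψ
    have : (φ + ψ).mulRight ℓ ξ b = φ.mulRight ℓ ξ b + ψ.mulRight ℓ ξ b :=
      DFunLike.ext _ _ fun z => add_mul (φ z) (ψ z) b
    rw [this]
    exact add_mem hφ hψ

/-- The element of the semiregular module that is `1` on `E⁽ⁿ⁾` and `0` on the other `E⁽ᵐ⁾`. -/
def deltaHom (n : ℕ) : HomB ℓ ξ :=
  show Uℓ ℓ ξ →ₗ[Bneg ℓ ξ] Bneg ℓ ξ from
  { toFun := fun u => ⟨projℓ hξ n u, projℓ_mem_Bneg hξ n u⟩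
    map_add' := fun x y => Subtype.ext (map_add (projℓ hξ n) x y)
    map_smul' := fun b x => Subtype.ext (projℓ_mul_of_mem hξ n b.2 x) }

lemma deltaHom_E (n m : ℕ) : deltaHom hξ n (E ℓ ξ m) = if m = n then 1 else 0 := by
  apply Subtype.ext
  refine (projℓ_E hξ n m).trans ?_
  split_ifs <;> rfl

lemma deltaHom_mem_Semiregular (n : ℕ) : deltaHom hξ n ∈ Semiregular ℓ ξ :=
  HomB.IsHomogeneous.mem_Semiregular (e := -n) fun _ _ hx => projℓ_mem_degPart hξ n hx

/-- The kernel of the projection of the semiregular module onto the quasi-Verma module. -/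
abbrev quasiVermaKer (ℓ : ℕ) (ξ : ℂˣ) (lam : ℤ) : Submodule (Uℓ ℓ ξ) (HomB ℓ ξ) :=
  Submodule.span (Uℓ ℓ ξ)
    {ψ | ∃ φ ∈ Semiregular ℓ ξ, ∃ b : Bneg ℓ ξ,
      (b : Uℓ ℓ ξ) ∈ negKer ℓ ξ lam ∧ ψ = φ.mulRight ℓ ξ b}

/-- For a product `b g` with `g` in `negKer`, the factor `b` is absorbed into `φ`. -/
lemma mulRight_mem_quasiVermaKer (hξ : ξ ^ ℓ = 1) {lam : ℤ} {φ : HomB ℓ ξ}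
    (hφ : φ ∈ Semiregular ℓ ξ) {b : Bneg ℓ ξ} (hb : (b : Uℓ ℓ ξ) ∈ negIdeal ℓ ξ lam) :
    φ.mulRight ℓ ξ b ∈ quasiVermaKer ℓ ξ lam := by
  have hneg : ∀ {g}, g ∈ negKer ℓ ξ lam → g ∈ Bneg ℓ ξ := by
    rintro g (⟨n, -, rfl⟩ | hg | ⟨t, -, rfl⟩)
    · exact F_mem_Bneg n
    · rw [Set.mem_singleton_iff.mp hg]
      exact sub_mem K_mem_Bneg ((Bneg ℓ ξ).algebraMap_mem _)
    · exact bin_mem_Bneg _ _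
  suffices h : ∀ x ∈ negIdeal ℓ ξ lam, ∃ hx : x ∈ Bneg ℓ ξ,
      φ.mulRight ℓ ξ ⟨x, hx⟩ ∈ quasiVermaKer ℓ ξ lam from (h b hb).choose_spec
  intro x hx
  induction hx using Submodule.span_induction with
  | mem x hx =>
    obtain ⟨b, hb, g, hg, rfl⟩ := hx
    refine ⟨(Bneg ℓ ξ).mul_mem hb (hneg hg), Submodule.subset_span
      ⟨_, mulRight_mem_Semiregular hξ hφ ⟨b, hb⟩, ⟨g, hneg hg⟩, hg, ?_⟩⟩
    exact φ.mulRight_mul ⟨b, hb⟩ ⟨g, hneg hg⟩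
  | zero => exact ⟨zero_mem _, φ.mulRight_zero.symm ▸ zero_mem _⟩
  | add x y _ _ hx hy =>
    obtain ⟨hx, hx'⟩ := hx
    obtain ⟨hy, hy'⟩ := hy
    exact ⟨add_mem hx hy, (φ.mulRight_add ⟨x, hx⟩ ⟨y, hy⟩).symm ▸ add_mem hx' hy'⟩
  | smul r x _ hx =>
    obtain ⟨hx, hx'⟩ := hx
    exact ⟨(Bneg ℓ ξ).smul_mem hx r,
      (φ.mulRight_smul r ⟨x, hx⟩).symm ▸ Submodule.smul_mem _ _ hx'⟩

/-- Finite support gives `φ = ∑ δₙ · φ(E⁽ⁿ⁾)`, and each value lies in `negIdeal` when its character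
vanishes. -/
lemma mem_quasiVermaKer {lam : ℤ} {φ : HomB ℓ ξ} (hφ : φ ∈ Semiregular ℓ ξ)
    (h : ∀ n, chi hξ lam (φ (E ℓ ξ n) : Uℓ ℓ ξ) = 0) : φ ∈ quasiVermaKer ℓ ξ lam := by
  have hfin := Semiregular_support_finite hξ hφ
  have hsum : φ = ∑ n ∈ hfin.toFinset, (deltaHom hξ n).mulRight ℓ ξ (φ (E ℓ ξ n)) := by
    refine HomB.ext_E fun m => ?_
    rw [← HomB.eval_apply _ (∑ n ∈ _, _), map_sum]
    simp only [HomB.eval_apply, HomB.mulRight_apply, deltaHom_E, ite_mul, one_mul, zero_mul]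
    rw [Finset.sum_ite_eq]
    split_ifs with hm
    · rfl
    · by_contra hne
      exact hm (hfin.mem_toFinset.mpr hne)
  rw [hsum]
  exact Submodule.sum_mem _ fun n _ => mulRight_mem_quasiVermaKer hξ
    (deltaHom_mem_Semiregular hξ n) (mem_negIdeal_of_chi_eq_zero hξ (φ _).2 (h n))

/-! ### The embedding of the quasi-Verma module -/

/-- The coordinates of the image of `φ` in the Verma module of highest weight `μ`. -/
def embCoeff (μ : ℕ) (φ : HomB ℓ ξ) (m : ℕ) : ℂ :=
  if μ < m then (-1) ^ (m - (μ + 1)) * chi hξ (sDot μ) (φ (E ℓ ξ (m - (μ + 1))) : Uℓ ℓ ξ) else 0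

/-- The dual vector `δₙ` goes to `(-1)ⁿ F⁽ⁿ⁺ᵘ⁺¹⁾v`, with `u = μ`: the shift `μ + 1` matches the
weights, the sign matches the action. -/
lemma embCoeff_add (μ : ℕ) (φ : HomB ℓ ξ) (n : ℕ) : embCoeff hξ μ φ (n + (μ + 1)) =
    (-1) ^ n * chi hξ (sDot μ) (φ (E ℓ ξ n) : Uℓ ℓ ξ) := by
  rw [embCoeff, if_pos (by omega), Nat.add_sub_cancel]

lemma embCoeff_of_le {μ m : ℕ} (φ : HomB ℓ ξ) (h : m ≤ μ) : embCoeff hξ μ φ m = 0 :=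
  if_neg (not_lt.mpr h)

lemma embCoeff_support_finite (μ : ℕ) {φ : HomB ℓ ξ} (hφ : φ ∈ Semiregular ℓ ξ) :
    (Function.support (embCoeff hξ μ φ)).Finite := by
  refine ((Semiregular_support_finite hξ hφ).image (· + (μ + 1))).subset fun m hm => ?_
  have hlt : μ < m := by
    by_contra hle
    exact hm (embCoeff_of_le hξ φ (not_lt.mp hle))
  obtain ⟨n, rfl⟩ : ∃ n, m = n + (μ + 1) := ⟨m - (μ + 1), by omega⟩
  refine ⟨n, fun h0 => hm ?_, rfl⟩
  rw [embCoeff_add, h0, ZeroMemClass.coe_zero, map_zero, mul_zero]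

/-- The image in the Verma module of an element of the semiregular module. -/
def embFun (μ : ℕ) (φ : Semiregular ℓ ξ) : Verma ℓ ξ μ :=
  (vermaBasis hξ μ).repr.symm
    (Finsupp.ofSupportFinite (embCoeff hξ μ φ) (embCoeff_support_finite hξ μ φ.2))

lemma vermaCoord_embFun (μ : ℕ) (φ : Semiregular ℓ ξ) (m : ℕ) :
    vermaCoord hξ μ m (embFun hξ μ φ) = embCoeff hξ μ φ m := by
  rw [← vermaBasis_repr, embFun, LinearEquiv.apply_symm_apply]
  rfl

lemma embFun_add (μ : ℕ) (φ ψ : Semiregular ℓ ξ) :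
    embFun hξ μ (φ + ψ) = embFun hξ μ φ + embFun hξ μ ψ := by
  refine verma_ext hξ fun m => ?_
  rw [map_add, vermaCoord_embFun, vermaCoord_embFun, vermaCoord_embFun, Submodule.coe_add]
  simp only [embCoeff]
  split_ifs
  · rw [HomB.add_apply, Subalgebra.coe_add, map_add, mul_add]
  · rw [add_zero]

/-- On the left, `φ(E⁽ⁿ⁾E⁽ᵏ⁾) = [n+k; n] φ(E⁽ⁿ⁺ᵏ⁾)`; on the right, the Verma coefficient is
`[-(n+1); k] = (-1)ᵏ [n+k; k]`. -/
lemma embFun_E_smul (μ k : ℕ) (φ : Semiregular ℓ ξ) :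
    embFun hξ μ (E ℓ ξ k • φ) = E ℓ ξ k • embFun hξ μ φ := by
  refine verma_ext hξ fun m => ?_
  rw [vermaCoord_E_smul, vermaCoord_embFun, vermaCoord_embFun, Submodule.coe_smul]
  rcases le_or_gt m μ with hm | hm
  · rw [embCoeff_of_le hξ _ hm]
    rcases le_or_gt (m + k) μ with hk | hk
    · rw [embCoeff_of_le hξ _ hk, mul_zero]
    -- Here `m ≤ μ < m + k`, and the vanishing of `[μ-m; k]` is what keeps `E⁽ᵏ⁾` from leading out
    -- of the span of the vectors of index above `μ`.
    · rw [show (μ : ℤ) - m = (μ - m : ℕ) by omega, qBinAt_eq_zero (by omega), zero_mul]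
  · obtain ⟨n, rfl⟩ : ∃ n, m = n + (μ + 1) := ⟨m - (μ + 1), by omega⟩
    rw [show n + (μ + 1) + k = n + k + (μ + 1) by ring, embCoeff_add, embCoeff_add,
      HomB.smul_apply, E_mul_E, HomB.map_smul, Subalgebra.coe_smul, map_smul, smul_eq_mul]
    push_cast
    rw [show (μ : ℤ) - (n + (μ + 1)) = -(n + 1) by ring, qBinAt_neg,
      show (n : ℤ) + 1 + k - 1 = n + k by ring, qBinAt_symm, pow_add]
    have : ((-1 : ℂ) ^ k) * (-1) ^ k = 1 := by rw [← mul_pow]; simp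
    linear_combination (-(-1) ^ n * qBinAt ξ ((n : ℤ) + k) k *
      chi hξ (sDot μ) ((φ : HomB ℓ ξ) (E ℓ ξ (n + k)) : Uℓ ℓ ξ)) * this

/-- After expanding `φ(E⁽ⁿ⁾F⁽ᵏ⁾)`, the character kills all terms but `j = k`. Writing `n = k + n'`,
the surviving coefficient is `[-(μ+2+n'); k] = (-1)ᵏ [k+n'+μ+1; k]`, which is, up to that sign, the
coefficient of `F⁽ᵏ⁾` in the Verma module. -/
lemma embFun_F_smul (μ k : ℕ) (φ : Semiregular ℓ ξ) :
    embFun hξ μ (F ℓ ξ k • φ) = F ℓ ξ k • embFun hξ μ φ := by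
  have hval : ∀ n, chi hξ (sDot μ) ((F ℓ ξ k • (φ : HomB ℓ ξ)) (E ℓ ξ n) : Uℓ ℓ ξ) =
      ∑ j ∈ Finset.range (min n k + 1), chi hξ (sDot μ) (F ℓ ξ (k - j)) *
        (qBinAt ξ (sDot μ + (2 * j - n - k)) j *
          chi hξ (sDot μ) ((φ : HomB ℓ ξ) (E ℓ ξ (n - j)) : Uℓ ℓ ξ)) := by
    intro n
    rw [HomB.smul_apply, E_mul_F, HomB.map_sum, AddSubmonoidClass.coe_finsetSum, map_sum]
    refine Finset.sum_congr rfl fun j _ => ?_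
    rw [mul_assoc, HomB.map_mul _ (F_mem_Bneg _), HomB.map_mul _ (bin_mem_Bneg _ _),
      Subalgebra.coe_mul, Subalgebra.coe_mul, chi_mul hξ (F_mem_Bneg _),
      chi_mul hξ (bin_mem_Bneg _ _), chi_bin]
  refine verma_ext hξ fun m => ?_
  rw [vermaCoord_embFun, Submodule.coe_smul]
  rcases le_or_gt m μ with hm | hm
  · rw [embCoeff_of_le hξ _ hm]
    rcases lt_or_ge m k with hk | hk
    · rw [vermaCoord_F_smul_of_lt hξ hk]
    · obtain ⟨m, rfl⟩ : ∃ j, m = k + j := ⟨m - k, by omega⟩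
      rw [vermaCoord_F_smul_add, vermaCoord_embFun, embCoeff_of_le hξ _ (by omega), mul_zero]
  · obtain ⟨n, rfl⟩ : ∃ n, m = n + (μ + 1) := ⟨m - (μ + 1), by omega⟩
    rw [embCoeff_add, hval]
    -- For `n < k` the term `j = k` is absent. Correspondingly, coordinate `n + μ + 1` of `F⁽ᵏ⁾y`
    -- could only come from an index at most `μ`, where the image vanishes.
    rcases lt_or_ge n k with hk | hk
    · rw [Finset.sum_eq_zero, mul_zero]
      · rcases lt_or_ge (n + (μ + 1)) k with hk' | hk'
        · rw [vermaCoord_F_smul_of_lt hξ hk']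
        · obtain ⟨j, hj⟩ : ∃ j, n + (μ + 1) = k + j := ⟨n + (μ + 1) - k, by omega⟩
          rw [hj, vermaCoord_F_smul_add, vermaCoord_embFun, embCoeff_of_le hξ _ (by omega),
            mul_zero]
      · intro j hj
        have := Finset.mem_range.mp hj
        rw [chi_F hξ (by omega), zero_mul]
    · obtain ⟨n, rfl⟩ : ∃ j, n = k + j := ⟨n - k, by omega⟩
      rw [min_eq_right hk, Finset.sum_range_succ, Finset.sum_eq_zero, zero_add, Nat.sub_self,
        F_zero, chi_one, one_mul, add_assoc k, vermaCoord_F_smul_add, vermaCoord_embFun,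
        embCoeff_add, Nat.add_sub_cancel_left, sDot]
      · push_cast
        rw [show -(μ : ℤ) - 2 + (2 * k - (k + n) - k) = -(μ + 2 + n) by ring, qBinAt_neg,
          show (μ : ℤ) + 2 + n + k - 1 = k + (n + (μ + 1)) by ring, pow_add]
        have : ((-1 : ℂ) ^ k) * (-1) ^ k = 1 := by rw [← mul_pow]; simp
        linear_combination ((-1) ^ n * qBinAt ξ ((k : ℤ) + (n + (μ + 1))) k *
          chi hξ (-(μ : ℤ) - 2) ((φ : HomB ℓ ξ) (E ℓ ξ n) : Uℓ ℓ ξ)) * this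
      · intro j hj
        have := Finset.mem_range.mp hj
        rw [chi_F hξ (by omega), zero_mul]

/-- Weights agree: `s·μ - 2n = μ - 2(n + μ + 1)`. -/
lemma embFun_K_smul (μ : ℕ) (φ : Semiregular ℓ ξ) :
    embFun hξ μ (K ℓ ξ • φ) = K ℓ ξ • embFun hξ μ φ := by
  refine verma_ext hξ fun m => ?_
  rw [vermaCoord_K_smul, vermaCoord_embFun, vermaCoord_embFun, Submodule.coe_smul]
  rcases le_or_gt m μ with hm | hm
  · rw [embCoeff_of_le hξ _ hm, embCoeff_of_le hξ _ hm, mul_zero]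
  · obtain ⟨n, rfl⟩ : ∃ n, m = n + (μ + 1) := ⟨m - (μ + 1), by omega⟩
    rw [embCoeff_add, embCoeff_add, HomB.smul_apply, E_mul_K, HomB.map_smul, Subalgebra.coe_smul,
      map_smul, HomB.map_mul _ K_mem_Bneg, Subalgebra.coe_mul, chi_mul hξ K_mem_Bneg, chi_K,
      smul_eq_mul, show (μ : ℤ) - 2 * ((n + (μ + 1) : ℕ) : ℤ) = -(2 * (n : ℤ)) + sDot μ by
        rw [sDot]; push_cast; ring, zpow_add, Units.val_mul]
    ring

lemma embFun_Kinv_smul (μ : ℕ) (φ : Semiregular ℓ ξ) :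
    embFun hξ μ (Kinv ℓ ξ • φ) = Kinv ℓ ξ • embFun hξ μ φ := by
  have h := embFun_K_smul hξ μ (Kinv ℓ ξ • φ)
  rw [smul_smul, K_mul_Kinv, one_smul] at h
  rw [h, smul_smul, Kinv_mul_K, one_smul]

lemma embFun_algebraMap_smul (μ : ℕ) (c : ℂ) (φ : Semiregular ℓ ξ) :
    embFun hξ μ (algebraMap ℂ (Uℓ ℓ ξ) c • φ) = algebraMap ℂ (Uℓ ℓ ξ) c • embFun hξ μ φ := by
  refine verma_ext hξ fun m => ?_
  rw [algebraMap_smul (Uℓ ℓ ξ) c (embFun hξ μ φ), map_smul, vermaCoord_embFun, vermaCoord_embFun, Submodule.coe_smul]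
  simp only [embCoeff]
  split_ifs
  · rw [HomB.smul_apply, ← Algebra.commutes, ← Algebra.smul_def, HomB.map_smul,
      Subalgebra.coe_smul, map_smul, smul_eq_mul, smul_eq_mul, mul_left_comm]
  · rw [smul_zero]

end semiregular

/-! ### Kernel and image of the map from the semiregular module -/

section final
variable {ℓ : ℕ} {ξ : ℂˣ}

/-- Induction on elements of `U_ℓ`, as polynomials in the generators. -/
lemma Uℓ_generator_induction {p : Uℓ ℓ ξ → Prop} (hE : ∀ n, p (E ℓ ξ n)) (hF : ∀ n, p (F ℓ ξ n))
    (hK : p (K ℓ ξ)) (hKinv : p (Kinv ℓ ξ)) (halg : ∀ c : ℂ, p (algebraMap ℂ (Uℓ ℓ ξ) c))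
    (hadd : ∀ x y, p x → p y → p (x + y)) (hmul : ∀ x y, p x → p y → p (x * y)) (u : Uℓ ℓ ξ) :
    p u := by
  have hUA : ∀ y ∈ UA, ∀ hy : y ∈ UA, p (toUℓ ℓ ξ ⟨y, hy⟩) := by
    intro y hy
    induction hy using Algebra.adjoin_induction with
    | mem x hx =>
      intro hx'
      rcases hx with (⟨n, rfl⟩ | ⟨n, rfl⟩) | rfl | rfl
      · exact hE n
      · exact hF n
      · exact hK
      · exact hKinv
    | algebraMap r =>
      intro h
      have h1 : (⟨algebraMap A U r, h⟩ : UA) = r • (1 : UA) :=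
        Subtype.ext (Algebra.algebraMap_eq_smul_one r)
      rw [h1, toUℓ_smul, map_one, ← Algebra.algebraMap_eq_smul_one]
      exact halg _
    | add x y hx hy ihx ihy =>
      intro h
      have h1 : (⟨x + y, h⟩ : UA) = ⟨x, hx⟩ + ⟨y, hy⟩ := rfl
      rw [h1, map_add]
      exact hadd _ _ (ihx hx) (ihy hy)
    | mul x y hx hy ihx ihy =>
      intro h
      have h1 : (⟨x * y, h⟩ : UA) = ⟨x, hx⟩ * ⟨y, hy⟩ := rfl
      rw [h1, map_mul]
      exact hmul _ _ (ihx hx) (ihy hy)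
  induction u using Uℓ_induction with
  | h c y =>
    rw [Algebra.smul_def]
    exact hmul _ _ (halg c) (hUA y.1 y.2 y.2)
  | hadd x y hx hy => exact hadd x y hx hy

variable (hξ : ξ ^ ℓ = 1)

/-- The homomorphism from the semiregular module to the Verma module of highest weight `μ`. -/
def embLin (μ : ℕ) : Semiregular ℓ ξ →ₗ[Uℓ ℓ ξ] Verma ℓ ξ μ where
  toFun := embFun hξ μ
  map_add' := embFun_add hξ μ
  map_smul' u φ := by
    rw [RingHom.id_apply]
    induction u using Uℓ_generator_induction generalizing φ with
    | hE n => exact embFun_E_smul hξ μ n φ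
    | hF n => exact embFun_F_smul hξ μ n φ
    | hK => exact embFun_K_smul hξ μ φ
    | hKinv => exact embFun_Kinv_smul hξ μ φ
    | halg c => exact embFun_algebraMap_smul hξ μ c φ
    | hadd x y hx hy => rw [add_smul, embFun_add, hx, hy, add_smul]
    | hmul x y hx hy => rw [mul_smul, hx, hy, mul_smul]

lemma vermaCoord_embLin (μ : ℕ) (φ : Semiregular ℓ ξ) (m : ℕ) :
    vermaCoord hξ μ m (embLin hξ μ φ) = embCoeff hξ μ φ m := vermaCoord_embFun hξ μ φ m

lemma embLin_eq_zero_iff (μ : ℕ) (φ : Semiregular ℓ ξ) : embLin hξ μ φ = 0 ↔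
    ∀ n, chi hξ (sDot μ) ((φ : HomB ℓ ξ) (E ℓ ξ n) : Uℓ ℓ ξ) = 0 := by
  constructor
  · intro h n
    have h1 := vermaCoord_embLin hξ μ φ (n + (μ + 1))
    rw [h, map_zero, embCoeff_add] at h1
    exact (mul_eq_zero.mp h1.symm).resolve_left (pow_ne_zero _ (by norm_num))
  · intro h
    refine verma_ext hξ fun m => ?_
    rw [vermaCoord_embLin, map_zero, embCoeff]
    split_ifs
    · rw [h, mul_zero]
    · rfl

/-- Both sides consist of the `φ` whose values at all `E⁽ⁿ⁾` have character zero. This yields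
injectivity on the quasi-Verma module. -/
lemma ker_embLin (μ : ℕ) : LinearMap.ker (embLin hξ μ) =
    Submodule.comap (Semiregular ℓ ξ).subtype (quasiVermaKer ℓ ξ (sDot μ)) := by
  apply le_antisymm
  · intro φ hφ
    exact mem_quasiVermaKer hξ φ.2 ((embLin_eq_zero_iff hξ μ φ).mp (LinearMap.mem_ker.mp hφ))
  -- The span is formed in `HomB`, whereas `embLin` lives on the semiregular submodule, so the
  -- kernel is pushed forward before comparing.
  · have h : quasiVermaKer ℓ ξ (sDot μ) ≤
        (LinearMap.ker (embLin hξ μ)).map (Semiregular ℓ ξ).subtype := by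
      rw [Submodule.span_le]
      rintro _ ⟨φ, hφ, b, hb, rfl⟩
      refine ⟨⟨_, mulRight_mem_Semiregular hξ hφ b⟩, ?_, rfl⟩
      refine LinearMap.mem_ker.mpr ((embLin_eq_zero_iff hξ μ _).mpr fun n => ?_)
      change chi hξ (sDot μ) (φ.mulRight ℓ ξ b (E ℓ ξ n) : Uℓ ℓ ξ) = 0
      rw [HomB.mulRight_apply, Subalgebra.coe_mul, chi_mul hξ (φ _).2, chi_negKer hξ hb, mul_zero]
    intro φ hφ
    obtain ⟨ψ, hψ, e⟩ := h hφ
    rwa [← Subtype.ext (a1 := ψ) (a2 := φ) e]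

lemma embLin_deltaHom (μ n : ℕ) :
    embLin hξ μ ⟨deltaHom hξ n, deltaHom_mem_Semiregular hξ n⟩ =
      ((-1 : ℂ) ^ n) • vermaBasis hξ μ (n + (μ + 1)) := by
  refine verma_ext hξ fun m => ?_
  rw [vermaCoord_embLin, map_smul, vermaCoord_vermaBasis]
  rcases le_or_gt m μ with hm | hm
  · rw [embCoeff_of_le hξ _ hm, if_neg (by omega), smul_zero]
  · obtain ⟨k, rfl⟩ : ∃ k, m = k + (μ + 1) := ⟨m - (μ + 1), by omega⟩
    rw [embCoeff_add, deltaHom_E]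
    by_cases h : k = n
    · rw [h, if_pos rfl, if_pos rfl, Subalgebra.coe_one, chi_one, smul_eq_mul]
    · rw [if_neg h, if_neg (by omega), ZeroMemClass.coe_zero, map_zero, mul_zero, smul_zero]

lemma vermaBasis_mem_range_embLin {μ m : ℕ} (hm : μ < m) :
    vermaBasis hξ μ m ∈ LinearMap.range (embLin hξ μ) := by
  obtain ⟨n, rfl⟩ : ∃ n, m = n + (μ + 1) := ⟨m - (μ + 1), by omega⟩
  have h := (LinearMap.range (embLin hξ μ)).smul_mem (algebraMap ℂ (Uℓ ℓ ξ) ((-1) ^ n))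
    ⟨_, embLin_deltaHom hξ μ n⟩
  rwa [algebraMap_smul (Uℓ ℓ ξ), smul_smul, ← mul_pow, neg_one_mul, neg_neg, one_pow,
    one_smul] at h

/-- The image contains every basis vector of index above `μ`, so the remaining `μ + 1` span the
quotient. -/
lemma finiteDimensional_quotient_range_embLin (μ : ℕ) :
    FiniteDimensional ℂ (Verma ℓ ξ μ ⧸ LinearMap.range (embLin hξ μ)) := by
  let q : Verma ℓ ξ μ →ₗ[ℂ] Verma ℓ ξ μ ⧸ LinearMap.range (embLin hξ μ) :=
    (LinearMap.range (embLin hξ μ)).mkQ.restrictScalars ℂ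
  have hspan : Submodule.span ℂ ((fun n => q (vermaBasis hξ μ n)) '' Set.Iic μ) = ⊤ := by
    rw [eq_top_iff]
    rintro y -
    obtain ⟨y, rfl⟩ := Submodule.mkQ_surjective _ y
    have hle : ⊤ ≤ (Submodule.span ℂ
        ((fun n => q (vermaBasis hξ μ n)) '' Set.Iic μ)).comap q := by
      rw [← (vermaBasis hξ μ).span_eq, Submodule.span_le]
      rintro _ ⟨n, rfl⟩
      rcases le_or_gt n μ with hn | hn
      · exact Submodule.subset_span ⟨n, hn, rfl⟩
      · have h0 : q (vermaBasis hξ μ n) = 0 :=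
          (Submodule.Quotient.mk_eq_zero _).mpr (vermaBasis_mem_range_embLin hξ hn)
        exact Submodule.mem_comap.mpr (h0.symm ▸ zero_mem _)
    exact hle Submodule.mem_top
  exact ⟨Submodule.fg_def.mpr ⟨_, (Set.finite_Iic μ).image _, hspan⟩⟩

/-- The image of the quasi-Verma module is the smallest submodule of finite codimension of the
Verma module. -/
lemma range_embLin (μ : ℕ) : LinearMap.range (embLin hξ μ) =
    sInf {N : Submodule (Uℓ ℓ ξ) (Verma ℓ ξ μ) | FiniteDimensional ℂ (Verma ℓ ξ μ ⧸ N)} := by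
  apply le_antisymm
  · refine le_sInf fun N hN => ?_
    have hN' : FiniteDimensional ℂ (Verma ℓ ξ μ ⧸ N) := hN
    rintro _ ⟨φ, rfl⟩
    -- Expand in the basis: coordinates of index at most `μ` vanish, and the remaining basis vectors
    -- lie in `N`.
    rw [← (vermaBasis hξ μ).linearCombination_repr (embLin hξ μ φ), Finsupp.linearCombination_apply]
    refine (N.restrictScalars ℂ).sum_mem fun m _ => ?_
    change (vermaBasis hξ μ).repr (embLin hξ μ φ) m • vermaBasis hξ μ m ∈ N.restrictScalars ℂ
    rw [vermaBasis_repr, vermaCoord_embLin]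
    rcases le_or_gt m μ with hm | hm
    · rw [embCoeff_of_le hξ _ hm, zero_smul]
      exact zero_mem _
    · exact Submodule.smul_mem _ _ (vermaBasis_mem_of_finiteDimensional hξ N hm)
  · exact sInf_le (finiteDimensional_quotient_range_embLin hξ μ)

end final

end QuantumSl2

end

theorem mainTheorem9 (ℓ : ℕ) (hℓ : Odd ℓ) (ξ : ℂˣ) (hξ : IsPrimitiveRoot ξ ℓ) (μ : ℕ) :
    ∃ (f : QuantumSl2.QuasiVerma ℓ ξ (QuantumSl2.sDot μ) →ₗ[QuantumSl2.Uℓ ℓ ξ]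
          QuantumSl2.Verma ℓ ξ μ)
      (g : QuantumSl2.Verma ℓ ξ μ →ₗ[QuantumSl2.Uℓ ℓ ξ] QuantumSl2.Weyl ℓ ξ μ),
      Function.Injective f ∧ Function.Exact f g ∧ Function.Surjective g := by
  have h1 : ξ ^ ℓ = 1 := hξ.pow_eq_one
  have hker := QuantumSl2.ker_embLin h1 μ
  -- `f` is the map on the quotient by the kernel, and `g` is the projection onto the Weyl module,
  -- whose kernel is the image of `f` by `range_embLin`.
  refine ⟨Submodule.liftQ _ (QuantumSl2.embLin h1 μ) hker.ge, Submodule.mkQ _, ?_, ?_,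
    Submodule.mkQ_surjective _⟩
  · rw [← LinearMap.ker_eq_bot]
    exact Submodule.ker_liftQ_eq_bot _ _ _ hker.le
  · rw [LinearMap.exact_iff, Submodule.ker_mkQ, Submodule.range_liftQ]
    exact (QuantumSl2.range_embLin h1 μ).symm
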